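/- Let $N\ge 1$ and let $\Gamma_N$ be the flower graph: $N$ loops, each parameterized by $[-\pi,\pi]$, and a half-line $[0,\infty)$, all joined at a single vertex. Let $H^2(\Gamma_N)=H^2(-\pi,\pi)^N\times H^2(0,\infty)$ (real-valued), and let $H^2_{\rm NK}(\Gamma_N)$ be the subspace of those $\Phi=(\phi_1,\dots,\phi_N,\phi_0)$ satisfying the Neumann--Kirchhoff conditions $$\phi_1(\pm\pi)=\dots=\phi_N(\pm\pi)=\phi_0(0),\qquad \sum_{j=1}^N\big[\phi_j'(\pi)-\phi_j'(-\pi)\big]=\phi_0'(0).$$ For $\omega<0$, a positive single-lobe symmetric state is a $\Phi\in H^2_{\rm NK}(\Gamma_N)$ such that: (i) $\omega\Phi=-\Delta\Phi-2\Phi^3$ on every edge; (ii) $\Phi(x)>0$ at every point of $\Gamma_N$; (iii) on each loop $[-\pi,\pi]$, either the maximum is attained at exactly one point, which is internal, and the minimum is attained at the end points $\pm\pi$, or the minimum is attained at exactly one point, which is internal, and the maximum is attained at the end points $\pm\pi$; (iv) $\phi_1=\dots=\phi_N$ on $[-\pi,\pi]$. For every $\omega<0$ there exists exactly one positive single-lobe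 symmetric state $\Phi(\cdot,\omega)$ whose half-line component $\phi_0$ is monotonically decreasing on $[0,\infty)$. Each $\phi_j$, $1\le j\le N$, is even on $[-\pi,\pi]$ and strictly decreasing on $[0,\pi]$, and $\phi_0$ is strictly decreasing on $[0,\infty)$. The map $(-\infty,0)\ni\omega\mapsto\Phi(\cdot,\omega)\in H^2_{\rm NK}(\Gamma_N)$ is $C^1$, and the mass $\mu(\omega):=\|\Phi(\cdot,\omega)\|^2_{L^2(\Gamma_N)}$ is a $C^1$ strictly decreasing function of $\omega\in(-\infty,0)$ with $\mu(\omega)\to 0$ as $\omega\to 0^-$ and $\mu(\omega)\to\infty$ as $\omega\to-\infty$. -/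

import Mathlib

open Set Filter Topology MeasureTheory

noncomputable section

/-- Real-valued `L²(I)` (Lebesgue measure). -/
abbrev L2 (I : Set ℝ) : Type := Lp ℝ 2 (volume.restrict I)

/-- `v` is the weak derivative of `u` on the open set `I`. -/
def IsWeakDeriv (I : Set ℝ) (u v : L2 I) : Prop :=
  ∀ η : ℝ → ℝ, ContDiff ℝ (⊤ : ℕ∞) η → HasCompactSupport η → tsupport η ⊆ I →
    ∫ x in I, u x * deriv η x = - ∫ x in I, v x * η x

theorem integrable_mul_test (I : Set ℝ) (u : L2 I) {η : ℝ → ℝ}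
    (hη : Continuous η) (hc : HasCompactSupport η) :
    Integrable (fun x => u x * η x) (volume.restrict I) :=
  MemLp.integrable_mul (p := 2) (q := 2) (Lp.memLp u)
    ((hη.memLp_of_hasCompactSupport hc).restrict I)

theorem IsWeakDeriv.zero (I : Set ℝ) : IsWeakDeriv I 0 0 := by
  intro η _ _ _
  have h0 := Lp.coeFn_zero ℝ 2 (volume.restrict I)
  have h1 : ∫ x in I, (0 : L2 I) x * deriv η x = 0 := by
    rw [integral_congr_ae (g := fun _ => (0 : ℝ)) (by
      filter_upwards [h0] with x hx; rw [hx]; simp)]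
    simp
  have h2 : ∫ x in I, (0 : L2 I) x * η x = 0 := by
    rw [integral_congr_ae (g := fun _ => (0 : ℝ)) (by
      filter_upwards [h0] with x hx; rw [hx]; simp)]
    simp
  rw [h1, h2, neg_zero]

theorem integral_add_mul_test (I : Set ℝ) (u v : L2 I) {η : ℝ → ℝ}
    (hη : Continuous η) (hc : HasCompactSupport η) :
    ∫ x in I, (u + v) x * η x = (∫ x in I, u x * η x) + ∫ x in I, v x * η x := by
  rw [← integral_add (integrable_mul_test I u hη hc) (integrable_mul_test I v hη hc)]
  refine integral_congr_ae ?_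
  filter_upwards [Lp.coeFn_add u v] with x hx
  rw [hx, Pi.add_apply, add_mul]

theorem integral_smul_mul_test (I : Set ℝ) (c : ℝ) (u : L2 I) (η : ℝ → ℝ) :
    ∫ x in I, (c • u) x * η x = c * ∫ x in I, u x * η x := by
  rw [← integral_const_mul]
  refine integral_congr_ae ?_
  filter_upwards [Lp.coeFn_smul c u] with x hx
  rw [hx, Pi.smul_apply, smul_eq_mul, mul_assoc]

theorem IsWeakDeriv.add {I : Set ℝ} {u v u' v' : L2 I} (h : IsWeakDeriv I u v)
    (h' : IsWeakDeriv I u' v') : IsWeakDeriv I (u + u') (v + v') := by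
  intro η hη hc hs
  rw [integral_add_mul_test I u u' (hη.continuous_deriv (by simp)) hc.deriv,
    integral_add_mul_test I v v' hη.continuous hc, h η hη hc hs, h' η hη hc hs, neg_add]

theorem IsWeakDeriv.smul {I : Set ℝ} {u v : L2 I} (c : ℝ) (h : IsWeakDeriv I u v) :
    IsWeakDeriv I (c • u) (c • v) := by
  intro η hη hc hs
  rw [integral_smul_mul_test, integral_smul_mul_test, h η hη hc hs, mul_neg]

/-- The Sobolev space `H²(I)` of real-valued functions on the open interval `I`: its elements are
the triples `(u, u', u'')` in `L²(I)³` whose entries are successive weak derivatives, with the norm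
`(‖u‖² + ‖u'‖² + ‖u''‖²)^{1/2}`. -/
def H2 (I : Set ℝ) : Submodule ℝ (PiLp 2 (fun _ : Fin 3 => L2 I)) where
  carrier := {U | IsWeakDeriv I (U 0) (U 1) ∧ IsWeakDeriv I (U 1) (U 2)}
  zero_mem' := ⟨IsWeakDeriv.zero I, IsWeakDeriv.zero I⟩
  add_mem' := fun h h' => ⟨h.1.add h'.1, h.2.add h'.2⟩
  smul_mem' := fun c _ h => ⟨h.1.smul c, h.2.smul c⟩

/-- The function `u` itself. -/
def H2.fn {I : Set ℝ} (U : H2 I) : L2 I := U.1 0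

/-- The second (weak) derivative `u''`. -/
def H2.deriv2 {I : Set ℝ} (U : H2 I) : L2 I := U.1 2

/-- The interval `(-π, π)` parameterizing each loop. -/
abbrev loopI : Set ℝ := Ioo (-Real.pi) Real.pi

/-- The half-line `(0, ∞)`. -/
abbrev tailI : Set ℝ := Ioi 0

/-- `H²(Γ_N) = H²(-π,π)^N × H²(0,∞)` with its Hilbert norm. -/
abbrev H2Flower (N : ℕ) : Type :=
  WithLp 2 (PiLp 2 (fun _ : Fin N => H2 loopI) × H2 tailI)

/-- The component on the `j`-th loop. -/
def H2Flower.loop {N : ℕ} (Φ : H2Flower N) (j : Fin N) : H2 loopI := Φ.fst j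

/-- The component on the half-line. -/
def H2Flower.tail {N : ℕ} (Φ : H2Flower N) : H2 tailI := Φ.snd

/-- A function on the flower graph, edge by edge. Only the values of `loop j` on `[-π, π]` and of
`tail` on `[0, ∞)` are used. -/
structure FlowerFun (N : ℕ) where
  loop : Fin N → ℝ → ℝ
  tail : ℝ → ℝ

/-- `φ` is the representative of `Φ` that is `C¹` on each closed edge. -/
structure FlowerFun.Represents {N : ℕ} (φ : FlowerFun N) (Φ : H2Flower N) : Prop where
  loop_contDiffOn : ∀ j, ContDiffOn ℝ 1 (φ.loop j) (Icc (-Real.pi) Real.pi)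
  tail_contDiffOn : ContDiffOn ℝ 1 φ.tail (Ici 0)
  loop_ae : ∀ j, φ.loop j =ᵐ[volume.restrict loopI] (H2.fn (Φ.loop j))
  tail_ae : φ.tail =ᵐ[volume.restrict tailI] (H2.fn Φ.tail)

/-- The Neumann–Kirchhoff conditions at the vertex; `derivWithin` gives one-sided derivatives at
the end points. -/
structure FlowerFun.NeumannKirchhoff {N : ℕ} (φ : FlowerFun N) : Prop where
  right_eq : ∀ j, φ.loop j Real.pi = φ.tail 0
  left_eq : ∀ j, φ.loop j (-Real.pi) = φ.tail 0
  kirchhoff : ∑ j, (derivWithin (φ.loop j) (Icc (-Real.pi) Real.pi) Real.pi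
      - derivWithin (φ.loop j) (Icc (-Real.pi) Real.pi) (-Real.pi))
    = derivWithin φ.tail (Ici 0) 0

/-- `H²_NK(Γ_N)`: the elements of `H²(Γ_N)` satisfying the Neumann–Kirchhoff conditions. -/
def H2NK (N : ℕ) : Submodule ℝ (H2Flower N) where
  carrier := {Φ | ∃ φ : FlowerFun N, φ.Represents Φ ∧ φ.NeumannKirchhoff}
  zero_mem' := by
    have h : ∀ I : Set ℝ, (fun _ : ℝ => (0 : ℝ)) =ᵐ[volume.restrict I] ((0 : L2 I) : ℝ → ℝ) :=
      fun I => (Lp.coeFn_zero ℝ 2 (volume.restrict I)).symm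
    exact ⟨⟨fun _ _ => 0, fun _ => 0⟩,
      ⟨fun _ => contDiffOn_const, contDiffOn_const, fun _ => h _, h _⟩,
      ⟨fun _ => rfl, fun _ => rfl, by simp⟩⟩
  add_mem' := by
    rintro Φ Ψ ⟨φ, hφ, kφ⟩ ⟨ψ, hψ, kψ⟩
    have hpi : -Real.pi ≤ Real.pi := by linarith [Real.pi_pos]
    have dl : ∀ j, ∀ x ∈ Icc (-Real.pi) Real.pi,
        derivWithin (fun y => φ.loop j y + ψ.loop j y) (Icc (-Real.pi) Real.pi) x
          = derivWithin (φ.loop j) (Icc (-Real.pi) Real.pi) x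
            + derivWithin (ψ.loop j) (Icc (-Real.pi) Real.pi) x := fun j x hx =>
      derivWithin_fun_add ((hφ.loop_contDiffOn j).differentiableOn one_ne_zero x hx)
        ((hψ.loop_contDiffOn j).differentiableOn one_ne_zero x hx)
    have dt : derivWithin (fun y => φ.tail y + ψ.tail y) (Ici 0) 0
          = derivWithin φ.tail (Ici 0) 0 + derivWithin ψ.tail (Ici 0) 0 :=
      derivWithin_fun_add (hφ.tail_contDiffOn.differentiableOn one_ne_zero 0 self_mem_Ici)
        (hψ.tail_contDiffOn.differentiableOn one_ne_zero 0 self_mem_Ici)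
    refine ⟨⟨fun j y => φ.loop j y + ψ.loop j y, fun y => φ.tail y + ψ.tail y⟩,
      ⟨fun j => (hφ.loop_contDiffOn j).add (hψ.loop_contDiffOn j),
        hφ.tail_contDiffOn.add hψ.tail_contDiffOn, fun j => ?_, ?_⟩,
      ⟨fun j => ?_, fun j => ?_, ?_⟩⟩
    · exact ((hφ.loop_ae j).add (hψ.loop_ae j)).trans
        (Lp.coeFn_add (H2.fn (Φ.loop j)) (H2.fn (Ψ.loop j))).symm
    · exact (hφ.tail_ae.add hψ.tail_ae).trans (Lp.coeFn_add (H2.fn Φ.tail) (H2.fn Ψ.tail)).symm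
    · simp only [kφ.right_eq, kψ.right_eq]
    · simp only [kφ.left_eq, kψ.left_eq]
    · simp only [dt, ← kφ.kirchhoff, ← kψ.kirchhoff, ← Finset.sum_add_distrib]
      refine Finset.sum_congr rfl fun j _ => ?_
      rw [dl j _ (right_mem_Icc.2 hpi), dl j _ (left_mem_Icc.2 hpi)]
      ring
  smul_mem' := by
    rintro c Φ ⟨φ, hφ, kφ⟩
    have hpi : -Real.pi ≤ Real.pi := by linarith [Real.pi_pos]
    have dl : ∀ j, ∀ x ∈ Icc (-Real.pi) Real.pi,
        derivWithin (fun y => c * φ.loop j y) (Icc (-Real.pi) Real.pi) x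
          = c * derivWithin (φ.loop j) (Icc (-Real.pi) Real.pi) x := fun j x hx =>
      derivWithin_const_mul c ((hφ.loop_contDiffOn j).differentiableOn one_ne_zero x hx)
    have dt : derivWithin (fun y => c * φ.tail y) (Ici 0) 0
          = c * derivWithin φ.tail (Ici 0) 0 :=
      derivWithin_const_mul c (hφ.tail_contDiffOn.differentiableOn one_ne_zero 0 self_mem_Ici)
    refine ⟨⟨fun j y => c * φ.loop j y, fun y => c * φ.tail y⟩,
      ⟨fun j => contDiffOn_const.mul (hφ.loop_contDiffOn j),
        contDiffOn_const.mul hφ.tail_contDiffOn, fun j => ?_, ?_⟩,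
      ⟨fun j => ?_, fun j => ?_, ?_⟩⟩
    · exact ((hφ.loop_ae j).const_smul c).trans (Lp.coeFn_smul c (H2.fn (Φ.loop j))).symm
    · exact (hφ.tail_ae.const_smul c).trans (Lp.coeFn_smul c (H2.fn Φ.tail)).symm
    · simp only [kφ.right_eq]
    · simp only [kφ.left_eq]
    · simp only [dt, ← kφ.kirchhoff, Finset.mul_sum]
      refine Finset.sum_congr rfl fun j _ => ?_
      rw [dl j _ (right_mem_Icc.2 hpi), dl j _ (left_mem_Icc.2 hpi)]
      ring

/-- `Φ` is a strong solution of the stationary NLS equation `ω Φ = -ΔΦ - 2 Φ³`. -/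
structure StationaryNLS {N : ℕ} (ω : ℝ) (Φ : H2Flower N) : Prop where
  loop : ∀ j, ∀ᵐ x ∂(volume.restrict loopI),
    ω * (H2.fn (Φ.loop j)) x = -(H2.deriv2 (Φ.loop j)) x - 2 * (H2.fn (Φ.loop j)) x ^ 3
  tail : ∀ᵐ x ∂(volume.restrict tailI),
    ω * (H2.fn Φ.tail) x = -(H2.deriv2 Φ.tail) x - 2 * (H2.fn Φ.tail) x ^ 3

/-- The mass `Q(Φ) = ‖Φ‖²` in `L²(Γ_N)`. -/
def mass {N : ℕ} (Φ : H2Flower N) : ℝ :=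
  (∑ j, ‖(H2.fn (Φ.loop j))‖ ^ 2) + ‖(H2.fn Φ.tail)‖ ^ 2

/-- On the closed edge `[-π, π]`, either the maximum is attained at exactly one point, an internal
one, and the minimum at the end points, or the same with maximum and minimum exchanged. -/
def IsSingleLobe (f : ℝ → ℝ) : Prop :=
  (∃ m ∈ Ioo (-Real.pi) Real.pi,
    (∀ x ∈ Icc (-Real.pi) Real.pi, x ≠ m → f x < f m) ∧
    ∀ x ∈ Icc (-Real.pi) Real.pi, f (-Real.pi) ≤ f x ∧ f Real.pi ≤ f x) ∨
  (∃ m ∈ Ioo (-Real.pi) Real.pi,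
    (∀ x ∈ Icc (-Real.pi) Real.pi, x ≠ m → f m < f x) ∧
    ∀ x ∈ Icc (-Real.pi) Real.pi, f x ≤ f (-Real.pi) ∧ f x ≤ f Real.pi)

/-- `Φ ∈ H²_NK(Γ_N)`, with `C¹` representative `φ`, is a positive single-lobe symmetric state of
the stationary NLS equation with frequency `ω`. -/
structure IsPositiveSingleLobeSymmetricState {N : ℕ} (ω : ℝ) (Φ : H2NK N) (φ : FlowerFun N) :
    Prop where
  represents : φ.Represents Φ.1
  nls : StationaryNLS ω Φ.1
  loop_pos : ∀ j, ∀ x ∈ Icc (-Real.pi) Real.pi, 0 < φ.loop j x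
  tail_pos : ∀ x ∈ Ici (0 : ℝ), 0 < φ.tail x
  singleLobe : ∀ j, IsSingleLobe (φ.loop j)
  symmetric : ∀ i j, EqOn (φ.loop i) (φ.loop j) (Icc (-Real.pi) Real.pi)

end

/-! ### Weak derivatives -/

/-! Put ω = -k² and Φ(x) = k u(kx), so that every edge carries u'' = u - 2u³. On the half-line the
decaying solution is u(z) = sech(z + a). On a loop the orbits inside the separatrix are dnoidal
waves, written here with a phase θ: u² = (1 + s cos θ)/2 and θ' = 2u, which gives u' = -(s sin θ)/2.
No elliptic functions are needed. With c = 1/(2N) and sinh a = exp τ, the vertex conditions become s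
cos θ = -tanh τ and s sin θ = c / cosh τ at the end of the loop. One real parameter τ thus describes
all admissible vertex data, and c < 1 forces s < 1.

Write w(t) for u at phase t, T = ∫₀^θ dt/(2w) for the time from the centre of the loop to the
vertex, J = ∫₀^θ w dt for the squared norm of u over the loop, and M = NJ + 1 - tanh a. The loop has
half-length π exactly when kπ = T(τ), and then the mass is T M / π. The theorem therefore reduces to
three facts: T increases from 0 to ∞ (`strictMono_endTime` and its limits), the product T M is
increasing (`strictMono_endTime_mul_scaledMass`), and it tends to 0 and to ∞ at the two ends.

Both monotonicities rest on closed formulas for T' and M' in terms of J, T, s, θ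
(`hasDerivAt_endTime`, `hasDerivAt_scaledMass`), obtained by eliminating the remaining integrals
with exact derivatives. If cos θ ≤ 0, the signs follow from J > √(1 - s²) T (`loopMass_gt`), which
is a completed square. If cos θ > 0, then θ < π/2 and the integrands have a sign. M itself is not
claimed to be monotone; only the product is.

Smoothness: the phase is C¹ in (τ, z) by the inverse function theorem (`contDiff_phase`), and a C¹
family whose parameter derivatives have locally uniform square integrable majorants is a C¹ curve in
H² (`contDiff_H2NK_ofProfile`). Since T' > 0, τ is a C¹ function of ω.

Uniqueness (`exists_eq_flowerState`): weak solutions are classical up to the end points. Square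
integrability and monotonicity force zero energy on the half-line, hence a sech with a ≥ 0. The
vertex conditions fix the Cauchy data on the loop up to the sign choice left by energy conservation;
a = 0 is impossible, and for a > 0 the single-lobe condition leaves exactly one passage of the
dnoidal orbit through its maximum (`loop_eq_dnoidal`). Hence kπ = T(τ), and injectivity of T
concludes. -/

theorem integrable_mul_of_tsupport_subset {I : Set ℝ} {f η : ℝ → ℝ} (hf : ContinuousOn f I)
    (hη : Continuous η) (hc : HasCompactSupport η) (hs : tsupport η ⊆ I) :
    Integrable (f * η) volume := by
  have h : IntegrableOn (f * η) (tsupport η) volume :=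
    ((hf.mono hs).mul hη.continuousOn).integrableOn_compact hc
  rwa [integrableOn_iff_integrable_of_support_subset] at h
  exact (Function.support_mul_subset_right f η).trans (subset_tsupport η)

theorem setIntegral_mul_eq_of_tsupport_subset {I : Set ℝ} {f η : ℝ → ℝ} (hs : tsupport η ⊆ I) :
    ∫ x in I, f x * η x = ∫ x, f x * η x := by
  refine setIntegral_eq_integral_of_forall_compl_eq_zero fun x hx => ?_
  rw [image_eq_zero_of_notMem_tsupport fun h => hx (hs h), mul_zero]

theorem integral_mul_deriv_test {I : Set ℝ} {f f' : ℝ → ℝ}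
    (hf : ∀ x ∈ I, HasDerivAt f (f' x) x) (hf' : ContinuousOn f' I) {η : ℝ → ℝ}
    (hη : ContDiff ℝ (⊤ : ℕ∞) η) (hc : HasCompactSupport η) (hs : tsupport η ⊆ I) :
    ∫ x in I, f x * deriv η x = - ∫ x in I, f' x * η x := by
  have hfc : ContinuousOn f I := fun x hx => (hf x hx).continuousAt.continuousWithinAt
  have hd : Continuous (deriv η) := hη.continuous_deriv (by simp)
  have hsd : tsupport (deriv η) ⊆ I := tsupport_deriv_subset.trans hs
  rw [setIntegral_mul_eq_of_tsupport_subset hsd, setIntegral_mul_eq_of_tsupport_subset hs]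
  exact integral_mul_deriv_eq_deriv_mul_of_integrable (fun x hx => hf x (hs hx))
    (fun x _ => (hη.differentiable (by simp) x).hasDerivAt)
    (integrable_mul_of_tsupport_subset hfc hd hc.deriv hsd)
    (integrable_mul_of_tsupport_subset hf' hη.continuous hc hs)
    (integrable_mul_of_tsupport_subset hfc hη.continuous hc hs)

theorem isWeakDeriv_iff_of_ae_eq {I : Set ℝ} {u v : L2 I} {f g : ℝ → ℝ}
    (hf : f =ᵐ[volume.restrict I] u) (hg : g =ᵐ[volume.restrict I] v) :
    IsWeakDeriv I u v ↔ ∀ η : ℝ → ℝ, ContDiff ℝ (⊤ : ℕ∞) η → HasCompactSupport η →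
      tsupport η ⊆ I → ∫ x in I, f x * deriv η x = - ∫ x in I, g x * η x := by
  have h1 : ∀ θ : ℝ → ℝ, ∫ x in I, u x * θ x = ∫ x in I, f x * θ x := fun θ =>
    integral_congr_ae (by filter_upwards [hf] with x hx; rw [hx])
  have h2 : ∀ θ : ℝ → ℝ, ∫ x in I, v x * θ x = ∫ x in I, g x * θ x := fun θ =>
    integral_congr_ae (by filter_upwards [hg] with x hx; rw [hx])
  simp only [IsWeakDeriv, h1, h2]

theorem isWeakDeriv_toLp {I : Set ℝ} {f f' : ℝ → ℝ} (hf : ∀ x, HasDerivAt f (f' x) x)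
    (hc : Continuous f') (h0 : MemLp f 2 (volume.restrict I))
    (h1 : MemLp f' 2 (volume.restrict I)) : IsWeakDeriv I (h0.toLp f) (h1.toLp f') :=
  (isWeakDeriv_iff_of_ae_eq h0.coeFn_toLp.symm h1.coeFn_toLp.symm).2 fun _ hη hcs hs =>
    integral_mul_deriv_test (fun x _ => hf x) hc.continuousOn hη hcs hs

theorem L2.locallyIntegrableOn {I : Set ℝ} (u : L2 I) : LocallyIntegrableOn u I volume :=
  locallyIntegrableOn_of_locallyIntegrable_restrict
    ((Lp.memLp u).locallyIntegrable (by norm_num))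

theorem ae_restrict_eq_zero_of_forall_test {I : Set ℝ} (hI : IsOpen I) {f : ℝ → ℝ}
    (hf : LocallyIntegrableOn f I volume)
    (h : ∀ η : ℝ → ℝ, ContDiff ℝ (⊤ : ℕ∞) η → HasCompactSupport η → tsupport η ⊆ I →
      ∫ x in I, f x * η x = 0) : f =ᵐ[volume.restrict I] 0 := by
  rw [EventuallyEq, ae_restrict_iff' hI.measurableSet]
  refine hI.ae_eq_zero_of_integral_contDiff_smul_eq_zero hf fun η hη hc hs => ?_
  rw [← h η hη hc hs, setIntegral_mul_eq_of_tsupport_subset hs]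
  exact integral_congr_ae (.of_forall fun x => by simp [mul_comm])

/-- The primitive starting at the left end of the support vanishes again to the right of the support
because the mean is zero; order-connectedness keeps the convex hull of the support inside `I`. -/
theorem exists_primitive_test {I : Set ℝ} (hI : I.OrdConnected) {θ : ℝ → ℝ}
    (hθ : ContDiff ℝ (⊤ : ℕ∞) θ) (hc : HasCompactSupport θ) (hs : tsupport θ ⊆ I)
    (h0 : ∫ x, θ x = 0) : ∃ ζ : ℝ → ℝ, ContDiff ℝ (⊤ : ℕ∞) ζ ∧ HasCompactSupport ζ ∧
      tsupport ζ ⊆ I ∧ deriv ζ = θ := by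
  rcases (tsupport θ).eq_empty_or_nonempty with he | hne
  · refine ⟨0, contDiff_const, HasCompactSupport.zero, by simp [tsupport], ?_⟩
    have : θ = 0 := by simpa [tsupport_eq_empty_iff] using he
    rw [this]; exact deriv_zero
  set K := tsupport θ with hK
  have hKc : IsCompact K := hc
  set a := sInf K
  set b := sSup K
  have ha : a ∈ K := hKc.sInf_mem hne
  have hb : b ∈ K := hKc.sSup_mem hne
  have hab : Icc a b ⊆ I := hI.out (hs ha) (hs hb)
  have hz : ∀ x, x ∉ Icc a b → θ x = 0 := fun x hx => image_eq_zero_of_notMem_tsupport fun h =>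
    hx ⟨csInf_le hKc.bddBelow h, le_csSup hKc.bddAbove h⟩
  have hle : a ≤ b := csInf_le hKc.bddBelow hb
  have hd : ∀ x, HasDerivAt (fun x => ∫ t in a..x, θ t) (θ x) x := fun x =>
    intervalIntegral.integral_hasDerivAt_right (hθ.continuous.intervalIntegrable _ _)
      (hθ.continuous.stronglyMeasurableAtFilter _ _) hθ.continuous.continuousAt
  have hde : deriv (fun x => ∫ t in a..x, θ t) = θ := funext fun x => (hd x).deriv
  have hsupp : ∀ x, x ∉ Icc a b → ∫ t in a..x, θ t = 0 := by
    intro x hx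
    rcases lt_or_ge x a with h | h
    · rw [intervalIntegral.integral_symm, neg_eq_zero]
      refine intervalIntegral.integral_zero_ae ?_
      have : ∀ᵐ t : ℝ, t ≠ a := by simp [ae_iff]
      filter_upwards [this] with t hta ht
      rw [uIoc_of_le h.le] at ht
      exact hz t fun h' => hta (le_antisymm ht.2 h'.1)
    · have hbx : b < x := by
        by_contra hcon
        exact hx ⟨h, not_lt.1 hcon⟩
      rw [intervalIntegral.integral_of_le h, ← h0]
      have : ∫ t in Icc a x, θ t = ∫ t, θ t :=
        setIntegral_eq_integral_of_forall_compl_eq_zero fun t ht =>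
          hz t fun h' => ht ⟨h'.1, h'.2.trans hbx.le⟩
      rw [← this, integral_Icc_eq_integral_Ioc]
  have hts : tsupport (fun x => ∫ t in a..x, θ t) ⊆ Icc a b :=
    closure_minimal (fun x hx => by_contra fun h => hx (hsupp x h)) isClosed_Icc
  refine ⟨_, ?_, HasCompactSupport.intro isCompact_Icc hsupp, hts.trans hab, hde⟩
  rw [contDiff_infty_iff_deriv, hde]
  exact ⟨fun x => (hd x).differentiableAt, hθ⟩

/-- The lemma of du Bois-Reymond. -/
theorem exists_const_of_forall_deriv_test {I : Set ℝ} (hI : IsOpen I) (hI' : I.OrdConnected)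
    (hne : I.Nonempty) {g : ℝ → ℝ} (hg : LocallyIntegrableOn g I volume)
    (h : ∀ η : ℝ → ℝ, ContDiff ℝ (⊤ : ℕ∞) η → HasCompactSupport η → tsupport η ⊆ I →
      ∫ x in I, g x * deriv η x = 0) : ∃ c : ℝ, g =ᵐ[volume.restrict I] fun _ => c := by
  obtain ⟨x₀, hx₀⟩ := hne
  obtain ⟨η₀, hs₀, hc₀, hη₀, hr₀, h1⟩ :=
    exists_contDiff_tsupport_subset (n := ⊤) (hI.mem_nhds hx₀)
  have hm : 0 < ∫ x, η₀ x :=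
    (hη₀.continuous.integral_pos_of_hasCompactSupport_nonneg_nonzero hc₀
      (fun x => (hr₀ (mem_range_self x)).1) (x := x₀) (by rw [h1]; exact one_ne_zero))
  have hint : ∀ η : ℝ → ℝ, ContDiff ℝ (⊤ : ℕ∞) η → HasCompactSupport η → tsupport η ⊆ I →
      Integrable (fun x => g x * η x) volume := by
    intro η hη hc hs
    have h2 : IntegrableOn g (tsupport η) volume :=
      hg.integrableOn_compact_subset hs hc
    have h3 : IntegrableOn (fun x => g x * η x) (tsupport η) volume :=
      h2.mul_continuousOn hη.continuous.continuousOn hc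
    rwa [integrableOn_iff_integrable_of_support_subset] at h3
    exact (Function.support_mul_subset_right g η).trans (subset_tsupport η)
  set c := (∫ x in I, g x * η₀ x) / ∫ x, η₀ x with hcdef
  refine ⟨c, ?_⟩
  have hz : (fun x => g x - c) =ᵐ[volume.restrict I] 0 := by
    refine ae_restrict_eq_zero_of_forall_test hI
      (hg.sub (locallyIntegrableOn_const c)) fun η hη hc hs => ?_
    -- Subtracting `m * η₀` removes the mean of `η`, so the difference is the derivative of a test
    -- function and is annihilated by `g`.
    set m := (∫ x, η x) / ∫ x, η₀ x with hmdef
    have hsm : tsupport (fun x => m * η₀ x) ⊆ I :=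
      (closure_mono (Function.support_mul_subset_right (fun _ => m) η₀)).trans hs₀
    have hcm : HasCompactSupport (fun x => m * η₀ x) := hc₀.mul_left
    have hi0 := hη₀.continuous.integrable_of_hasCompactSupport (μ := volume) hc₀
    have hi := hη.continuous.integrable_of_hasCompactSupport (μ := volume) hc
    obtain ⟨ζ, hζ, hζc, hζs, hζd⟩ := exists_primitive_test hI' (θ := fun x => η x - m * η₀ x)
      (hη.sub (contDiff_const.mul hη₀)) (hc.sub hcm)
      ((tsupport_sub _ _).trans (union_subset hs hsm)) (by
        rw [integral_sub hi (hi0.const_mul m), integral_const_mul, hmdef]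
        field_simp
        ring)
    have h4 := h ζ hζ hζc hζs
    rw [hζd] at h4
    have h5 := hint η hη hc hs
    have h6 := hint η₀ hη₀ hc₀ hs₀
    have h7 : ∫ x in I, g x * η x = m * ∫ x in I, g x * η₀ x := by
      rw [← integral_const_mul, ← sub_eq_zero, ← integral_sub h5.integrableOn
        (h6.integrableOn.const_mul m), ← h4]
      refine integral_congr_ae (.of_forall fun x => ?_)
      simp only; ring
    have h8 : ∫ x in I, η x = ∫ x, η x :=
      setIntegral_eq_integral_of_forall_compl_eq_zero fun x hx =>
        image_eq_zero_of_notMem_tsupport fun h => hx (hs h)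
    calc ∫ x in I, (g x - c) * η x = ∫ x in I, (g x * η x - c * η x) := by
          simp only [sub_mul]
      _ = 0 := by
          rw [integral_sub h5.integrableOn (hi.integrableOn.const_mul c), integral_const_mul, h7,
            h8, hcdef, hmdef]
          field_simp
          ring
  filter_upwards [hz] with x hx
  simpa [sub_eq_zero] using hx

theorem IsWeakDeriv.unique {I : Set ℝ} (hI : IsOpen I) {u v w : L2 I} (hv : IsWeakDeriv I u v)
    (hw : IsWeakDeriv I u w) : v = w := by
  rw [← sub_eq_zero]
  refine Lp.ext ?_
  have h := ae_restrict_eq_zero_of_forall_test hI (L2.locallyIntegrableOn (v - w))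
    fun η hη hc hs => ?_
  · filter_upwards [h, Lp.coeFn_zero ℝ 2 (volume.restrict I)] with x h1 h2
    rw [h1, h2]
  · rw [sub_eq_add_neg, ← neg_one_smul ℝ w, integral_add_mul_test I _ _ hη.continuous hc,
      integral_smul_mul_test]
    have h1 := hv η hη hc hs
    have h2 := hw η hη hc hs
    linarith

theorem H2.ext_fn {I : Set ℝ} (hI : IsOpen I) {U V : H2 I} (h : H2.fn U = H2.fn V) : U = V := by
  have h1 : U.1 1 = V.1 1 := IsWeakDeriv.unique hI U.2.1 (by
    have := V.2.1
    rwa [show V.1 0 = U.1 0 from h.symm] at this)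
  have h2 : U.1 2 = V.1 2 := IsWeakDeriv.unique hI U.2.2 (by
    have := V.2.2
    rwa [← h1] at this)
  refine Subtype.ext (PiLp.ext fun i => ?_)
  fin_cases i
  exacts [h, h1, h2]

/-- The classical derivative and `v` give the same values against all test functions. This ties the
abstract second entry of an `H2` triple to the one-sided derivatives in the vertex conditions. -/
theorem ae_eq_derivWithin_of_contDiffOn {I : Set ℝ} (hI : IsOpen I) (hI' : Convex ℝ I)
    {u v : L2 I} (h : IsWeakDeriv I u v) {φ : ℝ → ℝ} (hφ : ContDiffOn ℝ 1 φ (closure I))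
    (hae : φ =ᵐ[volume.restrict I] u) :
    derivWithin φ (closure I) =ᵐ[volume.restrict I] v := by
  rcases I.eq_empty_or_nonempty with rfl | hne
  · simp [EventuallyEq]
  have hint : (interior (closure I)).Nonempty :=
    hne.mono (interior_maximal subset_closure hI)
  have hu : UniqueDiffOn ℝ (closure I) := uniqueDiffOn_convex hI'.closure hint
  have hc : ContinuousOn (derivWithin φ (closure I)) (closure I) :=
    hφ.continuousOn_derivWithin hu le_rfl
  have hd : ∀ x ∈ I, HasDerivAt φ (derivWithin φ (closure I) x) x := fun x hx =>
    ((hφ.differentiableOn one_ne_zero x (subset_closure hx)).hasDerivWithinAt).hasDerivAt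
      (mem_of_superset (hI.mem_nhds hx) subset_closure)
  have hloc : LocallyIntegrableOn (derivWithin φ (closure I)) I volume :=
    (hc.mono subset_closure).locallyIntegrableOn hI.measurableSet
  have hz : (fun x => derivWithin φ (closure I) x - v x) =ᵐ[volume.restrict I] 0 := by
    refine ae_restrict_eq_zero_of_forall_test hI (hloc.sub (L2.locallyIntegrableOn v))
      fun η hη hcs hs => ?_
    have h1 := (isWeakDeriv_iff_of_ae_eq hae (EventuallyEq.refl _ _)).1 h η hη hcs hs
    have h2 := integral_mul_deriv_test hd (hc.mono subset_closure) hη hcs hs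
    have h3 : IntegrableOn (fun x => derivWithin φ (closure I) x * η x) I volume :=
      (integrable_mul_of_tsupport_subset (hc.mono subset_closure) hη.continuous hcs hs).integrableOn
    simp only [sub_mul]
    rw [integral_sub h3 (integrable_mul_test I v hη.continuous hcs)]
    linarith
  filter_upwards [hz] with x hx
  simpa [sub_eq_zero] using hx

/-- A limit of the derivative at a boundary point is the one-sided derivative there. -/
theorem hasDerivWithinAt_closure_of_hasDerivAt {I : Set ℝ} (hI : IsOpen I) (hI' : Convex ℝ I)
    {f g : ℝ → ℝ} (hf : ContinuousOn f (closure I)) (hg : ContinuousOn g (closure I))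
    (h : ∀ x ∈ I, HasDerivAt f (g x) x) {x : ℝ} (hx : x ∈ closure I) :
    HasDerivWithinAt f (g x) (closure I) x := by
  refine hasFDerivWithinAt_closure_of_tendsto_fderiv
    (fun y hy => (h y hy).differentiableAt.differentiableWithinAt) hI' hI
    (fun y hy => (hf y hy).mono subset_closure) ?_
  have h1 : Tendsto g (𝓝[I] x) (𝓝 (g x)) := (hg x hx).mono subset_closure
  have h2 : Tendsto (fun y => ContinuousLinearMap.toSpanSingleton ℝ (g y)) (𝓝[I] x)
      (𝓝 (ContinuousLinearMap.toSpanSingleton ℝ (g x))) :=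
    ((ContinuousLinearMap.toSpanSingletonCLE (𝕜 := ℝ) (E := ℝ)).continuous.tendsto _).comp h1
  refine h2.congr' ?_
  filter_upwards [self_mem_nhdsWithin] with y hy
  exact (h y hy).hasFDerivAt.fderiv.symm

/-- A `C¹` representative of an `H²` function with continuous second derivative is classically
twice differentiable. -/
theorem H2.hasDerivWithinAt_derivWithin {I : Set ℝ} (hI : IsOpen I) (hI' : Convex ℝ I)
    (hne : I.Nonempty) {U : H2 I} {φ f : ℝ → ℝ} (hφ : ContDiffOn ℝ 1 φ (closure I))
    (hae : φ =ᵐ[volume.restrict I] H2.fn U) (hf : ContinuousOn f (closure I))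
    (hfae : f =ᵐ[volume.restrict I] H2.deriv2 U) {x : ℝ} (hx : x ∈ closure I) :
    HasDerivWithinAt (derivWithin φ (closure I)) (f x) (closure I) x := by
  have hint : (interior (closure I)).Nonempty :=
    hne.mono (interior_maximal subset_closure hI)
  have hu : UniqueDiffOn ℝ (closure I) := uniqueDiffOn_convex hI'.closure hint
  have hc : ContinuousOn (derivWithin φ (closure I)) (closure I) :=
    hφ.continuousOn_derivWithin hu le_rfl
  have hφ' := ae_eq_derivWithin_of_contDiffOn hI hI' U.2.1 hφ hae
  have hw := (isWeakDeriv_iff_of_ae_eq hφ' hfae).1 U.2.2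
  have hfI := hf.mono (subset_closure (s := I))
  obtain ⟨x₀, hx₀⟩ := hne
  have hW : ∀ y ∈ I, HasDerivAt (fun y => ∫ t in x₀..y, f t) (f y) y := by
    intro y hy
    have hsub : uIcc x₀ y ⊆ I := hI'.ordConnected.uIcc_subset hx₀ hy
    exact intervalIntegral.integral_hasDerivAt_right
      ((hfI.mono hsub).intervalIntegrable)
      (hfI.stronglyMeasurableAtFilter hI y hy) (hfI.continuousAt (hI.mem_nhds hy))
  have hWc : ContinuousOn (fun y => ∫ t in x₀..y, f t) I :=
    fun y hy => (hW y hy).continuousAt.continuousWithinAt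
  have hcI := hc.mono (subset_closure (s := I))
  -- The first derivative and the primitive of `f` have the same weak derivative, so they differ by
  -- a constant almost everywhere, and by continuity everywhere on `I`.
  obtain ⟨c, hcae⟩ := exists_const_of_forall_deriv_test hI hI'.ordConnected ⟨x₀, hx₀⟩
    (g := fun y => derivWithin φ (closure I) y - ∫ t in x₀..y, f t)
    ((hcI.sub hWc).locallyIntegrableOn hI.measurableSet) fun η hη hcs hs => by
      have hd : Continuous (deriv η) := hη.continuous_deriv (by simp)
      have hsd : tsupport (deriv η) ⊆ I := tsupport_deriv_subset.trans hs
      have h1 := hw η hη hcs hs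
      have h2 := integral_mul_deriv_test hW hfI hη hcs hs
      simp only [sub_mul]
      have h3 := integral_sub
        (integrable_mul_of_tsupport_subset hcI hd hcs.deriv hsd).integrableOn.integrable
        (integrable_mul_of_tsupport_subset hWc hd hcs.deriv hsd).integrableOn.integrable
        (μ := volume.restrict I)
      simp only [Pi.mul_apply] at h3
      rw [h3]
      linarith
  have heq := Measure.eqOn_open_of_ae_eq hcae hI (hcI.sub hWc) continuousOn_const
  refine hasDerivWithinAt_closure_of_hasDerivAt hI hI' hc hf (fun y hy => ?_) hx
  refine ((hW y hy).add_const c).congr_of_eventuallyEq ?_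
  filter_upwards [hI.mem_nhds hy] with z hz
  have := heq hz
  simp only at this
  linarith

/-! ### Uniqueness for second order equations -/

/-- `F` is only locally Lipschitz, but both trajectories are bounded on the compact interval, so the
Lipschitz uniqueness theorem applies to the first-order system on a common ball. -/
theorem eqOn_of_second_order_ode {F : ℝ → ℝ} (hF : ContDiff ℝ 1 F) {a b : ℝ}
    {f f' g g' : ℝ → ℝ}
    (hf : ∀ x ∈ Icc a b, HasDerivWithinAt f (f' x) (Icc a b) x)
    (hf' : ∀ x ∈ Icc a b, HasDerivWithinAt f' (F (f x)) (Icc a b) x)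
    (hg : ∀ x ∈ Icc a b, HasDerivWithinAt g (g' x) (Icc a b) x)
    (hg' : ∀ x ∈ Icc a b, HasDerivWithinAt g' (F (g x)) (Icc a b) x)
    (h : f a = g a) (h' : f' a = g' a) : EqOn f g (Icc a b) := by
  set v : ℝ × ℝ → ℝ × ℝ := fun p => (p.2, F p.1) with hv
  have hvc : ContDiff ℝ 1 v := contDiff_snd.prodMk (hF.comp contDiff_fst)
  have hfc : ContinuousOn (fun x => (f x, f' x)) (Icc a b) :=
    fun x hx => ((hf x hx).prodMk (hf' x hx)).continuousWithinAt
  have hgc : ContinuousOn (fun x => (g x, g' x)) (Icc a b) :=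
    fun x hx => ((hg x hx).prodMk (hg' x hx)).continuousWithinAt
  obtain ⟨R, hR⟩ := ((isCompact_Icc.image_of_continuousOn hfc).union
    (isCompact_Icc.image_of_continuousOn hgc)).isBounded.subset_closedBall (0 : ℝ × ℝ)
  obtain ⟨K, hK⟩ := hvc.contDiffOn.exists_lipschitzOnWith one_ne_zero
    (convex_closedBall (0 : ℝ × ℝ) R) (isCompact_closedBall _ _)
  have key : EqOn (fun x => (f x, f' x)) (fun x => (g x, g' x)) (Icc a b) := by
    refine ODE_solution_unique_of_mem_Icc_right (v := fun _ => v)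
      (s := fun _ => Metric.closedBall 0 R) (K := K) (fun _ _ => hK) hfc ?_ ?_ hgc ?_ ?_ ?_
    · intro t ht
      exact ((hf t (Ico_subset_Icc_self ht)).prodMk (hf' t (Ico_subset_Icc_self ht))).mono_of_mem_nhdsWithin
        (Icc_mem_nhdsGE_of_mem ht)
    · exact fun t ht => hR (Or.inl (mem_image_of_mem _ (Ico_subset_Icc_self ht)))
    · intro t ht
      exact ((hg t (Ico_subset_Icc_self ht)).prodMk (hg' t (Ico_subset_Icc_self ht))).mono_of_mem_nhdsWithin
        (Icc_mem_nhdsGE_of_mem ht)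
    · exact fun t ht => hR (Or.inr (mem_image_of_mem _ (Ico_subset_Icc_self ht)))
    · simp [h, h']
  exact fun x hx => congrArg Prod.fst (key hx)

/-- An autonomous equation without first-order term is invariant under reflection, which turns
terminal data into initial data. On a loop the data are prescribed at the end π. -/
theorem eqOn_of_second_order_ode_right {F : ℝ → ℝ} (hF : ContDiff ℝ 1 F) {a b : ℝ}
    {f f' g g' : ℝ → ℝ}
    (hf : ∀ x ∈ Icc a b, HasDerivWithinAt f (f' x) (Icc a b) x)
    (hf' : ∀ x ∈ Icc a b, HasDerivWithinAt f' (F (f x)) (Icc a b) x)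
    (hg : ∀ x ∈ Icc a b, HasDerivWithinAt g (g' x) (Icc a b) x)
    (hg' : ∀ x ∈ Icc a b, HasDerivWithinAt g' (F (g x)) (Icc a b) x)
    (h : f b = g b) (h' : f' b = g' b) : EqOn f g (Icc a b) := by
  have hm : MapsTo (fun x : ℝ => -x) (Icc (-b) (-a)) (Icc a b) := fun x hx =>
    ⟨by linarith [hx.2], by linarith [hx.1]⟩
  have hneg : ∀ x : ℝ, HasDerivWithinAt (fun x : ℝ => -x) (-1) (Icc (-b) (-a)) x := fun x =>
    (hasDerivAt_neg x).hasDerivWithinAt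
  have hcomp : ∀ {k : ℝ → ℝ} {d x : ℝ}, HasDerivWithinAt k d (Icc a b) (-x) →
      HasDerivWithinAt (fun x => k (-x)) (-d) (Icc (-b) (-a)) x := fun {k d x} hk =>
    (hk.comp x (hneg x) hm).congr_deriv (mul_neg_one d)
  have key := eqOn_of_second_order_ode hF (a := -b) (b := -a) (f := fun x => f (-x))
    (f' := fun x => -f' (-x)) (g := fun x => g (-x)) (g' := fun x => -g' (-x))
    (fun x hx => hcomp (hf (-x) (hm hx)))
    (fun x hx => (hcomp (hf' (-x) (hm hx))).fun_neg.congr_deriv (neg_neg _))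
    (fun x hx => hcomp (hg (-x) (hm hx)))
    (fun x hx => (hcomp (hg' (-x) (hm hx))).fun_neg.congr_deriv (neg_neg _))
    (by simpa using h) (by simpa using h')
  intro x hx
  have := key (x := -x) ⟨by linarith [hx.2], by linarith [hx.1]⟩
  simpa using this

/-! ### Integrals depending on parameters -/

theorem HasFDerivAt.hasDerivAt_left {K : ℝ × ℝ → ℝ} {L : ℝ × ℝ →L[ℝ] ℝ} {y z : ℝ}
    (h : HasFDerivAt K L (y, z)) : HasDerivAt (fun y => K (y, z)) (L (1, 0)) y :=
  HasFDerivAt.comp_hasDerivAt (f := fun y => (y, z)) y h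
    ((hasDerivAt_id y).prodMk (hasDerivAt_const y z))

theorem HasFDerivAt.hasDerivAt_right {K : ℝ × ℝ → ℝ} {L : ℝ × ℝ →L[ℝ] ℝ} {y z : ℝ}
    (h : HasFDerivAt K L (y, z)) : HasDerivAt (fun z => K (y, z)) (L (0, 1)) z :=
  HasFDerivAt.comp_hasDerivAt (f := fun z => (y, z)) z h
    ((hasDerivAt_const z y).prodMk (hasDerivAt_id z))

theorem hasFDerivAt_intervalIntegral_of_contDiff {E : Type*} [NormedAddCommGroup E]
    [NormedSpace ℝ E] [LocallyCompactSpace E] {g : E → ℝ → ℝ}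
    (hg : ContDiff ℝ 1 (Function.uncurry g)) (a b : ℝ) (p : E) :
    HasFDerivAt (fun p => ∫ t in a..b, g p t)
      (∫ t in a..b, (fderiv ℝ (Function.uncurry g) (p, t)).comp
        (ContinuousLinearMap.inl ℝ E ℝ)) p := by
  set g' : E → ℝ → E →L[ℝ] ℝ := fun p t =>
    (fderiv ℝ (Function.uncurry g) (p, t)).comp (ContinuousLinearMap.inl ℝ E ℝ) with hg'
  have hgc : Continuous (Function.uncurry g) := hg.continuous
  have hc : Continuous (Function.uncurry g') :=
    (hg.continuous_fderiv one_ne_zero).clm_comp continuous_const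
  have hd : ∀ p t, HasFDerivAt (fun p => g p t) (g' p t) p := fun p t => by
    have h1 := (hg.differentiable one_ne_zero (p, t)).hasFDerivAt
    exact HasFDerivAt.comp (f := fun e => (e, t)) p h1 (hasFDerivAt_prodMk_left p t)
  obtain ⟨K, hK, hpK⟩ := exists_compact_mem_nhds p
  obtain ⟨C, hC⟩ := (hK.prod (isCompact_uIcc (a := a) (b := b))).exists_bound_of_continuousOn
    hc.continuousOn
  refine intervalIntegral.hasFDerivAt_integral_of_dominated_of_fderiv_le (bound := fun _ => C)
    (F' := g') hpK ?_ ?_ ?_ ?_ ?_ ?_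
  · exact .of_forall fun q => (hgc.comp (Continuous.prodMk_right q)).aestronglyMeasurable
  · exact (hgc.comp (Continuous.prodMk_right p)).intervalIntegrable _ _
  · exact (hc.comp (Continuous.prodMk_right p)).aestronglyMeasurable
  · exact .of_forall fun t ht q hq => hC (q, t) ⟨hq, uIoc_subset_uIcc ht⟩
  · exact intervalIntegrable_const
  · exact .of_forall fun t _ q _ => hd q t

theorem contDiff_intervalIntegral {E : Type*} [NormedAddCommGroup E]
    [NormedSpace ℝ E] [LocallyCompactSpace E] {g : E → ℝ → ℝ}
    (hg : ContDiff ℝ 1 (Function.uncurry g)) (a b : ℝ) :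
    ContDiff ℝ 1 (fun p => ∫ t in a..b, g p t) := by
  refine contDiff_one_iff_hasFDerivAt.2
    ⟨_, ?_, hasFDerivAt_intervalIntegral_of_contDiff hg a b⟩
  refine intervalIntegral.continuous_parametric_intervalIntegral_of_continuous' ?_ a b
  exact (hg.continuous_fderiv one_ne_zero).clm_comp continuous_const

theorem hasDerivAt_intervalIntegral_of_contDiff {g g' : ℝ → ℝ → ℝ}
    (hg : ContDiff ℝ 1 (Function.uncurry g)) (hg' : ∀ τ t, HasDerivAt (fun τ => g τ t) (g' τ t) τ)
    (a b τ : ℝ) : HasDerivAt (fun τ => ∫ t in a..b, g τ t) (∫ t in a..b, g' τ t) τ := by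
  have h := (hasFDerivAt_intervalIntegral_of_contDiff hg a b τ).hasDerivAt
  refine h.congr_deriv ?_
  have hc : Continuous fun t => (fderiv ℝ (Function.uncurry g) (τ, t)).comp
      (ContinuousLinearMap.inl ℝ ℝ ℝ) :=
    ((hg.continuous_fderiv one_ne_zero).comp (Continuous.prodMk_right τ)).clm_comp continuous_const
  rw [ContinuousLinearMap.intervalIntegral_apply (hc.intervalIntegrable _ _)]
  refine intervalIntegral.integral_congr fun t _ => ?_
  have h1 := (hg.differentiable one_ne_zero (τ, t)).hasFDerivAt.hasDerivAt_left
  exact h1.unique (hg' τ t)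

/-- Rescaling to the fixed interval [0, 1] moves the variable end point into the integrand, where
differentiation under the integral applies. -/
theorem contDiff_primitive {h : ℝ → ℝ → ℝ} (hh : ContDiff ℝ 1 (Function.uncurry h)) :
    ContDiff ℝ 1 (fun p : ℝ × ℝ => ∫ t in (0 : ℝ)..p.1, h p.2 t) := by
  have h1 : ∀ p : ℝ × ℝ, ∫ t in (0 : ℝ)..p.1, h p.2 t
      = p.1 * ∫ v in (0 : ℝ)..1, h p.2 (p.1 * v) := fun p => by
    rw [intervalIntegral.mul_integral_comp_mul_left (f := h p.2), mul_zero, mul_one]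
  simp_rw [h1]
  refine contDiff_fst.mul (contDiff_intervalIntegral ?_ 0 1)
  exact hh.comp (by fun_prop : ContDiff ℝ 1 fun q : (ℝ × ℝ) × ℝ => (q.1.2, q.1.1 * q.2))

theorem hasDerivAt_primitive {h h' : ℝ → ℝ → ℝ} (hh : ContDiff ℝ 1 (Function.uncurry h))
    (hh' : ∀ τ t, HasDerivAt (fun τ => h τ t) (h' τ t) τ) {x : ℝ → ℝ} {x' τ : ℝ}
    (hx : HasDerivAt x x' τ) :
    HasDerivAt (fun τ => ∫ t in (0 : ℝ)..x τ, h τ t)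
      (x' * h τ (x τ) + ∫ t in (0 : ℝ)..x τ, h' τ t) τ := by
  set K : ℝ × ℝ → ℝ := fun p => ∫ t in (0 : ℝ)..p.1, h p.2 t with hK
  have hd : HasFDerivAt K (fderiv ℝ K (x τ, τ)) (x τ, τ) :=
    ((contDiff_primitive hh).differentiable one_ne_zero (x τ, τ)).hasFDerivAt
  have hc : Continuous (h τ) := hh.continuous.comp (Continuous.prodMk_right τ)
  have h1 : HasDerivAt (fun y => K (y, τ)) (h τ (x τ)) (x τ) :=
    intervalIntegral.integral_hasDerivAt_right (hc.intervalIntegrable _ _)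
      (hc.stronglyMeasurableAtFilter _ _) hc.continuousAt
  have h2 : HasDerivAt (fun σ => K (x τ, σ)) (∫ t in (0 : ℝ)..x τ, h' τ t) τ :=
    hasDerivAt_intervalIntegral_of_contDiff hh hh' 0 (x τ) τ
  have e1 : fderiv ℝ K (x τ, τ) (1, 0) = h τ (x τ) :=
    hd.hasDerivAt_left.unique h1
  have e2 : fderiv ℝ K (x τ, τ) (0, 1) = ∫ t in (0 : ℝ)..x τ, h' τ t :=
    hd.hasDerivAt_right.unique h2
  have h3 := HasFDerivAt.comp_hasDerivAt (f := fun τ => (x τ, τ)) τ hd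
    (hx.prodMk (hasDerivAt_id τ))
  refine h3.congr_deriv ?_
  have : ((x', (1 : ℝ)) : ℝ × ℝ) = x' • ((1 : ℝ), (0 : ℝ)) + ((0 : ℝ), (1 : ℝ)) := by simp
  rw [this, map_add, map_smul, e1, e2, smul_eq_mul]

/-- The partial derivative in the first variable. -/
noncomputable def paramDeriv (f : ℝ → ℝ → ℝ) (τ x : ℝ) : ℝ :=
  fderiv ℝ (Function.uncurry f) (τ, x) (1, 0)

theorem hasDerivAt_paramDeriv {f : ℝ → ℝ → ℝ} (hf : ContDiff ℝ 1 (Function.uncurry f)) (τ x : ℝ) :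
    HasDerivAt (fun τ => f τ x) (paramDeriv f τ x) τ :=
  (hf.differentiable one_ne_zero (τ, x)).hasFDerivAt.hasDerivAt_left

theorem continuous_paramDeriv {f : ℝ → ℝ → ℝ} (hf : ContDiff ℝ 1 (Function.uncurry f)) :
    Continuous (Function.uncurry (paramDeriv f)) :=
  (hf.continuous_fderiv one_ne_zero).clm_apply continuous_const

/-- Symmetry of the mixed second derivatives. -/
theorem hasDerivAt_paramDeriv_right {f g : ℝ → ℝ → ℝ} (hf : ContDiff ℝ 1 (Function.uncurry f))
    (hg : ContDiff ℝ 1 (Function.uncurry g)) (h : ∀ τ x, HasDerivAt (f τ) (g τ x) x) (τ x : ℝ) :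
    HasDerivAt (paramDeriv f τ) (paramDeriv g τ x) x := by
  have hgc : ∀ τ, Continuous (g τ) := fun τ => hg.continuous.comp (Continuous.prodMk_right τ)
  have hpc : Continuous (paramDeriv g τ) :=
    (continuous_paramDeriv hg).comp (Continuous.prodMk_right τ)
  have h1 : ∀ τ x, f τ x = f τ 0 + ∫ t in (0 : ℝ)..x, g τ t := fun τ x => by
    rw [intervalIntegral.integral_eq_sub_of_hasDerivAt (fun t _ => h τ t)
      ((hgc τ).intervalIntegrable _ _)]
    ring
  -- Differentiating the integral form of `h` in the parameter avoids assuming second derivatives of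
  -- `f`.
  have h2 : ∀ x, paramDeriv f τ x = paramDeriv f τ 0 + ∫ t in (0 : ℝ)..x, paramDeriv g τ t := by
    intro x
    refine (hasDerivAt_paramDeriv hf τ x).unique ?_
    simp_rw [h1 _ x]
    exact (hasDerivAt_paramDeriv hf τ 0).add
      (hasDerivAt_intervalIntegral_of_contDiff hg (hasDerivAt_paramDeriv hg) 0 x τ)
  rw [funext h2]
  exact (intervalIntegral.integral_hasDerivAt_right (hpc.intervalIntegrable _ _)
    (hpc.stronglyMeasurableAtFilter _ _) hpc.continuousAt).const_add _

/-! ### Differentiability of curves in `L²` and in subspaces -/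

/-- Dominated convergence for the squared differences, with majorant `(2 * b) ^ 2`. -/
theorem tendsto_toLp_of_dominated {X : Type*} [TopologicalSpace X] {l : Filter X}
    [l.IsCountablyGenerated] {μ : Measure ℝ} {f : X → ℝ → ℝ} {g : ℝ → ℝ}
    (hf : ∀ τ, MemLp (f τ) 2 μ) (hg : MemLp g 2 μ) {b : ℝ → ℝ} (hb : MemLp b 2 μ)
    (hfb : ∀ᶠ τ in l, ∀ᵐ x ∂μ, |f τ x| ≤ b x) (hgb : ∀ᵐ x ∂μ, |g x| ≤ b x)
    (h : ∀ᵐ x ∂μ, Tendsto (fun τ => f τ x) l (𝓝 (g x))) :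
    Tendsto (fun τ => (hf τ).toLp (f τ)) l (𝓝 (hg.toLp g)) := by
  rw [Lp.tendsto_Lp_iff_tendsto_eLpNorm'']
  have h2 : ∀ τ, eLpNorm (f τ - g) 2 μ = (∫⁻ x, ENNReal.ofReal ((f τ x - g x) ^ 2) ∂μ) ^ (1 / 2 : ℝ) := by
    intro τ
    rw [eLpNorm_eq_lintegral_rpow_enorm_toReal (by norm_num) (by norm_num)]
    congr 1
    refine lintegral_congr fun x => ?_
    simp only [ENNReal.toReal_ofNat, Pi.sub_apply]
    rw [← ofReal_norm, ENNReal.ofReal_rpow_of_nonneg (norm_nonneg _) (by norm_num)]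
    congr 1
    rw [Real.rpow_two, Real.norm_eq_abs, sq_abs]
  simp_rw [h2]
  have h3 : Tendsto (fun τ => ∫ x, (f τ x - g x) ^ 2 ∂μ) l (𝓝 (∫ _, (0 : ℝ) ∂μ)) := by
    refine tendsto_integral_filter_of_dominated_convergence (fun x => (2 * b x) ^ 2) ?_ ?_ ?_ ?_
    · exact .of_forall fun τ => ((hf τ).aestronglyMeasurable.sub hg.aestronglyMeasurable).pow 2
    · filter_upwards [hfb] with τ hτ
      filter_upwards [hτ, hgb] with x h4 h5
      rw [Real.norm_eq_abs, abs_of_nonneg (sq_nonneg _), ← sq_abs]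
      exact pow_le_pow_left₀ (abs_nonneg _) ((abs_sub _ _).trans (by linarith)) 2
    · exact (hb.const_mul 2).integrable_sq
    · filter_upwards [h] with x hx
      have := (hx.sub_const (g x)).pow 2
      simpa using this
  rw [integral_zero] at h3
  have h4 : ∀ τ, ∫⁻ x, ENNReal.ofReal ((f τ x - g x) ^ 2) ∂μ
      = ENNReal.ofReal (∫ x, (f τ x - g x) ^ 2 ∂μ) := fun τ =>
    (ofReal_integral_eq_lintegral_ofReal ((hf τ).sub hg).integrable_sq
      (.of_forall fun x => sq_nonneg _)).symm
  simp_rw [h4]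
  have h5 := (ENNReal.continuous_rpow_const (y := (1 / 2 : ℝ))).tendsto (ENNReal.ofReal 0)
  have h6 := h5.comp (ENNReal.tendsto_ofReal h3)
  simpa [Function.comp_def] using h6

/-- By the mean value inequality the difference quotients inherit the bound `b`, so their pointwise
convergence is also convergence in L². -/
theorem hasDerivAt_toLp {μ : Measure ℝ} {f f' : ℝ → ℝ → ℝ} (hf : ∀ τ, MemLp (f τ) 2 μ)
    (hf' : ∀ τ, MemLp (f' τ) 2 μ) {τ₀ : ℝ} {s : Set ℝ} (hs : s ∈ 𝓝 τ₀) (hsc : Convex ℝ s)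
    {b : ℝ → ℝ} (hb : MemLp b 2 μ) (hfb : ∀ᵐ x ∂μ, ∀ τ ∈ s, |f' τ x| ≤ b x)
    (h : ∀ τ x, HasDerivAt (fun τ => f τ x) (f' τ x) τ) :
    HasDerivAt (fun τ => (hf τ).toLp (f τ)) ((hf' τ₀).toLp (f' τ₀)) τ₀ := by
  rw [hasDerivAt_iff_tendsto_slope]
  have hq : ∀ τ, MemLp (fun x => slope (fun τ => f τ x) τ₀ τ) 2 μ := fun τ => by
    simp only [slope_def_field, div_eq_inv_mul]
    exact ((hf τ).sub (hf τ₀)).const_mul _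
  have key := tendsto_toLp_of_dominated (l := 𝓝[≠] τ₀) hq (hf' τ₀) hb ?_ ?_ ?_
  · refine key.congr fun τ => ?_
    rw [slope_def_module, ← MemLp.toLp_sub, ← MemLp.toLp_const_smul]
    refine MemLp.toLp_congr _ _ (.of_forall fun x => ?_)
    simp [slope_def_field, div_eq_inv_mul]
  · filter_upwards [mem_nhdsWithin_of_mem_nhds hs] with τ hτ
    filter_upwards [hfb] with x hx
    have := hsc.norm_image_sub_le_of_norm_hasDerivWithin_le (f := fun τ => f τ x)
      (fun σ hσ => (h σ x).hasDerivWithinAt) (fun σ hσ => hx σ hσ) (mem_of_mem_nhds hs) hτ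
    rw [slope_def_field, abs_div]
    exact div_le_of_le_mul₀ (abs_nonneg _) ((abs_nonneg _).trans (hx τ hτ)) this
  · filter_upwards [hfb] with x hx using hx τ₀ (mem_of_mem_nhds hs)
  · exact .of_forall fun x => hasDerivAt_iff_tendsto_slope.1 (h τ₀ x)

/-- The subspace need not be closed, because the derivative is given as one of its elements. -/
theorem hasDerivAt_of_coe {E : Type*} [NormedAddCommGroup E] [NormedSpace ℝ E]
    {S : Submodule ℝ E} {f : ℝ → S} {d : S} {τ : ℝ}
    (h : HasDerivAt (fun τ => (f τ : E)) (d : E) τ) : HasDerivAt f d τ := by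
  rw [hasDerivAt_iff_tendsto_slope] at h ⊢
  rw [tendsto_subtype_rng]
  refine h.congr fun σ => ?_
  simp [slope_def_module]

theorem hasDerivAt_toLp_pi {ι : Type*} [Fintype ι] {E : ι → Type*}
    [∀ i, NormedAddCommGroup (E i)] [∀ i, NormedSpace ℝ (E i)] {f : ℝ → PiLp 2 E}
    {d : PiLp 2 E} {τ : ℝ} (h : ∀ i, HasDerivAt (fun τ => f τ i) (d i) τ) : HasDerivAt f d τ := by
  have h1 : HasDerivAt (fun τ => (WithLp.ofLp (f τ))) (WithLp.ofLp d) τ := hasDerivAt_pi.2 h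
  exact ((PiLp.continuousLinearEquiv 2 ℝ E).symm.hasFDerivAt).comp_hasDerivAt τ h1

theorem hasDerivAt_toLp_prod {E F : Type*} [NormedAddCommGroup E] [NormedSpace ℝ E]
    [NormedAddCommGroup F] [NormedSpace ℝ F] {f : ℝ → WithLp 2 (E × F)}
    {d : WithLp 2 (E × F)} {τ : ℝ} (h1 : HasDerivAt (fun τ => (f τ).fst) d.fst τ)
    (h2 : HasDerivAt (fun τ => (f τ).snd) d.snd τ) : HasDerivAt f d τ := by
  have h : HasDerivAt (fun τ => (WithLp.ofLp (f τ))) (WithLp.ofLp d) τ := h1.prodMk h2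
  exact ((WithLp.prodContinuousLinearEquiv 2 ℝ E F).symm.hasFDerivAt).comp_hasDerivAt τ h

/-! ### The family of dnoidal profiles -/

/-- The modulus `s` of the dnoidal orbit `u² = (1 + s cos θ) / 2`. -/
noncomputable def modulus (c τ : ℝ) : ℝ := √(Real.sinh τ ^ 2 + c ^ 2) / Real.cosh τ

/-- The phase `θ` of the orbit at the vertex. -/
noncomputable def endPhase (c τ : ℝ) : ℝ := Real.pi / 2 + Real.arctan (Real.sinh τ / c)

/-- The dnoidal orbit as a function of the phase. -/
noncomputable def profile (c τ t : ℝ) : ℝ := √((1 + modulus c τ * Real.cos t) / 2)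

/-! ### The curve of vertex data and the orbit as a function of the phase -/

section Modulus

variable {c : ℝ} (hc : 0 < c) (hc1 : c < 1) (τ t : ℝ)

include hc

theorem sinh_sq_add_pos : 0 < Real.sinh τ ^ 2 + c ^ 2 := by positivity

theorem modulus_pos : 0 < modulus c τ :=
  div_pos (Real.sqrt_pos.2 (sinh_sq_add_pos hc τ)) (Real.cosh_pos τ)

theorem modulus_sq : modulus c τ ^ 2 = (Real.sinh τ ^ 2 + c ^ 2) / Real.cosh τ ^ 2 := by
  rw [modulus, div_pow, Real.sq_sqrt (sinh_sq_add_pos hc τ).le]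

theorem one_sub_modulus_sq : 1 - modulus c τ ^ 2 = (1 - c ^ 2) / Real.cosh τ ^ 2 := by
  have := Real.cosh_pos τ
  rw [modulus_sq hc, eq_div_iff (by positivity), sub_mul, div_mul_cancel₀ _ (by positivity)]
  rw [Real.cosh_sq]; ring

theorem cos_endPhase : Real.cos (endPhase c τ) = -(Real.sinh τ / √(Real.sinh τ ^ 2 + c ^ 2)) := by
  have h : √(1 + (Real.sinh τ / c) ^ 2) = √(Real.sinh τ ^ 2 + c ^ 2) / c := by
    rw [← Real.sqrt_sq hc.le, ← Real.sqrt_div (by positivity), Real.sqrt_sq hc.le]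
    congr 1
    field_simp
    ring
  rw [endPhase, add_comm, Real.cos_add_pi_div_two, Real.sin_arctan, h]
  have := Real.sqrt_pos.2 (sinh_sq_add_pos hc τ)
  field_simp

theorem sin_endPhase : Real.sin (endPhase c τ) = c / √(Real.sinh τ ^ 2 + c ^ 2) := by
  have h : √(1 + (Real.sinh τ / c) ^ 2) = √(Real.sinh τ ^ 2 + c ^ 2) / c := by
    rw [← Real.sqrt_sq hc.le, ← Real.sqrt_div (by positivity), Real.sqrt_sq hc.le]
    congr 1
    field_simp
    ring
  rw [endPhase, add_comm, Real.sin_add_pi_div_two, Real.cos_arctan, h, one_div_div]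

/-- With `modulus_mul_sin` this shows where the parametrisation comes from: the point (s cos θ, s
sin θ) runs over the upper half of the ellipse X² + Y²/c² = 1. -/
theorem modulus_mul_cos : modulus c τ * Real.cos (endPhase c τ) = -Real.tanh τ := by
  have := Real.sqrt_pos.2 (sinh_sq_add_pos hc τ)
  have := Real.cosh_pos τ
  rw [cos_endPhase hc, modulus, Real.tanh_eq_sinh_div_cosh]
  field_simp

theorem modulus_mul_sin : modulus c τ * Real.sin (endPhase c τ) = c / Real.cosh τ := by
  have := Real.sqrt_pos.2 (sinh_sq_add_pos hc τ)
  have := Real.cosh_pos τ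
  rw [sin_endPhase hc, modulus]
  field_simp

omit hc in
theorem endPhase_pos : 0 < endPhase c τ := by
  have := Real.neg_pi_div_two_lt_arctan (Real.sinh τ / c)
  rw [endPhase]; linarith

omit hc in
theorem endPhase_lt_pi : endPhase c τ < Real.pi := by
  have := Real.arctan_lt_pi_div_two (Real.sinh τ / c)
  rw [endPhase]; linarith

omit hc in
theorem sin_endPhase_pos : 0 < Real.sin (endPhase c τ) :=
  Real.sin_pos_of_pos_of_lt_pi (endPhase_pos τ) (endPhase_lt_pi τ)

theorem contDiff_modulus : ContDiff ℝ 1 (modulus c) := by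
  unfold modulus
  refine ContDiff.div (ContDiff.sqrt (by fun_prop) fun x => (sinh_sq_add_pos hc x).ne')
    (by fun_prop) fun x => (Real.cosh_pos x).ne'

omit hc in
theorem contDiff_endPhase : ContDiff ℝ 1 (endPhase c) := by
  unfold endPhase
  exact contDiff_const.add (Real.contDiff_arctan.comp (Real.contDiff_sinh.div_const c))

/-- Together with `hasDerivAt_modulus`: along the vertex curve θ' = sin θ / s and s' = -(1 - s²) cos
θ, where c no longer appears explicitly. This is what keeps the later formulas short. -/
theorem hasDerivAt_endPhase :
    HasDerivAt (endPhase c) (Real.sin (endPhase c τ) / modulus c τ) τ := by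
  have h := ((Real.hasDerivAt_sinh τ).div_const c).arctan.const_add (Real.pi / 2)
  refine h.congr_deriv ?_
  have h1 := sinh_sq_add_pos hc τ
  have := Real.sqrt_pos.2 h1
  have := Real.cosh_pos τ
  have h2 := Real.sq_sqrt h1.le
  rw [sin_endPhase hc, modulus]
  field_simp
  rw [h2]; ring

theorem hasDerivAt_modulus :
    HasDerivAt (modulus c) (-(1 - modulus c τ ^ 2) * Real.cos (endPhase c τ)) τ := by
  have h1 := sinh_sq_add_pos hc τ
  have h := ((((Real.hasDerivAt_sinh τ).pow 2).add_const (c ^ 2)).sqrt h1.ne').div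
    (Real.hasDerivAt_cosh τ) (Real.cosh_pos τ).ne'
  refine h.congr_deriv ?_
  have := Real.sqrt_pos.2 h1
  have := Real.cosh_pos τ
  have h2 := Real.sq_sqrt h1.le
  have h3 := Real.cosh_sq τ
  rw [cos_endPhase hc, one_sub_modulus_sq hc]
  simp only [Pi.pow_apply]
  field_simp
  rw [h2, h3]; norm_num; ring

include hc1

/-- The assumption c < 1 puts the orbit strictly inside the separatrix s = 1, so the profile never
vanishes. -/
theorem modulus_lt_one : modulus c τ < 1 := by
  have h : 0 < 1 - modulus c τ ^ 2 := by
    rw [one_sub_modulus_sq hc]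
    have := Real.cosh_pos τ
    have : 0 < 1 - c ^ 2 := by nlinarith
    positivity
  nlinarith [modulus_pos hc τ]

theorem one_sub_modulus_sq_pos : 0 < 1 - modulus c τ ^ 2 := by
  nlinarith [modulus_pos hc τ, modulus_lt_one hc hc1 τ]

theorem one_add_modulus_mul_cos_pos : 0 < (1 + modulus c τ * Real.cos t) / 2 := by
  have h1 := modulus_pos hc τ
  have h2 := modulus_lt_one hc hc1 τ
  have h3 := Real.neg_one_le_cos t
  nlinarith

theorem profile_pos : 0 < profile c τ t :=
  Real.sqrt_pos.2 (one_add_modulus_mul_cos_pos hc hc1 τ t)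

theorem profile_sq : profile c τ t ^ 2 = (1 + modulus c τ * Real.cos t) / 2 :=
  Real.sq_sqrt (one_add_modulus_mul_cos_pos hc hc1 τ t).le

theorem profile_le_one : profile c τ t ≤ 1 := by
  have h1 := profile_sq hc hc1 τ t
  have h2 := modulus_lt_one hc hc1 τ
  have h3 := Real.cos_le_one t
  have := modulus_pos hc τ
  have := profile_pos hc hc1 τ t
  nlinarith

theorem contDiff_profile : ContDiff ℝ 1 (Function.uncurry (profile c)) := by
  have h := contDiff_modulus hc
  refine ContDiff.sqrt ?_ fun x => (one_add_modulus_mul_cos_pos hc hc1 x.1 x.2).ne'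
  fun_prop

theorem continuous_profile : Continuous (profile c τ) :=
  Continuous.uncurry_left τ (contDiff_profile hc hc1).continuous

theorem hasDerivAt_profile :
    HasDerivAt (profile c τ) (-(modulus c τ * Real.sin t) / (4 * profile c τ t)) t := by
  have h := (((((Real.hasDerivAt_cos t).const_mul (modulus c τ)).const_add 1).div_const 2).sqrt
    (one_add_modulus_mul_cos_pos hc hc1 τ t).ne')
  refine h.congr_deriv ?_
  have := profile_pos hc hc1 τ t
  simp only [profile] at this ⊢
  field_simp
  norm_num

theorem hasDerivAt_profile_param : HasDerivAt (fun τ => profile c τ t)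
    (-(1 - modulus c τ ^ 2) * Real.cos (endPhase c τ) * Real.cos t / (4 * profile c τ t)) τ := by
  have h := (((((hasDerivAt_modulus hc τ).mul_const (Real.cos t)).const_add 1).div_const 2).sqrt
    (one_add_modulus_mul_cos_pos hc hc1 τ t).ne')
  refine h.congr_deriv ?_
  have := profile_pos hc hc1 τ t
  simp only [profile] at this ⊢
  field_simp
  norm_num

theorem contDiff_inv_profile :
    ContDiff ℝ 1 (Function.uncurry fun τ t => 1 / (2 * profile c τ t)) := by
  have h := contDiff_profile hc hc1
  refine contDiff_const.div (contDiff_const.mul h) fun x => ?_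
  exact (mul_pos two_pos (profile_pos hc hc1 x.1 x.2)).ne'

theorem continuous_inv_profile : Continuous fun t => 1 / (2 * profile c τ t) :=
  Continuous.uncurry_left (f := fun τ t => 1 / (2 * profile c τ t)) τ
    (contDiff_inv_profile hc hc1).continuous

theorem hasDerivAt_inv_profile_param : HasDerivAt (fun τ => 1 / (2 * profile c τ t))
    ((1 - modulus c τ ^ 2) * Real.cos (endPhase c τ) * Real.cos t / (8 * profile c τ t ^ 3)) τ := by
  have h0 := profile_pos hc hc1 τ t
  have h := (hasDerivAt_const τ (1 : ℝ)).div ((hasDerivAt_profile_param hc hc1 τ t).const_mul 2)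
    (mul_pos two_pos h0).ne'
  refine h.congr_deriv ?_
  field_simp
  ring

end Modulus

/-- The time needed to reach the phase `ψ` from the top of the dnoidal orbit. -/
noncomputable def phaseTime (c τ ψ : ℝ) : ℝ := ∫ t in (0 : ℝ)..ψ, 1 / (2 * profile c τ t)

/-! ### Time as a function of the phase -/

section PhaseTime

variable {c : ℝ} (hc : 0 < c) (hc1 : c < 1) (τ ψ : ℝ)

theorem phaseTime_zero : phaseTime c τ 0 = 0 := intervalIntegral.integral_same

include hc hc1

theorem hasDerivAt_phaseTime :
    HasDerivAt (phaseTime c τ) (1 / (2 * profile c τ ψ)) ψ :=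
  intervalIntegral.integral_hasDerivAt_right
    ((continuous_inv_profile hc hc1 τ).intervalIntegrable _ _)
    ((continuous_inv_profile hc hc1 τ).stronglyMeasurableAtFilter _ _)
    (continuous_inv_profile hc hc1 τ).continuousAt

theorem strictMono_phaseTime : StrictMono (phaseTime c τ) := by
  refine strictMono_of_hasDerivAt_pos (hasDerivAt_phaseTime hc hc1 τ) fun x => ?_
  have := profile_pos hc hc1 τ x
  positivity

theorem continuous_phaseTime : Continuous (phaseTime c τ) :=
  continuous_iff_continuousAt.2 fun x => (hasDerivAt_phaseTime hc hc1 τ x).continuousAt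

theorem half_le_inv_profile (t : ℝ) : 1 / 2 ≤ 1 / (2 * profile c τ t) := by
  have h1 := profile_pos hc hc1 τ t
  have h2 := profile_le_one hc hc1 τ t
  exact one_div_le_one_div_of_le (by positivity) (by linarith)

theorem phaseTime_sub_ge {a b : ℝ} (hab : a ≤ b) :
    (b - a) / 2 ≤ phaseTime c τ b - phaseTime c τ a := by
  have hi := (continuous_inv_profile hc hc1 τ).intervalIntegrable (μ := volume)
  rw [phaseTime, phaseTime, intervalIntegral.integral_interval_sub_left (hi _ _) (hi _ _)]
  have h : ∫ _ in a..b, (1 / 2 : ℝ) ≤ ∫ t in a..b, 1 / (2 * profile c τ t) :=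
    intervalIntegral.integral_mono_on hab intervalIntegrable_const (hi _ _)
      fun t _ => half_le_inv_profile hc hc1 τ t
  simp only [intervalIntegral.integral_const, smul_eq_mul] at h
  linarith

theorem surjective_phaseTime : Function.Surjective (phaseTime c τ) := by
  refine (continuous_phaseTime hc hc1 τ).surjective ?_ ?_
  · refine tendsto_atTop_mono' _ ?_ (tendsto_id.atTop_div_const two_pos)
    filter_upwards [eventually_ge_atTop 0] with x hx
    have := phaseTime_sub_ge hc hc1 τ hx
    rw [phaseTime_zero] at this
    simpa using this
  · refine tendsto_atBot_mono' _ ?_ (tendsto_id.atBot_div_const two_pos)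
    filter_upwards [eventually_le_atBot 0] with x hx
    have := phaseTime_sub_ge hc hc1 τ hx
    rw [phaseTime_zero] at this
    simp only [id]
    linarith

omit hc hc1 in
theorem phaseTime_neg : phaseTime c τ (-ψ) = -phaseTime c τ ψ := by
  have h := intervalIntegral.integral_comp_neg (fun t => 1 / (2 * profile c τ t)) (a := 0) (b := ψ)
  simp only [profile, Real.cos_neg, neg_zero] at h
  rw [phaseTime, phaseTime, intervalIntegral.integral_symm, neg_inj]
  simp only [profile]
  exact h.symm

end PhaseTime

/-- The phase of the dnoidal orbit as a function of time. -/
noncomputable def phase (c τ z : ℝ) : ℝ := Function.invFun (phaseTime c τ) z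

/-! ### The phase as a function of time -/

section Phase

variable {c : ℝ} (hc : 0 < c) (hc1 : c < 1) (τ ψ z : ℝ)

include hc hc1

theorem phaseTime_phase : phaseTime c τ (phase c τ z) = z :=
  Function.rightInverse_invFun (surjective_phaseTime hc hc1 τ) z

theorem phase_phaseTime : phase c τ (phaseTime c τ ψ) = ψ :=
  Function.leftInverse_invFun (strictMono_phaseTime hc hc1 τ).injective ψ

theorem phase_neg : phase c τ (-z) = -phase c τ z := by
  apply (strictMono_phaseTime hc hc1 τ).injective
  rw [phaseTime_phase hc hc1, phaseTime_neg, phaseTime_phase hc hc1]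

theorem strictMono_phase : StrictMono (phase c τ) := fun x y hxy => by
  rw [← (strictMono_phaseTime hc hc1 τ).lt_iff_lt, phaseTime_phase hc hc1,
    phaseTime_phase hc hc1]
  exact hxy

/-- The inverse function theorem for (ψ, τ) ↦ (time, τ). Injectivity of this map identifies every
local inverse with the globally defined phase. -/
theorem contDiff_phase : ContDiff ℝ 1 (Function.uncurry (phase c)) := by
  set Θ : ℝ × ℝ → ℝ × ℝ := fun p => (phaseTime c p.2 p.1, p.2) with hΘ
  have hΘc : ContDiff ℝ 1 Θ :=
    (contDiff_primitive (contDiff_inv_profile hc hc1)).prodMk contDiff_snd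
  have hinj : Function.Injective Θ := by
    rintro ⟨x, σ⟩ ⟨y, ρ⟩ h
    simp only [hΘ, Prod.mk.injEq] at h
    obtain ⟨h1, rfl⟩ := h
    rw [(strictMono_phaseTime hc hc1 σ).injective h1]
  rw [contDiff_iff_contDiffAt]
  rintro ⟨σ, z⟩
  set ψ := phase c σ z with hψ
  have hat : Θ (ψ, σ) = (z, σ) := by simp only [hΘ, hψ, phaseTime_phase hc hc1]
  set K : ℝ × ℝ → ℝ := fun p => phaseTime c p.2 p.1 with hK
  have hKd : HasFDerivAt K (fderiv ℝ K (ψ, σ)) (ψ, σ) :=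
    ((contDiff_primitive (contDiff_inv_profile hc hc1)).differentiable one_ne_zero _).hasFDerivAt
  set a := 1 / (2 * profile c σ ψ) with ha
  set b := fderiv ℝ K (ψ, σ) (0, 1) with hb
  have ha0 : a ≠ 0 := by
    have := profile_pos hc hc1 σ ψ
    positivity
  have e1 : fderiv ℝ K (ψ, σ) (1, 0) = a :=
    hKd.hasDerivAt_left.unique (hasDerivAt_phaseTime hc hc1 σ ψ)
  -- The Jacobian is triangular with rows (a, b) and (0, 1); it is invertible because a = 1/(2w) ≠
  -- 0.
  let L : (ℝ × ℝ) ≃L[ℝ] (ℝ × ℝ) := ContinuousLinearEquiv.equivOfInverse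
    (((ContinuousLinearMap.fst ℝ ℝ ℝ).smulRight a + (ContinuousLinearMap.snd ℝ ℝ ℝ).smulRight b).prod
      (ContinuousLinearMap.snd ℝ ℝ ℝ))
    (((ContinuousLinearMap.fst ℝ ℝ ℝ).smulRight a⁻¹ -
      (ContinuousLinearMap.snd ℝ ℝ ℝ).smulRight (b * a⁻¹)).prod (ContinuousLinearMap.snd ℝ ℝ ℝ))
    (fun p => by
      ext
      · simp; field_simp; ring
      · simp)
    (fun p => by
      ext
      · simp; field_simp; ring
      · simp)
  have hΘd : HasFDerivAt Θ (L : ℝ × ℝ →L[ℝ] ℝ × ℝ) (ψ, σ) := by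
    refine (hKd.prodMk hasFDerivAt_snd).congr_fderiv ?_
    refine ContinuousLinearMap.ext fun p => ?_
    have hp : p = p.1 • ((1 : ℝ), (0 : ℝ)) + p.2 • ((0 : ℝ), (1 : ℝ)) := by
      ext <;> simp
    have h1 : fderiv ℝ K (ψ, σ) p = p.1 * a + p.2 * b := by
      conv_lhs => rw [hp]
      rw [map_add, map_smul, map_smul, e1, smul_eq_mul, smul_eq_mul]
    ext
    · simp [L, h1]
    · simp [L]
  have hA : ContDiffAt ℝ 1 Θ (ψ, σ) := hΘc.contDiffAt
  have hinv := hA.to_localInverse hΘd one_ne_zero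
  have hS := hA.hasStrictFDerivAt' hΘd one_ne_zero
  have hev : ∀ᶠ y in 𝓝 (z, σ), phase c y.2 y.1 = (hA.localInverse hΘd one_ne_zero y).1 := by
    have h2 := hS.eventually_right_inverse
    rw [hat] at h2
    filter_upwards [h2] with y hy
    have h3 : Θ (phase c y.2 y.1, y.2) = y := by
      simp only [hΘ, phaseTime_phase hc hc1]
    have := hinj (h3.trans hy.symm)
    exact congrArg Prod.fst this
  rw [hat] at hinv
  have h4 : ContDiffAt ℝ 1 (fun y : ℝ × ℝ => phase c y.2 y.1) (z, σ) :=
    (contDiffAt_fst.comp _ hinv).congr_of_eventuallyEq hev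
  exact ContDiffAt.comp (g := fun y : ℝ × ℝ => phase c y.2 y.1) (f := Prod.swap) (σ, z) h4
    (contDiff_snd.prodMk contDiff_fst).contDiffAt

theorem hasDerivAt_phase :
    HasDerivAt (phase c τ) (2 * profile c τ (phase c τ z)) z := by
  have h1 : HasDerivAt (phaseTime c τ) (1 / (2 * profile c τ (phase c τ z))) (phase c τ z) :=
    hasDerivAt_phaseTime hc hc1 τ _
  have h0 := profile_pos hc hc1 τ (phase c τ z)
  have hcont : ContinuousAt (phase c τ) z :=
    ((contDiff_phase hc hc1).continuous.comp (Continuous.prodMk_right τ)).continuousAt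
  exact (h1.of_local_left_inverse hcont (by positivity)
    (.of_forall (phaseTime_phase hc hc1 τ))).congr_deriv (by field_simp)

end Phase

/-- The dnoidal wave. -/
noncomputable def dnoidal (c τ z : ℝ) : ℝ := profile c τ (phase c τ z)

/-- The derivative of the dnoidal wave. -/
noncomputable def dnoidalDeriv (c τ z : ℝ) : ℝ := -(modulus c τ * Real.sin (phase c τ z)) / 2

/-! ### The dnoidal wave as a solution of u'' = u - 2u³ -/

section Dnoidal

variable {c : ℝ} (hc : 0 < c) (hc1 : c < 1) (τ z : ℝ)

include hc hc1

theorem hasDerivAt_dnoidal : HasDerivAt (dnoidal c τ) (dnoidalDeriv c τ z) z := by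
  refine ((hasDerivAt_profile hc hc1 τ _).comp z (hasDerivAt_phase hc hc1 τ z)).congr_deriv ?_
  have := profile_pos hc hc1 τ (phase c τ z)
  rw [dnoidalDeriv]
  field_simp
  ring

/-- From u' = -(s sin θ)/2 and θ' = 2u one gets u'' = -u s cos θ, and s cos θ = 2u² - 1. -/
theorem hasDerivAt_dnoidalDeriv :
    HasDerivAt (dnoidalDeriv c τ) (dnoidal c τ z - 2 * dnoidal c τ z ^ 3) z := by
  have h := (((hasDerivAt_phase hc hc1 τ z).sin.const_mul (modulus c τ)).fun_neg).div_const 2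
  refine h.congr_deriv ?_
  have h1 := profile_sq hc hc1 τ (phase c τ z)
  have h2 : modulus c τ * Real.cos (phase c τ z) = 2 * profile c τ (phase c τ z) ^ 2 - 1 := by
    rw [h1]; ring
  rw [dnoidal]
  linear_combination (-profile c τ (phase c τ z)) * h2

theorem contDiff_dnoidal : ContDiff ℝ 1 (Function.uncurry (dnoidal c)) :=
  (contDiff_profile hc hc1).comp (contDiff_fst.prodMk (contDiff_phase hc hc1))

theorem contDiff_dnoidalDeriv : ContDiff ℝ 1 (Function.uncurry (dnoidalDeriv c)) := by
  have h1 := contDiff_modulus hc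
  have h2 := contDiff_phase hc hc1
  exact ((((h1.comp contDiff_fst).mul (Real.contDiff_sin.comp h2)).neg).div_const 2)

end Dnoidal

/-! ### Time and mass along the loop -/

/-- Half the length of the rescaled loop. -/
noncomputable def endTime (c τ : ℝ) : ℝ := phaseTime c τ (endPhase c τ)

/-- The squared `L²` norm of the dnoidal wave over the rescaled loop. -/
noncomputable def loopMass (c τ : ℝ) : ℝ := ∫ t in (0 : ℝ)..endPhase c τ, profile c τ t

/-- The shift of the solitary wave on the half-line. -/
noncomputable def tailShift (τ : ℝ) : ℝ := Real.arsinh (Real.exp τ)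

theorem contDiff_tailShift : ContDiff ℝ 1 tailShift :=
  Real.contDiff_arsinh.comp Real.contDiff_exp

theorem cosh_tailShift_sq (τ : ℝ) : Real.cosh (tailShift τ) ^ 2 = 1 + Real.exp τ ^ 2 := by
  rw [Real.cosh_sq, tailShift, Real.sinh_arsinh]; ring

theorem sinh_tailShift (τ : ℝ) : Real.sinh (tailShift τ) = Real.exp τ := Real.sinh_arsinh _

theorem tailShift_pos (τ : ℝ) : 0 < tailShift τ := Real.arsinh_pos_iff.2 (Real.exp_pos τ)

theorem hasDerivAt_tailShift (τ : ℝ) :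
    HasDerivAt tailShift (Real.tanh (tailShift τ)) τ := by
  refine (Real.hasDerivAt_exp τ).arsinh.congr_deriv ?_
  rw [Real.tanh_eq_sinh_div_cosh, sinh_tailShift, tailShift, Real.cosh_arsinh, smul_eq_mul,
    div_eq_mul_inv, mul_comm]

theorem hasDerivAt_tanh (y : ℝ) : HasDerivAt Real.tanh (1 / Real.cosh y ^ 2) y := by
  have h0 := Real.cosh_pos y
  have h1 := (Real.hasDerivAt_sinh y).div (Real.hasDerivAt_cosh y) h0.ne'
  rw [show Real.tanh = Real.sinh / Real.cosh from funext Real.tanh_eq_sinh_div_cosh]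
  refine h1.congr_deriv ?_
  congr 1
  nlinarith [Real.cosh_sq y]

theorem hasDerivAt_tanh_tailShift (τ : ℝ) : HasDerivAt (fun τ => Real.tanh (tailShift τ))
    (Real.tanh (tailShift τ) / Real.cosh (tailShift τ) ^ 2) τ :=
  ((hasDerivAt_tanh _).comp τ (hasDerivAt_tailShift τ)).congr_deriv (by ring)

/-! ### Derivatives of time and mass along the vertex curve -/

section

variable {c : ℝ} (hc : 0 < c) (hc1 : c < 1) (τ : ℝ)

include hc hc1

/-- Continuity at the vertex: both squares equal (1 - tanh τ)/2 = 1/(1 + exp 2τ). -/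
theorem profile_endPhase : profile c τ (endPhase c τ) = 1 / Real.cosh (tailShift τ) := by
  have h0 := Real.cosh_pos (tailShift τ)
  have h1 := Real.cosh_pos τ
  have h2 := Real.exp_pos τ
  rw [← sq_eq_sq₀ (profile_pos hc hc1 _ _).le (by positivity), profile_sq hc hc1,
    modulus_mul_cos hc, div_pow, cosh_tailShift_sq, Real.tanh_eq_sinh_div_cosh, Real.sinh_eq,
    Real.cosh_eq, Real.exp_neg]
  field_simp
  ring

omit hc1 in
-- For c = 1/(2N) this is the Kirchhoff condition: the two ends of each loop contribute -s sin θ in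
-- total, in rescaled units.
theorem tanh_div_cosh_tailShift : Real.tanh (tailShift τ) / Real.cosh (tailShift τ)
    = modulus c τ * Real.sin (endPhase c τ) / (2 * c) := by
  have h0 := Real.cosh_pos (tailShift τ)
  have h1 := Real.cosh_pos τ
  have h2 := Real.exp_pos τ
  rw [modulus_mul_sin hc, Real.tanh_eq_sinh_div_cosh, div_div, ← sq, cosh_tailShift_sq,
    sinh_tailShift, Real.cosh_eq, Real.exp_neg]
  field_simp
  ring

theorem endTime_pos : 0 < endTime c τ := by
  have := strictMono_phaseTime hc hc1 τ (endPhase_pos (c := c) τ)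
  rwa [phaseTime_zero] at this

theorem hasDerivAt_endTime_aux : HasDerivAt (endTime c)
    (Real.sin (endPhase c τ) / modulus c τ * (1 / (2 * profile c τ (endPhase c τ))) +
      (1 - modulus c τ ^ 2) * Real.cos (endPhase c τ) *
        ∫ t in (0 : ℝ)..endPhase c τ, Real.cos t / (8 * profile c τ t ^ 3)) τ := by
  refine (hasDerivAt_primitive (contDiff_inv_profile hc hc1)
    (hasDerivAt_inv_profile_param hc hc1) (hasDerivAt_endPhase hc τ)).congr_deriv ?_
  rw [← intervalIntegral.integral_const_mul]
  simp only [mul_div_assoc]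

theorem hasDerivAt_loopMass_aux : HasDerivAt (loopMass c)
    (Real.sin (endPhase c τ) / modulus c τ * profile c τ (endPhase c τ) +
      -(1 - modulus c τ ^ 2) * Real.cos (endPhase c τ) *
        ∫ t in (0 : ℝ)..endPhase c τ, Real.cos t / (4 * profile c τ t)) τ := by
  refine (hasDerivAt_primitive (contDiff_profile hc hc1)
    (hasDerivAt_profile_param hc hc1) (hasDerivAt_endPhase hc τ)).congr_deriv ?_
  rw [← intervalIntegral.integral_const_mul]
  simp only [mul_div_assoc]

theorem intervalIntegrable_div_profile {f : ℝ → ℝ} (hf : Continuous f) (k : ℝ) (n : ℕ) (hk : 0 < k)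
    (a b : ℝ) : IntervalIntegrable (fun t => f t / (k * profile c τ t ^ n)) volume a b := by
  refine Continuous.intervalIntegrable ?_ _ _
  exact hf.div (continuous_const.mul ((continuous_profile hc hc1 τ).pow n)) fun t =>
    (mul_pos hk (pow_pos (profile_pos hc hc1 τ t) n)).ne'

/-- Since s cos t = 2w² - 1, the integrand splits into multiples of w and 1/w, that is, into mass
and time. -/
theorem integral_cos_div_profile (ψ : ℝ) :
    modulus c τ * ∫ t in (0 : ℝ)..ψ, Real.cos t / (4 * profile c τ t)
      = ((∫ t in (0 : ℝ)..ψ, profile c τ t) - phaseTime c τ ψ) / 2 := by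
  have h1 : IntervalIntegrable (profile c τ) volume 0 ψ :=
    (continuous_profile hc hc1 τ).intervalIntegrable _ _
  have h2 : IntervalIntegrable (fun t => 1 / (2 * profile c τ t)) volume 0 ψ :=
    (continuous_inv_profile hc hc1 τ).intervalIntegrable _ _
  rw [phaseTime, ← intervalIntegral.integral_sub h1 h2, ← intervalIntegral.integral_const_mul,
    ← intervalIntegral.integral_div]
  refine intervalIntegral.integral_congr fun t _ => ?_
  have h3 := profile_pos hc hc1 τ t
  have h4 := profile_sq hc hc1 τ t
  field_simp
  rw [h4]; ring

/-- An exact derivative that trades the integral of 1/w³ for a boundary term and the integral of w.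
-/
theorem hasDerivAt_sin_div_profile (t : ℝ) :
    HasDerivAt (fun t => modulus c τ * Real.sin t / profile c τ t)
      (profile c τ t - (1 - modulus c τ ^ 2) / (4 * profile c τ t ^ 3)) t := by
  have h3 := profile_pos hc hc1 τ t
  have h4 := profile_sq hc hc1 τ t
  refine ((((Real.hasDerivAt_sin t).const_mul _).div (hasDerivAt_profile hc hc1 τ t)
    h3.ne')).congr_deriv ?_
  have h5 : modulus c τ * Real.cos t = 2 * profile c τ t ^ 2 - 1 := by rw [h4]; ring
  have h6 : modulus c τ ^ 2 * Real.sin t ^ 2 = modulus c τ ^ 2 - (2 * profile c τ t ^ 2 - 1) ^ 2 := by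
    rw [← h5, Real.sin_sq]; ring
  generalize profile c τ t = w at *
  generalize modulus c τ = s at *
  field_simp
  linear_combination 4 * w ^ 2 * h5 + h6

theorem modulus_mul_sin_div_profile (ψ : ℝ) : modulus c τ * Real.sin ψ / profile c τ ψ
    = ∫ t in (0 : ℝ)..ψ, (profile c τ t - (1 - modulus c τ ^ 2) / (4 * profile c τ t ^ 3)) := by
  rw [intervalIntegral.integral_eq_sub_of_hasDerivAt
    (fun t _ => hasDerivAt_sin_div_profile hc hc1 τ t)]
  · simp
  · exact ((continuous_profile hc hc1 τ).intervalIntegrable _ _).sub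
      (intervalIntegrable_div_profile hc hc1 τ continuous_const 4 3 (by norm_num) _ _)

theorem integral_cos_div_profile_cube (ψ : ℝ) :
    modulus c τ * (1 - modulus c τ ^ 2) * ∫ t in (0 : ℝ)..ψ, Real.cos t / (8 * profile c τ t ^ 3)
      = ((1 - modulus c τ ^ 2) * phaseTime c τ ψ - (∫ t in (0 : ℝ)..ψ, profile c τ t)
        + modulus c τ * Real.sin ψ / profile c τ ψ) / 2 := by
  have h1 : IntervalIntegrable (profile c τ) volume 0 ψ :=
    (continuous_profile hc hc1 τ).intervalIntegrable _ _
  have h2 : IntervalIntegrable (fun t => 1 / (2 * profile c τ t)) volume 0 ψ :=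
    (continuous_inv_profile hc hc1 τ).intervalIntegrable _ _
  have h3 : IntervalIntegrable
      (fun t => (1 - modulus c τ ^ 2) / (4 * profile c τ t ^ 3)) volume 0 ψ :=
    intervalIntegrable_div_profile hc hc1 τ continuous_const 4 3 (by norm_num) _ _
  rw [modulus_mul_sin_div_profile hc hc1, phaseTime, ← intervalIntegral.integral_const_mul,
    ← intervalIntegral.integral_const_mul, ← intervalIntegral.integral_sub (h2.const_mul _) h1,
    ← intervalIntegral.integral_add ((h2.const_mul _).sub h1) (h1.sub h3),
    ← intervalIntegral.integral_div]
  refine intervalIntegral.integral_congr fun t _ => ?_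
  have h3 := profile_pos hc hc1 τ t
  have h4 := profile_sq hc hc1 τ t
  have h5 : modulus c τ * Real.cos t = 2 * profile c τ t ^ 2 - 1 := by rw [h4]; ring
  generalize profile c τ t = w at *
  generalize modulus c τ = s at *
  field_simp
  linear_combination 16 * (1 - s ^ 2) * h5

/-- The Leibniz rule leaves the integral of cos t / w³; eliminating it with
`integral_cos_div_profile_cube` expresses T' by J and T alone. -/
theorem hasDerivAt_endTime : HasDerivAt (endTime c)
    ((Real.sin (endPhase c τ) * profile c τ (endPhase c τ) -
      Real.cos (endPhase c τ) / 2 * (loopMass c τ - (1 - modulus c τ ^ 2) * endTime c τ)) /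
        modulus c τ) τ := by
  refine (hasDerivAt_endTime_aux hc hc1 τ).congr_deriv ?_
  have h1 := integral_cos_div_profile_cube hc hc1 τ (endPhase c τ)
  have hs := modulus_pos hc τ
  have hp := profile_pos hc hc1 τ (endPhase c τ)
  have h4 := profile_sq hc hc1 τ (endPhase c τ)
  rw [loopMass, endTime]
  generalize (∫ t in (0 : ℝ)..endPhase c τ, Real.cos t / (8 * profile c τ t ^ 3)) = G at *
  generalize (∫ t in (0 : ℝ)..endPhase c τ, profile c τ t) = J at *
  generalize phaseTime c τ (endPhase c τ) = T at *
  generalize profile c τ (endPhase c τ) = p at *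
  generalize modulus c τ = s at *
  generalize Real.sin (endPhase c τ) = sn at *
  generalize Real.cos (endPhase c τ) = cn at *
  field_simp at h1 ⊢
  linear_combination cn * h1 - sn * 2 * h4

/-- The rescaled mass of the state. -/
noncomputable def scaledMass (n τ : ℝ) : ℝ :=
  n * loopMass (1 / (2 * n)) τ + (1 - Real.tanh (tailShift τ))

omit hc hc1

/-- The vertex conditions turn the derivative of the tail mass into -n s sin θ w(θ). Added to the
boundary term n sin θ w(θ) / s of the loops, it produces the common factor (1 - s²)/s. -/
theorem hasDerivAt_scaledMass {n : ℝ} (hn : 1 ≤ n) : HasDerivAt (scaledMass n)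
    (n * (1 - modulus (1 / (2 * n)) τ ^ 2) / modulus (1 / (2 * n)) τ *
      (Real.sin (endPhase (1 / (2 * n)) τ) * profile (1 / (2 * n)) τ (endPhase (1 / (2 * n)) τ) -
      Real.cos (endPhase (1 / (2 * n)) τ) / 2 *
        (loopMass (1 / (2 * n)) τ - endTime (1 / (2 * n)) τ))) τ := by
  have hn0 : 0 < n := by linarith
  have hc : 0 < 1 / (2 * n) := by positivity
  have hc1 : 1 / (2 * n) < 1 := by rw [div_lt_one (by positivity)]; linarith
  refine (((hasDerivAt_loopMass_aux hc hc1 τ).const_mul n).add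
    ((hasDerivAt_tanh_tailShift τ).const_sub 1)).congr_deriv ?_
  have h1 := integral_cos_div_profile hc hc1 τ (endPhase (1 / (2 * n)) τ)
  have h2 := tanh_div_cosh_tailShift hc τ
  have h3 := profile_endPhase hc hc1 τ
  have hs := modulus_pos hc τ
  have h5 : Real.tanh (tailShift τ) / Real.cosh (tailShift τ) ^ 2 =
      n * modulus (1 / (2 * n)) τ * Real.sin (endPhase (1 / (2 * n)) τ)
        * profile (1 / (2 * n)) τ (endPhase (1 / (2 * n)) τ) := by
    rw [h3, sq, ← div_div, h2]
    field_simp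
  rw [h5, loopMass, endTime]
  generalize 1 / (2 * n) = c at *
  generalize (∫ t in (0 : ℝ)..endPhase c τ, Real.cos t / (4 * profile c τ t)) = G at *
  generalize (∫ t in (0 : ℝ)..endPhase c τ, profile c τ t) = J at *
  generalize phaseTime c τ (endPhase c τ) = T at *
  generalize profile c τ (endPhase c τ) = p at *
  generalize modulus c τ = s at *
  generalize Real.sin (endPhase c τ) = sn at *
  generalize Real.cos (endPhase c τ) = cn at *
  field_simp at h1 ⊢
  linear_combination -cn * (1 - s ^ 2) * h1

include hc hc1

/-- With d = √(1 - s²), the pointwise inequality w + d²/(4w³) ≥ d/w integrates, through the exact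
derivative of s sin t / w, to 2J - 2dT ≥ s sin θ / w(θ) > 0. -/
theorem loopMass_gt : √(1 - modulus c τ ^ 2) * endTime c τ < loopMass c τ := by
  have hd := one_sub_modulus_sq_pos hc hc1 τ
  set d := √(1 - modulus c τ ^ 2) with hd'
  have hd2 : d ^ 2 = 1 - modulus c τ ^ 2 := Real.sq_sqrt hd.le
  have h1 : IntervalIntegrable (profile c τ) volume 0 (endPhase c τ) :=
    (continuous_profile hc hc1 τ).intervalIntegrable _ _
  have h2 : IntervalIntegrable (fun t => 1 / (2 * profile c τ t)) volume 0 (endPhase c τ) :=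
    (continuous_inv_profile hc hc1 τ).intervalIntegrable _ _
  have h3 : IntervalIntegrable
      (fun t => (1 - modulus c τ ^ 2) / (4 * profile c τ t ^ 3)) volume 0 (endPhase c τ) :=
    intervalIntegrable_div_profile hc hc1 τ continuous_const 4 3 (by norm_num) _ _
  have h4 := intervalIntegral.integral_mono_on (endPhase_pos (c := c) τ).le (h1.sub h3)
    ((h1.const_mul 2).sub (h2.const_mul (2 * d))) fun t _ => by
      have h5 := profile_pos hc hc1 τ t
      rw [← hd2]
      generalize profile c τ t = w at *
      have : 2 * w - 2 * d * (1 / (2 * w)) - (w - d ^ 2 / (4 * w ^ 3))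
        = (w ^ 2 - d / 2) ^ 2 / w ^ 3 := by field_simp; ring
      have h6 : 0 ≤ (w ^ 2 - d / 2) ^ 2 / w ^ 3 := by positivity
      linarith
  rw [← modulus_mul_sin_div_profile hc hc1, intervalIntegral.integral_sub (h1.const_mul 2)
    (h2.const_mul (2 * d)), intervalIntegral.integral_const_mul,
    intervalIntegral.integral_const_mul] at h4
  have h5 : 0 < modulus c τ * Real.sin (endPhase c τ) / profile c τ (endPhase c τ) :=
    div_pos (mul_pos (modulus_pos hc τ) (sin_endPhase_pos τ)) (profile_pos hc hc1 _ _)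
  rw [endTime, loopMass, phaseTime]
  linarith

omit hc hc1 in
theorem endPhase_lt_of_cos_pos (h : 0 < Real.cos (endPhase c τ)) : endPhase c τ < Real.pi / 2 := by
  by_contra hcon
  exact h.not_ge (Real.cos_nonpos_of_pi_div_two_le_of_le (not_lt.1 hcon)
    (by linarith [endPhase_lt_pi (c := c) τ, Real.pi_pos]))

/-- For cos θ ≤ 0 the bound J > √(1 - s²) T ≥ (1 - s²) T fixes the sign of the closed formula. For
cos θ > 0 that formula is a difference of positive terms and a different expression is needed. -/
theorem endTime_deriv_pos : 0 < (Real.sin (endPhase c τ) * profile c τ (endPhase c τ) -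
      Real.cos (endPhase c τ) / 2 * (loopMass c τ - (1 - modulus c τ ^ 2) * endTime c τ)) /
        modulus c τ := by
  have hs := modulus_pos hc τ
  have hp := profile_pos hc hc1 τ (endPhase c τ)
  have hsn := sin_endPhase_pos (c := c) τ
  have hd := one_sub_modulus_sq_pos hc hc1 τ
  rcases le_or_gt (Real.cos (endPhase c τ)) 0 with h | h
  · have h1 := loopMass_gt hc hc1 τ
    have hT := endTime_pos hc hc1 τ
    have h2 : 1 - modulus c τ ^ 2 ≤ √(1 - modulus c τ ^ 2) :=
      Real.le_sqrt_of_sq_le (by nlinarith [sq_nonneg (modulus c τ)])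
    have h3 : 0 < loopMass c τ - (1 - modulus c τ ^ 2) * endTime c τ := by nlinarith
    refine div_pos ?_ hs
    have : Real.cos (endPhase c τ) / 2 * (loopMass c τ - (1 - modulus c τ ^ 2) * endTime c τ) ≤ 0 :=
      mul_nonpos_of_nonpos_of_nonneg (by linarith) h3.le
    have := mul_pos hsn hp
    linarith
  -- Back to the unreduced Leibniz formula: for θ < π/2 the cosine is nonnegative on the whole range
  -- of integration.
  · rw [(hasDerivAt_endTime hc hc1 τ).unique (hasDerivAt_endTime_aux hc hc1 τ)]
    have h0 := endPhase_lt_of_cos_pos τ h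
    have h1 : 0 ≤ ∫ t in (0 : ℝ)..endPhase c τ, Real.cos t / (8 * profile c τ t ^ 3) := by
      refine intervalIntegral.integral_nonneg (endPhase_pos τ).le fun t ht => ?_
      have h2 := profile_pos hc hc1 τ t
      have h3 : 0 ≤ Real.cos t := Real.cos_nonneg_of_mem_Icc
        ⟨by linarith [ht.1, Real.pi_pos], by linarith [ht.2]⟩
      positivity
    have := mul_nonneg (mul_nonneg hd.le h.le) h1
    have : 0 < Real.sin (endPhase c τ) / modulus c τ * (1 / (2 * profile c τ (endPhase c τ))) := by
      positivity
    linarith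

theorem strictMono_endTime : StrictMono (endTime c) :=
  strictMono_of_hasDerivAt_pos (hasDerivAt_endTime hc hc1) (endTime_deriv_pos hc hc1)

theorem loopMass_pos : 0 < loopMass c τ :=
  (mul_nonneg (Real.sqrt_nonneg _) (endTime_pos hc hc1 τ).le).trans_lt (loopMass_gt hc hc1 τ)

theorem profile_ge_of_mem {t : ℝ} (ht : t ∈ Icc 0 (endPhase c τ)) :
    profile c τ (endPhase c τ) ≤ profile c τ t := by
  have h1 : Real.cos (endPhase c τ) ≤ Real.cos t :=
    Real.cos_le_cos_of_nonneg_of_le_pi ht.1 (endPhase_lt_pi τ).le ht.2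
  have := modulus_pos hc τ
  exact Real.sqrt_le_sqrt (by nlinarith)

/-- The profile is smallest at θ, so s∫cos t/(4w) = (J - T)/2 is at most s sin θ/(4w(θ)); it remains
to see that s cos² θ, times sin θ/(4w(θ)), stays below sin θ w(θ), which follows from s cos θ <
4w(θ)² = 2(1 + s cos θ). -/
theorem sin_mul_profile_gt_of_cos_pos (h : 0 < Real.cos (endPhase c τ)) :
    0 < Real.sin (endPhase c τ) * profile c τ (endPhase c τ) -
      Real.cos (endPhase c τ) / 2 * (loopMass c τ - endTime c τ) := by
  have hs := modulus_pos hc τ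
  have hp := profile_pos hc hc1 τ (endPhase c τ)
  have hsn := sin_endPhase_pos (c := c) τ
  have h0 := endPhase_lt_of_cos_pos τ h
  have h1 := integral_cos_div_profile hc hc1 τ (endPhase c τ)
  have h2 : ∫ t in (0 : ℝ)..endPhase c τ, Real.cos t / (4 * profile c τ t)
      ≤ ∫ t in (0 : ℝ)..endPhase c τ, Real.cos t / (4 * profile c τ (endPhase c τ)) := by
    have hi := intervalIntegrable_div_profile hc hc1 τ Real.continuous_cos 4 1 four_pos 0
      (endPhase c τ)
    simp only [pow_one] at hi
    refine intervalIntegral.integral_mono_on (endPhase_pos τ).le hi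
      ((Real.continuous_cos.div_const _).intervalIntegrable _ _) fun t ht => ?_
    have h3 : 0 ≤ Real.cos t := Real.cos_nonneg_of_mem_Icc
      ⟨by linarith [ht.1, Real.pi_pos], by linarith [ht.2]⟩
    have h4 := profile_ge_of_mem hc hc1 τ ht
    gcongr
  rw [intervalIntegral.integral_div, integral_cos, Real.sin_zero, sub_zero] at h2
  have h5 := profile_sq hc hc1 τ (endPhase c τ)
  rw [loopMass, endTime]
  have h6 := mul_le_mul_of_nonneg_left h2 (mul_pos h hs).le
  have h7 : Real.cos (endPhase c τ) / 2 * ((∫ t in (0 : ℝ)..endPhase c τ, profile c τ t)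
      - phaseTime c τ (endPhase c τ)) ≤ Real.cos (endPhase c τ) * modulus c τ *
        (Real.sin (endPhase c τ) / (4 * profile c τ (endPhase c τ))) := by
    refine le_trans (le_of_eq ?_) h6
    rw [mul_assoc (Real.cos _) (modulus c τ), h1]; ring
  refine sub_pos.2 (h7.trans_lt ?_)
  rw [mul_div_assoc', div_lt_iff₀ (by positivity)]
  have h8 : Real.sin (endPhase c τ) * profile c τ (endPhase c τ) *
    (4 * profile c τ (endPhase c τ)) = Real.sin (endPhase c τ) * (4 * profile c τ (endPhase c τ) ^ 2) := by
    ring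
  rw [h8, h5]
  have h9 : 0 < modulus c τ * Real.cos (endPhase c τ) := mul_pos hs h
  nlinarith [mul_pos hsn h9]

end

/-! ### Monotonicity of time multiplied by mass -/

section

variable {n : ℝ} (hn : 1 ≤ n) (τ : ℝ)

include hn

theorem one_div_two_mul_pos : 0 < 1 / (2 * n) := by positivity

theorem one_div_two_mul_lt_one : 1 / (2 * n) < 1 := by
  rw [div_lt_one (by positivity)]; linarith

omit hn in
theorem scaledMass_gt : n * loopMass (1 / (2 * n)) τ < scaledMass n τ := by
  have := Real.tanh_lt_one (tailShift τ)
  rw [scaledMass]; linarith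

/-- For cos θ > 0 both factors increase. For cos θ ≤ 0 no sign of M' is established; instead T'M is
bounded below by T'nJ, and T'nJ + TM' is a sum of terms of known sign. -/
theorem strictMono_endTime_mul_scaledMass :
    StrictMono fun τ => endTime (1 / (2 * n)) τ * scaledMass n τ := by
  have hc := one_div_two_mul_pos hn
  have hc1 := one_div_two_mul_lt_one hn
  refine strictMono_of_hasDerivAt_pos (fun τ => (hasDerivAt_endTime hc hc1 τ).mul
    (hasDerivAt_scaledMass τ hn)) fun τ => ?_
  have hM := scaledMass_gt (n := n) τ
  have hT' := endTime_deriv_pos hc hc1 τ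
  have hJ := loopMass_pos hc hc1 τ
  have hT := endTime_pos hc hc1 τ
  have hs := modulus_pos hc τ
  have hd := one_sub_modulus_sq_pos hc hc1 τ
  have hp := profile_pos hc hc1 τ (endPhase (1 / (2 * n)) τ)
  have hsn := sin_endPhase_pos (c := 1 / (2 * n)) τ
  have hn0 : 0 < n := by linarith
  have hnJ : 0 < n * loopMass (1 / (2 * n)) τ := by positivity
  rcases le_or_gt (Real.cos (endPhase (1 / (2 * n)) τ)) 0 with h | h
  · have hJT := loopMass_gt hc hc1 τ
    have hJT2 : (1 - modulus (1 / (2 * n)) τ ^ 2) * endTime (1 / (2 * n)) τ ^ 2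
        ≤ loopMass (1 / (2 * n)) τ ^ 2 := by
      have h1 := Real.sq_sqrt hd.le
      rw [← h1, ← mul_pow]
      exact pow_le_pow_left₀ (by positivity) hJT.le 2
    have h2 := mul_lt_mul_of_pos_left hM hT'
    refine lt_of_lt_of_le ?_ (add_le_add_left h2.le _)
    generalize scaledMass n τ = M at *
    generalize 1 / (2 * n) = c at *
    generalize loopMass c τ = J at *
    generalize endTime c τ = T at *
    generalize profile c τ (endPhase c τ) = p at *
    generalize modulus c τ = s at *
    generalize Real.sin (endPhase c τ) = sn at *
    generalize Real.cos (endPhase c τ) = cn at *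
    -- The mixed terms JT cancel, leaving J² - (1 - s²)T², which is nonnegative by `loopMass_gt`.
    have e : (sn * p - cn / 2 * (J - (1 - s ^ 2) * T)) / s * (n * J) +
        T * (n * (1 - s ^ 2) / s * (sn * p - cn / 2 * (J - T)))
        = n / s * (sn * p * (J + (1 - s ^ 2) * T) + -cn / 2 * (J ^ 2 - (1 - s ^ 2) * T ^ 2)) := by
      field_simp; ring
    rw [e]
    have e1 : 0 < sn * p * (J + (1 - s ^ 2) * T) := by positivity
    have e2 : 0 ≤ -cn / 2 * (J ^ 2 - (1 - s ^ 2) * T ^ 2) :=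
      mul_nonneg (by linarith) (by linarith)
    positivity
  · have h1 := sin_mul_profile_gt_of_cos_pos hc hc1 τ h
    have h2 : 0 < scaledMass n τ := hnJ.trans hM
    have h3 : 0 < n * (1 - modulus (1 / (2 * n)) τ ^ 2) / modulus (1 / (2 * n)) τ := by positivity
    exact add_pos (mul_pos hT' h2) (mul_pos hT (mul_pos h3 h1))

end

/-! ### Limits and the frequency parameter -/

theorem tendsto_sinh_atTop : Tendsto Real.sinh atTop atTop :=
  Real.sinhOrderIso.tendsto_atTop

theorem tendsto_sinh_atBot : Tendsto Real.sinh atBot atBot :=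
  Real.sinhOrderIso.tendsto_atBot

theorem tendsto_endPhase_atBot {c : ℝ} (hc : 0 < c) :
    Tendsto (endPhase c) atBot (𝓝 0) := by
  have h1 : Tendsto (fun τ => Real.sinh τ / c) atBot atBot :=
    tendsto_sinh_atBot.atBot_div_const hc
  have h2 := ((Real.tendsto_arctan_atBot.comp h1).mono_right nhdsWithin_le_nhds).const_add
    (Real.pi / 2)
  rw [add_neg_cancel] at h2
  exact h2

theorem tendsto_endPhase_atTop {c : ℝ} (hc : 0 < c) :
    Tendsto (endPhase c) atTop (𝓝[<] Real.pi) := by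
  have h1 : Tendsto (fun τ => Real.sinh τ / c) atTop atTop :=
    tendsto_sinh_atTop.atTop_div_const hc
  have h2 := ((Real.tendsto_arctan_atTop.comp h1).mono_right nhdsWithin_le_nhds).const_add
    (Real.pi / 2)
  rw [add_halves] at h2
  exact tendsto_nhdsWithin_iff.2 ⟨h2, .of_forall fun τ => endPhase_lt_pi τ⟩

section

variable {c : ℝ} (hc : 0 < c) (hc1 : c < 1)

include hc hc1

theorem half_le_profile {τ t : ℝ} (ht : t ∈ Icc 0 (Real.pi / 2)) : 1 / 2 ≤ profile c τ t := by
  have h1 : 0 ≤ Real.cos t := Real.cos_nonneg_of_mem_Icc ⟨by linarith [ht.1, Real.pi_pos], ht.2⟩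
  have h2 := mul_nonneg (modulus_pos hc τ).le h1
  have h3 := profile_sq hc hc1 τ t
  nlinarith [profile_pos hc hc1 τ t]

theorem tendsto_endTime_atBot : Tendsto (endTime c) atBot (𝓝 0) := by
  refine squeeze_zero' (.of_forall fun τ => (endTime_pos hc hc1 τ).le) ?_
    (tendsto_endPhase_atBot hc)
  filter_upwards [(tendsto_endPhase_atBot hc).eventually (gt_mem_nhds Real.pi_div_two_pos)]
    with τ hτ
  have h := intervalIntegral.integral_mono_on (endPhase_pos (c := c) τ).le
    ((continuous_inv_profile hc hc1 τ).intervalIntegrable (μ := volume) _ _)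
    (intervalIntegrable_const (c := (1 : ℝ))) fun t ht => by
      have h1 := half_le_profile hc hc1 (τ := τ) ⟨ht.1, ht.2.trans hτ.le⟩
      rw [div_le_one (by linarith)]; linarith
  simpa [endTime, phaseTime] using h

/-- As τ → ∞ the orbit approaches the homoclinic one, for which w vanishes linearly at phase π. The
bound is uniform in τ because t ≤ θ controls 1 - s² by (π - t)². -/
theorem profile_le_mul_pi_sub {τ t : ℝ} (ht : t ∈ Icc 0 (endPhase c τ)) :
    profile c τ t ≤ (1 / c + 1) * (Real.pi - t) := by
  have hχ := endPhase_lt_pi (c := c) τ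
  have ht' : 0 < Real.pi - t := by linarith [ht.2]
  have h1 := Real.cosh_pos τ
  have h2 : Real.sin (endPhase c τ) ≤ Real.pi - t := by
    rw [← Real.sin_pi_sub]
    exact (Real.sin_le (by linarith)).trans (by linarith [ht.2])
  have h3 : 1 / Real.cosh τ ≤ (Real.pi - t) / c := by
    have h4 := modulus_mul_sin hc τ
    have h5 := modulus_lt_one hc hc1 τ
    have h6 := sin_endPhase_pos (c := c) τ
    have h7 : c / Real.cosh τ ≤ Real.pi - t := by nlinarith
    rw [le_div_iff₀ hc]
    rw [div_mul_eq_mul_div, one_mul]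
    exact h7
  have h4 : 1 - modulus c τ ^ 2 ≤ ((Real.pi - t) / c) ^ 2 := by
    refine le_trans ?_ (pow_le_pow_left₀ (by positivity) h3 2)
    rw [one_sub_modulus_sq hc, div_pow, one_pow]
    gcongr
    nlinarith
  have h5 : 1 + Real.cos t ≤ (Real.pi - t) ^ 2 / 2 := by
    have := Real.one_sub_sq_div_two_le_cos (x := Real.pi - t)
    rw [Real.cos_pi_sub] at this
    linarith
  refine abs_le_of_sq_le_sq' ?_ (by positivity) |>.2
  rw [profile_sq hc hc1]
  have h6 := modulus_pos hc τ
  have h7 := modulus_lt_one hc hc1 τ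
  have h8 := Real.neg_one_le_cos t
  -- The difference of the two sides factors as (1 - s)(1 + s + cos t).
  have h9 : modulus c τ * Real.cos t ≤ (1 - modulus c τ ^ 2) + Real.cos t := by nlinarith
  have h10 : 0 ≤ 1 / c * (Real.pi - t) ^ 2 := by positivity
  have h11 : ((Real.pi - t) / c) ^ 2 = (1 / c) ^ 2 * (Real.pi - t) ^ 2 := by ring
  nlinarith [sq_nonneg (Real.pi - t), sq_nonneg ((Real.pi - t) / c)]

/-- The linear bound on w makes T at least a constant times log(π/(π - θ)), and θ → π. -/
theorem tendsto_endTime_atTop : Tendsto (endTime c) atTop atTop := by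
  set K := 1 / c + 1 with hK
  have hK0 : 0 < K := by positivity
  have h1 : ∀ τ, 1 / (2 * K) * (Real.log Real.pi - Real.log (Real.pi - endPhase c τ))
      ≤ endTime c τ := by
    intro τ
    have hχ := endPhase_lt_pi (c := c) τ
    have hχ0 := endPhase_pos (c := c) τ
    have hd : ∀ t ∈ uIcc 0 (endPhase c τ), HasDerivAt
        (fun t => -(1 / (2 * K) * Real.log (Real.pi - t))) (1 / (2 * K) * (1 / (Real.pi - t))) t := by
      intro t ht
      rw [uIcc_of_le hχ0.le] at ht
      have h2 : Real.pi - t ≠ 0 := by linarith [ht.2]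
      exact ((((hasDerivAt_id t).const_sub Real.pi).log h2).const_mul (1 / (2 * K))).fun_neg.congr_deriv
        (by simp; ring)
    have hi : IntervalIntegrable (fun t => 1 / (2 * K) * (1 / (Real.pi - t))) volume 0
        (endPhase c τ) := by
      refine ContinuousOn.intervalIntegrable fun t ht => ContinuousAt.continuousWithinAt ?_
      rw [uIcc_of_le hχ0.le] at ht
      have h2 : Real.pi - t ≠ 0 := by linarith [ht.2]
      fun_prop (disch := assumption)
    have h3 := intervalIntegral.integral_eq_sub_of_hasDerivAt hd hi
    have h4 : 1 / (2 * K) * (Real.log Real.pi - Real.log (Real.pi - endPhase c τ))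
        = ∫ t in (0 : ℝ)..endPhase c τ, 1 / (2 * K) * (1 / (Real.pi - t)) := by
      rw [h3]; simp; ring
    rw [h4, endTime, phaseTime]
    refine intervalIntegral.integral_mono_on hχ0.le hi
      ((continuous_inv_profile hc hc1 τ).intervalIntegrable _ _) fun t ht => ?_
    rw [one_div_mul_one_div]
    have h5 := profile_le_mul_pi_sub hc hc1 ht
    have h6 := profile_pos hc hc1 τ t
    refine one_div_le_one_div_of_le (by positivity) ?_
    nlinarith
  refine tendsto_atTop_mono h1 (Tendsto.const_mul_atTop (by positivity) ?_)
  have h2 : Tendsto (fun τ => Real.pi - endPhase c τ) atTop (𝓝[>] 0) := by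
    have h3 := ((tendsto_endPhase_atTop hc).mono_right nhdsWithin_le_nhds).const_sub Real.pi
    rw [sub_self] at h3
    exact tendsto_nhdsWithin_iff.2 ⟨h3, .of_forall fun τ => sub_pos.2 (endPhase_lt_pi τ)⟩
  exact tendsto_atTop_add_const_left _ _
    (tendsto_neg_atBot_atTop.comp (Real.tendsto_log_nhdsGT_zero.comp h2))

theorem continuous_endTime : Continuous (endTime c) :=
  continuous_iff_continuousAt.2 fun τ => (hasDerivAt_endTime hc hc1 τ).continuousAt

theorem contDiff_endTime : ContDiff ℝ 1 (endTime c) :=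
  ContDiff.comp (f := fun τ => (endPhase c τ, τ)) (contDiff_primitive (contDiff_inv_profile hc hc1))
    (contDiff_endPhase.prodMk contDiff_id)

theorem contDiff_loopMass : ContDiff ℝ 1 (loopMass c) :=
  ContDiff.comp (f := fun τ => (endPhase c τ, τ)) (contDiff_primitive (contDiff_profile hc hc1))
    (contDiff_endPhase.prodMk contDiff_id)

/-- For τ ≥ 0 the phase runs past π/2, and w ≥ 1/2 up to there. This lower bound lets T → ∞ force T
M → ∞. -/
theorem pi_div_four_le_loopMass {τ : ℝ} (hτ : 0 ≤ τ) : Real.pi / 4 ≤ loopMass c τ := by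
  have h1 : Real.pi / 2 ≤ endPhase c τ := by
    have : 0 ≤ Real.arctan (Real.sinh τ / c) :=
      Real.arctan_nonneg.2 (div_nonneg (Real.sinh_nonneg_iff.2 hτ) hc.le)
    rw [endPhase]; linarith
  have hi := (continuous_profile hc hc1 τ).intervalIntegrable (μ := volume)
  have h2 := intervalIntegral.integral_add_adjacent_intervals (hi 0 (Real.pi / 2))
    (hi (Real.pi / 2) (endPhase c τ))
  have h3 : 0 ≤ ∫ t in (Real.pi / 2)..endPhase c τ, profile c τ t :=
    intervalIntegral.integral_nonneg h1 fun t _ => (profile_pos hc hc1 τ t).le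
  have h4 := intervalIntegral.integral_mono_on Real.pi_div_two_pos.le
    (intervalIntegrable_const (c := (1 / 2 : ℝ))) (hi 0 (Real.pi / 2)) fun t ht =>
      half_le_profile hc hc1 ht
  simp only [intervalIntegral.integral_const, smul_eq_mul] at h4
  rw [loopMass, ← h2]
  linarith

theorem loopMass_le_pi (τ : ℝ) : loopMass c τ ≤ Real.pi := by
  have h := intervalIntegral.integral_mono_on (endPhase_pos (c := c) τ).le
    ((continuous_profile hc hc1 τ).intervalIntegrable (μ := volume) _ _)
    (intervalIntegrable_const (c := (1 : ℝ))) fun t _ => profile_le_one hc hc1 τ t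
  simp only [intervalIntegral.integral_const, smul_eq_mul, mul_one, sub_zero] at h
  exact h.trans (endPhase_lt_pi τ).le

theorem strictMono_log_endTime : StrictMono fun τ => Real.log (endTime c τ) := fun _ _ h =>
  Real.log_lt_log (endTime_pos hc hc1 _) (strictMono_endTime hc hc1 h)

/-- T sweeps (0, ∞); the logarithm turns this range into the whole line, so that the inverse is
defined on ℝ. -/
theorem surjective_log_endTime : Function.Surjective fun τ => Real.log (endTime c τ) := by
  refine Continuous.surjective ((continuous_endTime hc hc1).log fun τ =>
    (endTime_pos hc hc1 τ).ne') (Real.tendsto_log_atTop.comp (tendsto_endTime_atTop hc hc1)) ?_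
  exact Real.tendsto_log_nhdsGT_zero.comp (tendsto_nhdsWithin_iff.2
    ⟨tendsto_endTime_atBot hc hc1, .of_forall fun τ => endTime_pos hc hc1 τ⟩)

end

/-- The logarithm of the rescaled length as an isomorphism of the parameter line. -/
noncomputable def logTimeIso {c : ℝ} (hc : 0 < c) (hc1 : c < 1) : ℝ ≃o ℝ :=
  (strictMono_log_endTime hc hc1).orderIsoOfSurjective _ (surjective_log_endTime hc hc1)

/-- The parameter of the state of frequency `ω < 0`. -/
noncomputable def freqParam {c : ℝ} (hc : 0 < c) (hc1 : c < 1) (ω : ℝ) : ℝ :=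
  (logTimeIso hc hc1).symm (Real.log (Real.pi * √(-ω)))

section

variable {c : ℝ} (hc : 0 < c) (hc1 : c < 1)

theorem endTime_freqParam {ω : ℝ} (hω : ω < 0) :
    endTime c (freqParam hc hc1 ω) = Real.pi * √(-ω) := by
  have h1 : 0 < Real.pi * √(-ω) := mul_pos Real.pi_pos (Real.sqrt_pos.2 (by linarith))
  have h : Real.log (endTime c (freqParam hc hc1 ω)) = Real.log (Real.pi * √(-ω)) :=
    (logTimeIso hc hc1).apply_symm_apply _
  exact Real.log_injOn_pos (endTime_pos hc hc1 _) h1 h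

theorem contDiff_logTimeIso_symm : ContDiff ℝ 1 (logTimeIso hc hc1).symm := by
  rw [contDiff_iff_contDiffAt]
  intro y
  set τ := (logTimeIso hc hc1).symm y
  have hT := endTime_pos hc hc1 τ
  have h1 := (hasDerivAt_endTime hc hc1 τ).log hT.ne'
  exact (logTimeIso hc hc1).toHomeomorph.toOpenPartialHomeomorph.contDiffAt_symm_deriv
    (div_pos (endTime_deriv_pos hc hc1 τ) hT).ne' (mem_univ _) h1
    ((contDiff_endTime hc hc1).contDiffAt.log hT.ne')

theorem contDiffOn_freqParam : ContDiffOn ℝ 1 (freqParam hc hc1) (Iio 0) := by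
  refine (contDiff_logTimeIso_symm hc hc1).comp_contDiffOn ?_
  have h0 : ∀ ω ∈ Iio (0 : ℝ), -ω ≠ 0 := fun ω hω => neg_ne_zero.2 (ne_of_lt hω)
  refine ContDiffOn.log (contDiffOn_const.mul (contDiff_neg.contDiffOn.sqrt h0)) fun ω hω => ?_
  have : 0 < -ω := neg_pos.2 hω
  have := Real.pi_pos
  positivity

theorem strictAntiOn_freqParam : StrictAntiOn (freqParam hc hc1) (Iio 0) := by
  intro a ha b hb hab
  have ha' : 0 < -a := neg_pos.2 ha
  have hb' : 0 < -b := neg_pos.2 hb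
  have := Real.pi_pos
  refine (logTimeIso hc hc1).symm.strictMono (Real.log_lt_log (by positivity) ?_)
  exact mul_lt_mul_of_pos_left (Real.sqrt_lt_sqrt hb'.le (neg_lt_neg hab)) this

theorem tendsto_freqParam_atBot : Tendsto (freqParam hc hc1) atBot atTop :=
  (logTimeIso hc hc1).symm.tendsto_atTop.comp (Real.tendsto_log_atTop.comp
    ((Real.tendsto_sqrt_atTop.comp tendsto_neg_atBot_atTop).const_mul_atTop Real.pi_pos))

theorem tendsto_freqParam_zero : Tendsto (freqParam hc hc1) (𝓝[<] 0) atBot := by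
  refine (logTimeIso hc hc1).symm.tendsto_atBot.comp (Real.tendsto_log_nhdsGT_zero.comp ?_)
  refine tendsto_nhdsWithin_iff.2 ⟨?_, ?_⟩
  · have h : Continuous fun ω : ℝ => Real.pi * √(-ω) := by fun_prop
    have h1 := (h.tendsto 0).mono_left (nhdsWithin_le_nhds (s := Iio 0))
    simpa using h1
  · filter_upwards [self_mem_nhdsWithin] with ω hω
    have : 0 < -ω := neg_pos.2 hω
    have := Real.pi_pos
    show 0 < Real.pi * √(-ω)
    positivity

end

section

variable {n : ℝ} (hn : 1 ≤ n)

include hn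

theorem scaledMass_le (τ : ℝ) : scaledMass n τ ≤ n * Real.pi + 1 := by
  have h1 := loopMass_le_pi (one_div_two_mul_pos hn) (one_div_two_mul_lt_one hn) τ
  have h2 : 0 < Real.tanh (tailShift τ) := by
    rw [Real.tanh_eq_sinh_div_cosh, sinh_tailShift]
    exact div_pos (Real.exp_pos _) (Real.cosh_pos _)
  rw [scaledMass]
  nlinarith

theorem scaledMass_pos (τ : ℝ) : 0 < scaledMass n τ :=
  (mul_pos (by linarith) (loopMass_pos (one_div_two_mul_pos hn)
    (one_div_two_mul_lt_one hn) τ)).trans (scaledMass_gt τ)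

theorem contDiff_scaledMass : ContDiff ℝ 1 (scaledMass n) := by
  refine (contDiff_const.mul (contDiff_loopMass (one_div_two_mul_pos hn)
    (one_div_two_mul_lt_one hn))).add (contDiff_const.sub ?_)
  simp_rw [Real.tanh_eq_sinh_div_cosh]
  exact (Real.contDiff_sinh.comp contDiff_tailShift).div
    (Real.contDiff_cosh.comp contDiff_tailShift) fun τ => (Real.cosh_pos _).ne'

theorem tendsto_endTime_mul_scaledMass_atBot :
    Tendsto (fun τ => endTime (1 / (2 * n)) τ * scaledMass n τ) atBot (𝓝 0) := by
  have hc := one_div_two_mul_pos hn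
  have hc1 := one_div_two_mul_lt_one hn
  have h := (tendsto_endTime_atBot hc hc1).mul_const (n * Real.pi + 1)
  rw [zero_mul] at h
  refine squeeze_zero (fun τ => (mul_pos (endTime_pos hc hc1 τ) (scaledMass_pos hn τ)).le)
    (fun τ => ?_) h
  exact mul_le_mul_of_nonneg_left (scaledMass_le hn τ) (endTime_pos hc hc1 τ).le

theorem tendsto_endTime_mul_scaledMass_atTop :
    Tendsto (fun τ => endTime (1 / (2 * n)) τ * scaledMass n τ) atTop atTop := by
  have hc := one_div_two_mul_pos hn
  have hc1 := one_div_two_mul_lt_one hn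
  have h := (tendsto_endTime_atTop hc hc1).atTop_mul_const (r := Real.pi / 4)
    (by positivity)
  refine tendsto_atTop_mono' _ ?_ h
  filter_upwards [eventually_ge_atTop 0] with τ hτ
  refine mul_le_mul_of_nonneg_left ?_ (endTime_pos hc hc1 τ).le
  have h1 := pi_div_four_le_loopMass hc hc1 hτ
  have h2 := scaledMass_gt (n := n) τ
  nlinarith [Real.pi_pos]

end

/-! ### Classical functions as elements of the Sobolev spaces -/

/-- `f 0` is a `C²` function with derivatives `f 1`, `f 2`, all square integrable on `I`. -/
structure IsProfile (I : Set ℝ) (f : Fin 3 → ℝ → ℝ) : Prop where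
  deriv0 : ∀ x, HasDerivAt (f 0) (f 1 x) x
  deriv1 : ∀ x, HasDerivAt (f 1) (f 2 x) x
  cont2 : Continuous (f 2)
  memLp : ∀ i, MemLp (f i) 2 (volume.restrict I)

theorem IsProfile.cont1 {I : Set ℝ} {f : Fin 3 → ℝ → ℝ} (h : IsProfile I f) : Continuous (f 1) :=
  continuous_iff_continuousAt.2 fun x => (h.deriv1 x).continuousAt

theorem IsProfile.contDiff {I : Set ℝ} {f : Fin 3 → ℝ → ℝ} (h : IsProfile I f) :
    ContDiff ℝ 1 (f 0) :=
  contDiff_one_iff_deriv.2 ⟨fun x => (h.deriv0 x).differentiableAt, by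
    rw [show deriv (f 0) = f 1 from funext fun x => (h.deriv0 x).deriv]
    exact h.cont1⟩

/-- The element of `H²(I)` given by a classical function. -/
noncomputable def H2.ofProfile {I : Set ℝ} {f : Fin 3 → ℝ → ℝ} (h : IsProfile I f) : H2 I :=
  ⟨WithLp.toLp 2 fun i => (h.memLp i).toLp (f i),
    isWeakDeriv_toLp h.deriv0 h.cont1 (h.memLp 0) (h.memLp 1),
    isWeakDeriv_toLp h.deriv1 h.cont2 (h.memLp 1) (h.memLp 2)⟩

/-- The Neumann–Kirchhoff conditions for equal loops. -/
def VertexCondition (N : ℕ) (l t : Fin 3 → ℝ → ℝ) : Prop :=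
  l 0 Real.pi = t 0 0 ∧ l 0 (-Real.pi) = t 0 0 ∧
    (N : ℝ) * (l 1 Real.pi - l 1 (-Real.pi)) = t 1 0

section

variable {N : ℕ} {l t : Fin 3 → ℝ → ℝ}

/-- The element of `H²(Γ_N)` with classical components and equal loops. -/
noncomputable def H2Flower.ofProfile (N : ℕ) (hl : IsProfile loopI l) (ht : IsProfile tailI t) :
    H2Flower N :=
  WithLp.toLp 2 (WithLp.toLp 2 fun _ => H2.ofProfile hl, H2.ofProfile ht)

theorem H2Flower.represents_ofProfile (hl : IsProfile loopI l) (ht : IsProfile tailI t) :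
    (FlowerFun.mk (fun _ : Fin N => l 0) (t 0)).Represents (H2Flower.ofProfile N hl ht) where
  loop_contDiffOn _ := hl.contDiff.contDiffOn
  tail_contDiffOn := ht.contDiff.contDiffOn
  loop_ae _ := (hl.memLp 0).coeFn_toLp.symm
  tail_ae := (ht.memLp 0).coeFn_toLp.symm

theorem VertexCondition.neumannKirchhoff (hl : IsProfile loopI l) (ht : IsProfile tailI t)
    (h : VertexCondition N l t) :
    (FlowerFun.mk (fun _ : Fin N => l 0) (t 0)).NeumannKirchhoff where
  right_eq _ := h.1
  left_eq _ := h.2.1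
  kirchhoff := by
    have hpi : -Real.pi < Real.pi := by linarith [Real.pi_pos]
    have hu := uniqueDiffOn_Icc hpi
    simp only
    rw [(hl.deriv0 _).hasDerivWithinAt.derivWithin (hu _ (right_mem_Icc.2 hpi.le)),
      (hl.deriv0 _).hasDerivWithinAt.derivWithin (hu _ (left_mem_Icc.2 hpi.le)),
      (ht.deriv0 _).hasDerivWithinAt.derivWithin (uniqueDiffOn_Ici 0 _ self_mem_Ici)]
    simpa [mul_sub] using h.2.2

/-- The element of `H²_NK(Γ_N)` with classical components and equal loops. -/
noncomputable def H2NK.ofProfile (hl : IsProfile loopI l) (ht : IsProfile tailI t)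
    (h : VertexCondition N l t) : H2NK N :=
  ⟨H2Flower.ofProfile N hl ht, _, H2Flower.represents_ofProfile hl ht, h.neumannKirchhoff hl ht⟩

end

/-- A `C¹` family of `C²` functions with locally uniform square integrable bounds. -/
structure IsProfileFamily (I : Set ℝ) (f : Fin 3 → ℝ → ℝ → ℝ) : Prop where
  contDiff : ∀ i, ContDiff ℝ 1 (Function.uncurry (f i))
  deriv0 : ∀ τ x, HasDerivAt (f 0 τ) (f 1 τ x) x
  deriv1 : ∀ τ x, HasDerivAt (f 1 τ) (f 2 τ x) x
  memLp : ∀ i τ, MemLp (f i τ) 2 (volume.restrict I)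
  dominated : ∀ i τ₀, ∃ b : ℝ → ℝ, MemLp b 2 (volume.restrict I) ∧
    ∃ δ > 0, ∀ τ ∈ Metric.ball τ₀ δ, ∀ x ∈ I, |paramDeriv (f i) τ x| ≤ b x

namespace IsProfileFamily

variable {I : Set ℝ} {f : Fin 3 → ℝ → ℝ → ℝ} (h : IsProfileFamily I f) (hI : MeasurableSet I)

include h

theorem isProfile (τ : ℝ) : IsProfile I (fun i => f i τ) :=
  ⟨h.deriv0 τ, h.deriv1 τ, Continuous.uncurry_left τ (h.contDiff 2).continuous, fun i => h.memLp i τ⟩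

include hI

theorem memLp_paramDeriv (i : Fin 3) (τ : ℝ) :
    MemLp (paramDeriv (f i) τ) 2 (volume.restrict I) := by
  obtain ⟨b, hb, δ, hδ, hbd⟩ := h.dominated i τ
  refine hb.mono' (Continuous.uncurry_left τ
    (continuous_paramDeriv (h.contDiff i))).aestronglyMeasurable ?_
  exact (ae_restrict_iff' hI).2 (.of_forall fun x hx => hbd τ (Metric.mem_ball_self hδ) x hx)

theorem isProfile_paramDeriv (τ : ℝ) : IsProfile I (fun i => paramDeriv (f i) τ) :=
  ⟨hasDerivAt_paramDeriv_right (h.contDiff 0) (h.contDiff 1) h.deriv0 τ,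
    hasDerivAt_paramDeriv_right (h.contDiff 1) (h.contDiff 2) h.deriv1 τ,
    Continuous.uncurry_left τ (continuous_paramDeriv (h.contDiff 2)),
    fun i => h.memLp_paramDeriv hI i τ⟩

theorem hasDerivAt_ofProfile (τ : ℝ) : HasDerivAt (fun τ => H2.ofProfile (h.isProfile τ))
    (H2.ofProfile (h.isProfile_paramDeriv hI τ)) τ := by
  refine hasDerivAt_of_coe (hasDerivAt_toLp_pi fun i => ?_)
  obtain ⟨b, hb, δ, hδ, hbd⟩ := h.dominated i τ
  exact hasDerivAt_toLp (h.memLp i) (h.memLp_paramDeriv hI i) (Metric.ball_mem_nhds τ hδ)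
    (convex_ball τ δ) hb ((ae_restrict_iff' hI).2 (.of_forall fun x hx τ' hτ' => hbd τ' hτ' x hx))
    fun τ x => hasDerivAt_paramDeriv (h.contDiff i) τ x

theorem continuous_ofProfile_paramDeriv :
    Continuous fun τ => H2.ofProfile (h.isProfile_paramDeriv hI τ) := by
  refine Continuous.subtype_mk ((PiLp.continuous_toLp 2 _).comp (continuous_pi fun i => ?_)) _
  rw [continuous_iff_continuousAt]
  intro τ
  obtain ⟨b, hb, δ, hδ, hbd⟩ := h.dominated i τ
  refine tendsto_toLp_of_dominated (h.memLp_paramDeriv hI i) (h.memLp_paramDeriv hI i τ) hb ?_ ?_ ?_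
  · filter_upwards [Metric.ball_mem_nhds τ hδ] with τ' hτ'
    exact (ae_restrict_iff' hI).2 (.of_forall fun x hx => hbd τ' hτ' x hx)
  · exact (ae_restrict_iff' hI).2 (.of_forall fun x hx => hbd τ (Metric.mem_ball_self hδ) x hx)
  · exact .of_forall fun x =>
      (Continuous.uncurry_right x (continuous_paramDeriv (h.contDiff i))).tendsto τ

end IsProfileFamily

theorem contDiff_submodule_of_hasDerivAt {N : ℕ} {E F : Type*} [NormedAddCommGroup E]
    [NormedSpace ℝ E] [NormedAddCommGroup F] [NormedSpace ℝ F]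
    {S : Submodule ℝ (WithLp 2 (PiLp 2 (fun _ : Fin N => E) × F))} {f f' : ℝ → E} {g g' : ℝ → F}
    (hf : ∀ τ, HasDerivAt f (f' τ) τ) (hg : ∀ τ, HasDerivAt g (g' τ) τ) (hf' : Continuous f')
    (hg' : Continuous g') (h : ∀ τ, WithLp.toLp 2 (WithLp.toLp 2 fun _ : Fin N => f τ, g τ) ∈ S)
    (h' : ∀ τ, WithLp.toLp 2 (WithLp.toLp 2 fun _ : Fin N => f' τ, g' τ) ∈ S) :
    ContDiff ℝ 1 fun τ => (⟨_, h τ⟩ : S) := by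
  have hd : ∀ τ, HasDerivAt (fun τ => (⟨_, h τ⟩ : S)) ⟨_, h' τ⟩ τ := fun τ =>
    hasDerivAt_of_coe (hasDerivAt_toLp_prod (hasDerivAt_toLp_pi fun _ => hf τ) (hg τ))
  refine contDiff_one_iff_deriv.2 ⟨fun τ => (hd τ).differentiableAt, ?_⟩
  rw [show deriv _ = _ from funext fun τ => (hd τ).deriv]
  refine Continuous.subtype_mk ?_ _
  refine (WithLp.prod_continuous_toLp 2 _ _).comp (Continuous.prodMk ?_ hg')
  exact (PiLp.continuous_toLp 2 _).comp (continuous_pi fun _ => hf')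

theorem contDiff_H2NK_ofProfile {N : ℕ} {l t : Fin 3 → ℝ → ℝ → ℝ} (hl : IsProfileFamily loopI l)
    (ht : IsProfileFamily tailI t) (h : ∀ τ, VertexCondition N (fun i => l i τ) fun i => t i τ) :
    ContDiff ℝ 1 fun τ => H2NK.ofProfile (hl.isProfile τ) (ht.isProfile τ) (h τ) := by
  -- The vertex conditions are linear identities valid for all τ, so they survive differentiation in
  -- τ and the derivative stays in the subspace.
  have hv : ∀ τ, VertexCondition N (fun i => paramDeriv (l i) τ) fun i => paramDeriv (t i) τ := by
    intro τ
    have dl := fun i x => hasDerivAt_paramDeriv (hl.contDiff i) τ x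
    have dt := fun i x => hasDerivAt_paramDeriv (ht.contDiff i) τ x
    refine ⟨?_, ?_, ?_⟩
    · exact (dl 0 Real.pi).unique ((dt 0 0).congr_of_eventuallyEq (.of_forall fun σ => (h σ).1))
    · exact (dl 0 (-Real.pi)).unique
        ((dt 0 0).congr_of_eventuallyEq (.of_forall fun σ => (h σ).2.1))
    · exact (((dl 1 Real.pi).fun_sub (dl 1 (-Real.pi))).const_mul (N : ℝ)).unique
        ((dt 1 0).congr_of_eventuallyEq (.of_forall fun σ => (h σ).2.2))
  have hlp := fun τ => hl.isProfile_paramDeriv measurableSet_Ioo τ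
  have htp := fun τ => ht.isProfile_paramDeriv measurableSet_Ioi τ
  exact contDiff_submodule_of_hasDerivAt (S := H2NK N)
    (hl.hasDerivAt_ofProfile measurableSet_Ioo) (ht.hasDerivAt_ofProfile measurableSet_Ioi)
    (hl.continuous_ofProfile_paramDeriv measurableSet_Ioo)
    (ht.continuous_ofProfile_paramDeriv measurableSet_Ioi)
    (fun τ => (H2NK.ofProfile (hl.isProfile τ) (ht.isProfile τ) (h τ)).2)
    (fun τ => (H2NK.ofProfile (hlp τ) (htp τ) (hv τ)).2)

/-! ### The loop components -/

theorem memLp_loopI_of_continuous {f : ℝ → ℝ} (hf : Continuous f) :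
    MemLp f 2 (volume.restrict loopI) := by
  obtain ⟨C, hC⟩ := (isCompact_Icc (a := -Real.pi) (b := Real.pi)).exists_bound_of_continuousOn
    hf.continuousOn
  exact MemLp.of_bound hf.aestronglyMeasurable C ((ae_restrict_iff' measurableSet_Ioo).2
    (.of_forall fun x hx => hC x (Ioo_subset_Icc_self hx)))

theorem isProfileFamily_loopI {f : Fin 3 → ℝ → ℝ → ℝ}
    (hf : ∀ i, ContDiff ℝ 1 (Function.uncurry (f i)))
    (h0 : ∀ τ x, HasDerivAt (f 0 τ) (f 1 τ x) x) (h1 : ∀ τ x, HasDerivAt (f 1 τ) (f 2 τ x) x) :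
    IsProfileFamily loopI f where
  contDiff := hf
  deriv0 := h0
  deriv1 := h1
  memLp i τ := memLp_loopI_of_continuous (Continuous.uncurry_left τ (hf i).continuous)
  dominated i τ₀ := by
    obtain ⟨C, hC⟩ := ((isCompact_closedBall τ₀ 1).prod
      (isCompact_Icc (a := -Real.pi) (b := Real.pi))).exists_bound_of_continuousOn
      (continuous_paramDeriv (hf i)).continuousOn
    exact ⟨fun _ => C, memLp_const C, 1, one_pos, fun τ hτ x hx =>
      hC (τ, x) ⟨Metric.ball_subset_closedBall hτ, Ioo_subset_Icc_self hx⟩⟩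

/-- The square root of `-ω`. -/
noncomputable def waveNumber (c τ : ℝ) : ℝ := endTime c τ / Real.pi

/-- The loop component of the state and its first two derivatives. -/
noncomputable def loopFamily (c : ℝ) : Fin 3 → ℝ → ℝ → ℝ :=
  ![fun τ x => waveNumber c τ * dnoidal c τ (waveNumber c τ * x),
    fun τ x => waveNumber c τ ^ 2 * dnoidalDeriv c τ (waveNumber c τ * x),
    fun τ x => waveNumber c τ ^ 3 * (dnoidal c τ (waveNumber c τ * x)
      - 2 * dnoidal c τ (waveNumber c τ * x) ^ 3)]

section

variable {c : ℝ} (hc : 0 < c) (hc1 : c < 1)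

include hc hc1

theorem waveNumber_pos (τ : ℝ) : 0 < waveNumber c τ :=
  div_pos (endTime_pos hc hc1 τ) Real.pi_pos

omit hc hc1 in
theorem waveNumber_mul_pi (τ : ℝ) : waveNumber c τ * Real.pi = endTime c τ :=
  div_mul_cancel₀ _ Real.pi_ne_zero

theorem contDiff_waveNumber : ContDiff ℝ 1 (waveNumber c) :=
  (contDiff_endTime hc hc1).div_const _

theorem isProfileFamily_loopFamily : IsProfileFamily loopI (loopFamily c) := by
  have hw : ContDiff ℝ 1 fun p : ℝ × ℝ => waveNumber c p.1 :=
    (contDiff_waveNumber hc hc1).comp contDiff_fst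
  have ha : ContDiff ℝ 1 fun p : ℝ × ℝ => (p.1, waveNumber c p.1 * p.2) :=
    contDiff_fst.prodMk (hw.mul contDiff_snd)
  have hd : ContDiff ℝ 1 fun p : ℝ × ℝ => dnoidal c p.1 (waveNumber c p.1 * p.2) :=
    ContDiff.comp (f := fun p : ℝ × ℝ => (p.1, waveNumber c p.1 * p.2))
      (contDiff_dnoidal hc hc1) ha
  have hd' : ContDiff ℝ 1 fun p : ℝ × ℝ => dnoidalDeriv c p.1 (waveNumber c p.1 * p.2) :=
    ContDiff.comp (f := fun p : ℝ × ℝ => (p.1, waveNumber c p.1 * p.2))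
      (contDiff_dnoidalDeriv hc hc1) ha
  have hx : ∀ τ x, HasDerivAt (fun x => waveNumber c τ * x) (waveNumber c τ) x := fun τ x => by
    simpa using (hasDerivAt_id x).const_mul (waveNumber c τ)
  refine isProfileFamily_loopI (fun i => ?_) (fun τ x => ?_) fun τ x => ?_
  · fin_cases i
    · exact hw.mul hd
    · exact (hw.pow 2).mul hd'
    · exact (hw.pow 3).mul (hd.sub (contDiff_const.mul (hd.pow 3)))
  · exact (((hasDerivAt_dnoidal hc hc1 τ _).comp x (hx τ x)).const_mul _).congr_deriv
      (by simp only [loopFamily, Matrix.cons_val]; ring)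
  · exact (((hasDerivAt_dnoidalDeriv hc hc1 τ _).comp x (hx τ x)).const_mul _).congr_deriv
      (by simp only [loopFamily, Matrix.cons_val]; ring)

theorem phase_endTime (τ : ℝ) : phase c τ (endTime c τ) = endPhase c τ :=
  phase_phaseTime hc hc1 τ _

theorem phase_zero (τ : ℝ) : phase c τ 0 = 0 := by
  have := phase_phaseTime hc hc1 τ 0
  rwa [phaseTime_zero] at this

theorem dnoidal_neg (τ z : ℝ) : dnoidal c τ (-z) = dnoidal c τ z := by
  simp only [dnoidal, phase_neg hc hc1, profile, Real.cos_neg]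

theorem strictAntiOn_profile (τ : ℝ) : StrictAntiOn (profile c τ) (Icc 0 Real.pi) := by
  intro a ha b hb hab
  have h1 := Real.strictAntiOn_cos ha hb hab
  have h2 := modulus_pos hc τ
  refine Real.sqrt_lt_sqrt (one_add_modulus_mul_cos_pos hc hc1 τ b).le ?_
  nlinarith

theorem strictAntiOn_dnoidal (τ : ℝ) : StrictAntiOn (dnoidal c τ) (Icc 0 (endTime c τ)) := by
  have hm := strictMono_phase hc hc1 τ
  have hmap : ∀ z ∈ Icc 0 (endTime c τ), phase c τ z ∈ Icc 0 Real.pi := fun z hz =>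
    ⟨by rw [← phase_zero hc hc1 τ]; exact hm.monotone hz.1,
      (hm.monotone hz.2).trans (by rw [phase_endTime hc hc1]; exact (endPhase_lt_pi τ).le)⟩
  exact fun a ha b hb hab => strictAntiOn_profile hc hc1 τ (hmap a ha) (hmap b hb) (hm hab)

/-- Substitution z ↦ θ: since dz = dθ/(2w), u² dz = w dθ/2. -/
theorem integral_dnoidal_sq (τ : ℝ) :
    ∫ z in (0 : ℝ)..endTime c τ, dnoidal c τ z ^ 2 = loopMass c τ / 2 := by
  have hp := continuous_profile hc hc1 τ
  have hd : ∀ z, HasDerivAt (fun z => (∫ t in (0 : ℝ)..phase c τ z, profile c τ t) / 2)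
      (dnoidal c τ z ^ 2) z := fun z => by
    have h1 : HasDerivAt (fun ψ => ∫ t in (0 : ℝ)..ψ, profile c τ t)
        (profile c τ (phase c τ z)) (phase c τ z) :=
      intervalIntegral.integral_hasDerivAt_right (hp.intervalIntegrable _ _)
        (hp.stronglyMeasurableAtFilter _ _) hp.continuousAt
    refine ((h1.comp z (hasDerivAt_phase hc hc1 τ z)).div_const 2).congr_deriv ?_
    rw [dnoidal]; ring
  have hcont : Continuous fun z => dnoidal c τ z ^ 2 :=
    (Continuous.uncurry_left τ (contDiff_dnoidal hc hc1).continuous).pow 2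
  rw [intervalIntegral.integral_eq_sub_of_hasDerivAt (fun z _ => hd z)
    (hcont.intervalIntegrable _ _), phase_endTime hc hc1, phase_zero hc hc1]
  simp [loopMass]

theorem integral_loopFamily_sq (τ : ℝ) :
    ∫ x in loopI, loopFamily c 0 τ x ^ 2 = waveNumber c τ * loopMass c τ := by
  have hpi : -Real.pi ≤ Real.pi := by linarith [Real.pi_pos]
  have hw := waveNumber_pos hc hc1 τ
  have hcont : Continuous fun z => dnoidal c τ z ^ 2 :=
    (Continuous.uncurry_left τ (contDiff_dnoidal hc hc1).continuous).pow 2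
  have hi := hcont.intervalIntegrable (μ := volume)
  rw [← integral_Ioc_eq_integral_Ioo, ← intervalIntegral.integral_of_le hpi]
  have h1 : ∀ x, loopFamily c 0 τ x ^ 2
      = waveNumber c τ ^ 2 * dnoidal c τ (waveNumber c τ * x) ^ 2 := fun x => by
    simp only [loopFamily, Matrix.cons_val_zero]; ring
  simp_rw [h1]
  rw [intervalIntegral.integral_const_mul, intervalIntegral.integral_comp_mul_left
    (f := fun z => dnoidal c τ z ^ 2) hw.ne', mul_neg, waveNumber_mul_pi,
    ← intervalIntegral.integral_add_adjacent_intervals (hi _ 0) (hi 0 _)]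
  have h2 := intervalIntegral.integral_comp_neg (fun z => dnoidal c τ z ^ 2) (a := 0)
    (b := endTime c τ)
  simp only [dnoidal_neg hc hc1, neg_zero] at h2
  rw [← h2, integral_dnoidal_sq hc hc1, smul_eq_mul]
  field_simp
  ring

end

/-! ### The half-line component -/

theorem inv_cosh_le (y : ℝ) : 1 / Real.cosh y ≤ 2 * Real.exp (-y) := by
  have h1 := Real.exp_pos y
  have h2 := Real.exp_pos (-y)
  rw [div_le_iff₀ (Real.cosh_pos y), Real.cosh_eq]
  have h3 : Real.exp (-y) * Real.exp y = 1 := by rw [← Real.exp_add]; simp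
  nlinarith

theorem memLp_exp_neg_tailI {k : ℝ} (hk : 0 < k) (M : ℝ) :
    MemLp (fun x => M * Real.exp (-k * x)) 2 (volume.restrict tailI) := by
  refine MemLp.const_mul ?_ M
  rw [memLp_two_iff_integrable_sq (by fun_prop)]
  refine (exp_neg_integrableOn_Ioi 0 (mul_pos two_pos hk)).congr (.of_forall fun x => ?_)
  simp only
  rw [← Real.exp_nat_mul]
  congr 1
  push_cast; ring

theorem memLp_tailI_of_le {f : ℝ → ℝ} (hf : Continuous f) {k M : ℝ} (hk : 0 < k)
    (h : ∀ x ∈ tailI, |f x| ≤ M * Real.exp (-k * x)) : MemLp f 2 (volume.restrict tailI) :=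
  (memLp_exp_neg_tailI hk M).mono' hf.aestronglyMeasurable
    ((ae_restrict_iff' measurableSet_Ioi).2 (.of_forall h))

theorem exp_shift_le {k κ a x : ℝ} (hκ : κ ≤ k) (ha : 0 ≤ a) (hx : 0 < x) :
    Real.exp (-(k * x + a)) ≤ Real.exp (-κ * x) :=
  Real.exp_le_exp.2 (by nlinarith)

section

variable {k a : ℝ → ℝ} (hk : ContDiff ℝ 1 k) (hk0 : ∀ τ, 0 < k τ) (ha : ContDiff ℝ 1 a)
  (ha0 : ∀ τ, 0 < a τ) {g g' : ℝ → ℝ} (hg : ∀ y, HasDerivAt g (g' y) y) (hg' : Continuous g') {C : ℝ}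
  (hgC : ∀ y, |g y| ≤ C * Real.exp (-y)) (hgC' : ∀ y, |g' y| ≤ C * Real.exp (-y)) (n : ℕ)

include hk0 ha0 hg hgC in
theorem memLp_tail_wave (τ : ℝ) :
    MemLp (fun x => k τ ^ n * g (k τ * x + a τ)) 2 (volume.restrict tailI) := by
  have hgc : Continuous g := continuous_iff_continuousAt.2 fun y => (hg y).continuousAt
  have hC : 0 ≤ C := by
    have := (abs_nonneg _).trans (hgC 0)
    simpa using this
  refine memLp_tailI_of_le (M := k τ ^ n * C) (by fun_prop) (hk0 τ) fun x hx => ?_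
  rw [abs_mul, abs_of_pos (pow_pos (hk0 τ) n), mul_assoc]
  refine mul_le_mul_of_nonneg_left ((hgC _).trans ?_) (pow_pos (hk0 τ) n).le
  exact mul_le_mul_of_nonneg_left (exp_shift_le le_rfl (ha0 τ).le hx) hC

include hk ha hg hg' in
theorem contDiff_tail_wave :
    ContDiff ℝ 1 (Function.uncurry fun τ x => k τ ^ n * g (k τ * x + a τ)) := by
  have hgd : ContDiff ℝ 1 g := contDiff_one_iff_deriv.2 ⟨fun y => (hg y).differentiableAt, by
    rwa [show deriv g = g' from funext fun y => (hg y).deriv]⟩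
  have h1 : ContDiff ℝ 1 fun p : ℝ × ℝ => k p.1 := hk.comp contDiff_fst
  have h2 : ContDiff ℝ 1 fun p : ℝ × ℝ => a p.1 := ha.comp contDiff_fst
  exact (h1.pow n).mul (hgd.comp ((h1.mul contDiff_snd).add h2))

include hk hk0 ha ha0 hg hg' hgC hgC' in
-- Differentiating in the parameter produces a factor x from the argument kx + a. With κ the minimum
-- of k near τ₀, half of the decay exp(-κx) absorbs it and the other half remains square integrable.
theorem dominated_tail_wave (τ₀ : ℝ) : ∃ b : ℝ → ℝ, MemLp b 2 (volume.restrict tailI) ∧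
    ∃ δ > 0, ∀ τ ∈ Metric.ball τ₀ δ, ∀ x ∈ tailI,
      |paramDeriv (fun τ x => k τ ^ n * g (k τ * x + a τ)) τ x| ≤ b x := by
  have hC : 0 ≤ C := by
    have := (abs_nonneg _).trans (hgC 0)
    simpa using this
  have hkc := hk.continuous
  have hkd := hk.continuous_deriv le_rfl
  have had := ha.continuous_deriv le_rfl
  obtain ⟨A, hA⟩ := (isCompact_closedBall τ₀ 1).exists_bound_of_continuousOn
    (f := fun τ => n * k τ ^ (n - 1) * deriv k τ) (by fun_prop)
  obtain ⟨B, hB⟩ := (isCompact_closedBall τ₀ 1).exists_bound_of_continuousOn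
    (f := fun τ => k τ ^ n * deriv k τ) (by fun_prop)
  obtain ⟨D, hD⟩ := (isCompact_closedBall τ₀ 1).exists_bound_of_continuousOn
    (f := fun τ => k τ ^ n * deriv a τ) (by fun_prop)
  obtain ⟨τ₁, _, hmin⟩ := (isCompact_closedBall τ₀ 1).exists_isMinOn
    (Metric.nonempty_closedBall.2 zero_le_one) hkc.continuousOn
  set κ := k τ₁ with hκ
  have hκ0 : 0 < κ := hk0 τ₁
  refine ⟨fun x => (C * (A + D + B * (2 / κ))) * Real.exp (-(κ / 2) * x),
    memLp_exp_neg_tailI (half_pos hκ0) _, 1, one_pos, fun τ hτ x hx => ?_⟩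
  have hτ' := Metric.ball_subset_closedBall hτ
  have hx0 : 0 < x := hx
  have hA' := hA τ hτ'
  have hB' := hB τ hτ'
  have hD' := hD τ hτ'
  simp only [Real.norm_eq_abs] at hA' hB' hD'
  have hk1 := (hk.differentiable one_ne_zero τ).hasDerivAt
  have ha1 := (ha.differentiable one_ne_zero τ).hasDerivAt
  have hd : HasDerivAt (fun τ => k τ ^ n * g (k τ * x + a τ))
      ((n * k τ ^ (n - 1) * deriv k τ) * g (k τ * x + a τ) +
        ((k τ ^ n * deriv k τ) * x + k τ ^ n * deriv a τ) * g' (k τ * x + a τ)) τ := by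
    refine ((hk1.fun_pow n).mul ((hg _).comp τ ((hk1.mul_const x).fun_add ha1))).congr_deriv ?_
    simp only [Function.comp]
    ring
  rw [(hasDerivAt_paramDeriv (contDiff_tail_wave hk ha hg hg' n) τ x).unique hd]
  have hE := exp_shift_le (hmin hτ') (ha0 τ).le hx0
  have hg1 : |g (k τ * x + a τ)| ≤ C * Real.exp (-κ * x) :=
    (hgC _).trans (mul_le_mul_of_nonneg_left hE hC)
  have hg2 : |g' (k τ * x + a τ)| ≤ C * Real.exp (-κ * x) :=
    (hgC' _).trans (mul_le_mul_of_nonneg_left hE hC)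
  have he : Real.exp (-κ * x) = Real.exp (-(κ / 2) * x) * Real.exp (-(κ / 2) * x) := by
    rw [← Real.exp_add]; congr 1; ring
  set e := Real.exp (-(κ / 2) * x) with hedef
  have he0 : 0 < e := Real.exp_pos _
  have he1 : e ≤ 1 := Real.exp_le_one_iff.2 (by nlinarith)
  -- From 1 + y ≤ exp y with y = κx/2.
  have hxe : x * e ≤ 2 / κ := by
    have h1 := Real.add_one_le_exp (κ / 2 * x)
    have h2 : Real.exp (κ / 2 * x) * e = 1 := by
      rw [hedef, ← Real.exp_add]; simp
    have h3 : κ / 2 * x * e ≤ 1 := by nlinarith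
    rw [le_div_iff₀ hκ0]; linarith
  have hA0 := (abs_nonneg _).trans hA'
  have hB0 := (abs_nonneg _).trans hB'
  have hD0 := (abs_nonneg _).trans hD'
  rw [he] at hg1 hg2
  calc _ ≤ |(n * k τ ^ (n - 1) * deriv k τ)| * |g (k τ * x + a τ)| +
        (|k τ ^ n * deriv k τ| * x + |k τ ^ n * deriv a τ|) * |g' (k τ * x + a τ)| := by
        refine (abs_add_le _ _).trans ?_
        rw [abs_mul, abs_mul (_ + _)]
        gcongr
        refine (abs_add_le _ _).trans ?_
        rw [abs_mul _ x, abs_of_pos hx0]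
    _ ≤ A * (C * (e * e)) + (B * x + D) * (C * (e * e)) := by gcongr
    _ = (C * e) * ((A + D) * e + B * (x * e)) := by ring
    _ ≤ (C * e) * ((A + D) * 1 + B * (2 / κ)) := by gcongr
    _ = _ := by ring

end

/-- The hyperbolic secant and its first derivatives. -/
noncomputable def sechDeriv : Fin 4 → ℝ → ℝ :=
  ![fun y => 1 / Real.cosh y, fun y => -(Real.sinh y / Real.cosh y ^ 2),
    fun y => 1 / Real.cosh y - 2 * (1 / Real.cosh y) ^ 3,
    fun y => -(Real.sinh y / Real.cosh y ^ 2) + 6 * (Real.sinh y / Real.cosh y ^ 4)]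

theorem hasDerivAt_sech0 (y : ℝ) : HasDerivAt (sechDeriv 0) (sechDeriv 1 y) y := by
  have h := Real.cosh_pos y
  refine ((hasDerivAt_const y (1 : ℝ)).div (Real.hasDerivAt_cosh y) h.ne').congr_deriv ?_
  simp only [sechDeriv, Matrix.cons_val]; ring

theorem hasDerivAt_sech1 (y : ℝ) : HasDerivAt (sechDeriv 1) (sechDeriv 2 y) y := by
  have h := Real.cosh_pos y
  refine ((Real.hasDerivAt_sinh y).div ((Real.hasDerivAt_cosh y).pow 2)
    (pow_pos h 2).ne').neg.congr_deriv ?_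
  simp only [sechDeriv, Matrix.cons_val, Pi.pow_apply]
  have h1 := Real.cosh_sq y
  field_simp
  have : Real.sinh y ^ 2 = Real.cosh y ^ 2 - 1 := by linarith
  push_cast
  rw [this]; ring

theorem hasDerivAt_sech2 (y : ℝ) : HasDerivAt (sechDeriv 2) (sechDeriv 3 y) y := by
  have h := Real.cosh_pos y
  have h0 := hasDerivAt_sech0 y
  refine (h0.sub ((h0.pow 3).const_mul 2)).congr_deriv ?_
  simp only [sechDeriv, Matrix.cons_val]
  norm_num
  field_simp
  ring

/-- Since |tanh| ≤ 1 and sech³ ≤ sech, the worst entry is at most (1 + 6) sech y, and sech y ≤ 2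
exp(-y). The third derivative is needed because the parameter derivative of the second derivative of
the wave involves it. -/
theorem abs_sechDeriv_le (i : Fin 4) (y : ℝ) : |sechDeriv i y| ≤ 14 * Real.exp (-y) := by
  have h0 := Real.cosh_pos y
  have h1 := Real.one_le_cosh y
  have hs : |Real.sinh y| ≤ Real.cosh y := by
    refine abs_le_of_sq_le_sq ?_ h0.le
    rw [Real.cosh_sq]; linarith
  have h2 := inv_cosh_le y
  have hi0 : 0 < 1 / Real.cosh y := by positivity
  have hi1 : 1 / Real.cosh y ≤ 1 := by rw [div_le_one h0]; exact h1
  set v := 1 / Real.cosh y with hv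
  have ht : |Real.sinh y * v| ≤ 1 := by
    rw [abs_mul, abs_of_pos hi0, hv, mul_one_div, div_le_one h0]; exact hs
  have hv1 : Real.sinh y / Real.cosh y ^ 2 = (Real.sinh y * v) * v := by rw [hv]; field_simp
  have hv3 : Real.sinh y / Real.cosh y ^ 4 = (Real.sinh y * v) * v ^ 3 := by rw [hv]; field_simp
  have hvv : v ^ 3 ≤ v := by
    have := pow_le_pow_of_le_one hi0.le hi1 (show 1 ≤ 3 by norm_num)
    simpa using this
  have hb : ∀ m : ℕ, |Real.sinh y * v * v ^ m| ≤ v ^ m := fun m => by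
    rw [abs_mul, abs_of_pos (pow_pos hi0 m)]
    exact mul_le_of_le_one_left (pow_pos hi0 m).le ht
  have hb1 := hb 1
  have hb3 := hb 3
  rw [pow_one] at hb1
  refine le_trans ?_ (show 7 * v ≤ 14 * Real.exp (-y) by linarith)
  have hv3p : 0 < v ^ 3 := by positivity
  fin_cases i
  · show |v| ≤ 7 * v
    rw [abs_of_pos hi0]; linarith
  · show |-(Real.sinh y / Real.cosh y ^ 2)| ≤ 7 * v
    rw [abs_neg, hv1]; linarith
  · show |v - 2 * v ^ 3| ≤ 7 * v
    rw [abs_le]; constructor <;> linarith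
  · show |-(Real.sinh y / Real.cosh y ^ 2) + 6 * (Real.sinh y / Real.cosh y ^ 4)| ≤ 7 * v
    rw [hv1, hv3]
    rw [abs_le] at hb1 hb3 ⊢
    constructor <;> linarith

theorem continuous_sechDeriv (i : Fin 4) : Continuous (sechDeriv i) := by
  have h : ∀ y, Real.cosh y ≠ 0 := fun y => (Real.cosh_pos y).ne'
  have h2 : ∀ y, Real.cosh y ^ 2 ≠ 0 := fun y => pow_ne_zero _ (h y)
  have h4 : ∀ y, Real.cosh y ^ 4 ≠ 0 := fun y => pow_ne_zero _ (h y)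
  fin_cases i
  · show Continuous fun y => 1 / Real.cosh y
    fun_prop (disch := assumption)
  · show Continuous fun y => -(Real.sinh y / Real.cosh y ^ 2)
    fun_prop (disch := assumption)
  · show Continuous fun y => 1 / Real.cosh y - 2 * (1 / Real.cosh y) ^ 3
    fun_prop (disch := assumption)
  · show Continuous fun y => -(Real.sinh y / Real.cosh y ^ 2) + 6 * (Real.sinh y / Real.cosh y ^ 4)
    fun_prop (disch := assumption)

theorem hasDerivAt_sechDeriv (i : Fin 3) (y : ℝ) :
    HasDerivAt (sechDeriv i.castSucc) (sechDeriv i.succ y) y := by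
  fin_cases i
  exacts [hasDerivAt_sech0 y, hasDerivAt_sech1 y, hasDerivAt_sech2 y]

theorem tendsto_tanh_atTop : Tendsto Real.tanh atTop (𝓝 1) := by
  have h : ∀ y, 1 - Real.exp (-y) ≤ Real.tanh y := fun y => by
    have h0 := Real.cosh_pos y
    have h1 := Real.one_le_cosh y
    have h2 := Real.exp_pos (-y)
    rw [Real.tanh_eq_sinh_div_cosh, le_div_iff₀ h0]
    have h3 : Real.cosh y - Real.sinh y = Real.exp (-y) := Real.cosh_sub_sinh y
    nlinarith
  have h1 : Tendsto (fun y => 1 - Real.exp (-y)) atTop (𝓝 1) := by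
    simpa using Real.tendsto_exp_neg_atTop_nhds_zero.const_sub 1
  exact tendsto_of_tendsto_of_tendsto_of_le_of_le h1 tendsto_const_nhds h
    fun y => (Real.tanh_lt_one y).le

/-- The half-line component of the state and its first two derivatives. -/
noncomputable def tailFamily (c : ℝ) (i : Fin 3) (τ x : ℝ) : ℝ :=
  waveNumber c τ ^ ((i : ℕ) + 1) * sechDeriv i.castSucc (waveNumber c τ * x + tailShift τ)

section

variable {c : ℝ} (hc : 0 < c) (hc1 : c < 1)

include hc hc1

theorem isProfileFamily_tailFamily : IsProfileFamily tailI (tailFamily c) where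
  contDiff i := contDiff_tail_wave (contDiff_waveNumber hc hc1) contDiff_tailShift
    (hasDerivAt_sechDeriv i) (continuous_sechDeriv _) _
  deriv0 τ x := by
    have h1 : HasDerivAt (fun x => waveNumber c τ * x + tailShift τ) (waveNumber c τ) x := by
      simpa using ((hasDerivAt_id x).const_mul (waveNumber c τ)).add_const (tailShift τ)
    refine (((hasDerivAt_sechDeriv 0 _).comp x h1).const_mul _).congr_deriv ?_
    simp [tailFamily]; ring
  deriv1 τ x := by
    have h1 : HasDerivAt (fun x => waveNumber c τ * x + tailShift τ) (waveNumber c τ) x := by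
      simpa using ((hasDerivAt_id x).const_mul (waveNumber c τ)).add_const (tailShift τ)
    refine (((hasDerivAt_sechDeriv 1 _).comp x h1).const_mul _).congr_deriv ?_
    simp [tailFamily]; ring
  memLp i τ := memLp_tail_wave (waveNumber_pos hc hc1) tailShift_pos
    (hasDerivAt_sechDeriv i) (abs_sechDeriv_le _) _ τ
  dominated i τ₀ := dominated_tail_wave (contDiff_waveNumber hc hc1) (waveNumber_pos hc hc1)
    contDiff_tailShift tailShift_pos (hasDerivAt_sechDeriv i) (continuous_sechDeriv _)
    (abs_sechDeriv_le _) (abs_sechDeriv_le _) _ τ₀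

theorem integral_tailFamily_sq (τ : ℝ) : ∫ x in tailI, tailFamily c 0 τ x ^ 2
    = waveNumber c τ * (1 - Real.tanh (tailShift τ)) := by
  have hw := waveNumber_pos hc hc1 τ
  have h1 : ∀ x, HasDerivAt (fun x => waveNumber c τ * x + tailShift τ) (waveNumber c τ) x := by
    intro x
    simpa using ((hasDerivAt_id x).const_mul (waveNumber c τ)).add_const (tailShift τ)
  have hd : ∀ x, HasDerivAt (fun x => waveNumber c τ * Real.tanh (waveNumber c τ * x + tailShift τ))
      (tailFamily c 0 τ x ^ 2) x := fun x => by
    refine (((hasDerivAt_tanh _).comp x (h1 x)).const_mul _).congr_deriv ?_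
    simp only [tailFamily, sechDeriv]
    simp
    ring
  have hint : IntegrableOn (fun x => tailFamily c 0 τ x ^ 2) tailI volume :=
    ((isProfileFamily_tailFamily hc hc1).memLp 0 τ).integrable_sq
  have hlim : Tendsto (fun x => waveNumber c τ * Real.tanh (waveNumber c τ * x + tailShift τ)) atTop
      (𝓝 (waveNumber c τ * 1)) := by
    refine Tendsto.const_mul _ (tendsto_tanh_atTop.comp ?_)
    exact tendsto_atTop_add_const_right _ _ (tendsto_id.const_mul_atTop hw)
  rw [integral_Ioi_of_hasDerivAt_of_tendsto (hd 0).continuousAt.continuousWithinAt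
    (fun x _ => hd x) hint hlim]
  simp; ring

end

/-! ### The states -/

section

variable {N : ℕ} (hN : 1 ≤ N)

include hN

theorem one_le_cast : (1 : ℝ) ≤ N := by exact_mod_cast hN

theorem loopFamily_end (τ : ℝ) : loopFamily (1 / (2 * N)) 0 τ Real.pi
    = waveNumber (1 / (2 * N)) τ * (1 / Real.cosh (tailShift τ)) := by
  have hc := one_div_two_mul_pos (one_le_cast hN)
  have hc1 := one_div_two_mul_lt_one (one_le_cast hN)
  simp only [loopFamily, Matrix.cons_val_zero, waveNumber_mul_pi, dnoidal,
    phase_endTime hc hc1, profile_endPhase hc hc1]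

theorem loopFamily_neg (τ x : ℝ) : loopFamily (1 / (2 * N)) 0 τ (-x)
    = loopFamily (1 / (2 * N)) 0 τ x := by
  have hc := one_div_two_mul_pos (one_le_cast hN)
  have hc1 := one_div_two_mul_lt_one (one_le_cast hN)
  simp only [loopFamily, Matrix.cons_val_zero, mul_neg, dnoidal_neg hc hc1]

omit hN in
theorem tailFamily_zero (τ : ℝ) : tailFamily (1 / (2 * N)) 0 τ 0
    = waveNumber (1 / (2 * N)) τ * (1 / Real.cosh (tailShift τ)) := by
  simp [tailFamily, sechDeriv]

theorem vertexCondition_families (τ : ℝ) : VertexCondition N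
    (fun i => loopFamily (1 / (2 * N)) i τ) fun i => tailFamily (1 / (2 * N)) i τ := by
  have hc := one_div_two_mul_pos (one_le_cast hN)
  have hc1 := one_div_two_mul_lt_one (one_le_cast hN)
  refine ⟨?_, ?_, ?_⟩
  · exact (loopFamily_end hN τ).trans (tailFamily_zero τ).symm
  · exact ((loopFamily_neg hN τ _).trans (loopFamily_end hN τ)).trans (tailFamily_zero τ).symm
  · have h1 := tanh_div_cosh_tailShift hc τ
    have hN0 : (0 : ℝ) < N := by have := one_le_cast hN; linarith
    have h2 : Real.sinh (tailShift τ) / Real.cosh (tailShift τ) ^ 2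
        = N * (modulus (1 / (2 * N)) τ * Real.sin (endPhase (1 / (2 * N)) τ)) := by
      rw [sq, ← div_div, ← Real.tanh_eq_sinh_div_cosh, h1]
      field_simp
    simp only [loopFamily, tailFamily, sechDeriv, Matrix.cons_val_one, Matrix.cons_val_zero,
      mul_neg, waveNumber_mul_pi, dnoidalDeriv, phase_neg hc hc1, phase_endTime hc hc1,
      Fin.castSucc_one, Fin.val_one, mul_zero, zero_add, h2, Real.sin_neg]
    ring

end

/-- The state with parameter `τ`. -/
noncomputable def flowerState {N : ℕ} (hN : 1 ≤ N) (τ : ℝ) : H2NK N :=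
  H2NK.ofProfile
    ((isProfileFamily_loopFamily (one_div_two_mul_pos (one_le_cast hN))
      (one_div_two_mul_lt_one (one_le_cast hN))).isProfile τ)
    ((isProfileFamily_tailFamily (one_div_two_mul_pos (one_le_cast hN))
      (one_div_two_mul_lt_one (one_le_cast hN))).isProfile τ) (vertexCondition_families hN τ)

theorem contDiff_flowerState {N : ℕ} (hN : 1 ≤ N) : ContDiff ℝ 1 (flowerState hN) :=
  contDiff_H2NK_ofProfile
    (isProfileFamily_loopFamily (one_div_two_mul_pos (one_le_cast hN))
      (one_div_two_mul_lt_one (one_le_cast hN)))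
    (isProfileFamily_tailFamily (one_div_two_mul_pos (one_le_cast hN))
      (one_div_two_mul_lt_one (one_le_cast hN))) (vertexCondition_families hN)

/-- The continuous representative of the state with parameter `τ`. -/
noncomputable def flowerFun (N : ℕ) (τ : ℝ) : FlowerFun N :=
  ⟨fun _ => loopFamily (1 / (2 * N)) 0 τ, tailFamily (1 / (2 * N)) 0 τ⟩

theorem norm_toLp_sq {μ : Measure ℝ} {f : ℝ → ℝ} (hf : MemLp f 2 μ) :
    ‖hf.toLp f‖ ^ 2 = ∫ x, f x ^ 2 ∂μ := by
  rw [← real_inner_self_eq_norm_sq, L2.inner_def]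
  refine integral_congr_ae ?_
  filter_upwards [hf.coeFn_toLp] with x hx
  rw [hx, real_inner_self_eq_norm_sq, Real.norm_eq_abs, sq_abs]

section

variable {N : ℕ} (hN : 1 ≤ N) (τ : ℝ)

theorem mass_flowerState : mass (flowerState hN τ).1
    = endTime (1 / (2 * N)) τ * scaledMass N τ / Real.pi := by
  have hc := one_div_two_mul_pos (one_le_cast hN)
  have hc1 := one_div_two_mul_lt_one (one_le_cast hN)
  have hl := (isProfileFamily_loopFamily hc hc1).memLp 0 τ
  have ht := (isProfileFamily_tailFamily hc hc1).memLp 0 τ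
  have h : mass (flowerState hN τ).1 = (∑ _j : Fin N, ‖hl.toLp _‖ ^ 2) + ‖ht.toLp _‖ ^ 2 := rfl
  rw [h, norm_toLp_sq, norm_toLp_sq, integral_loopFamily_sq hc hc1, integral_tailFamily_sq hc hc1,
    scaledMass, Finset.sum_const, Finset.card_univ, Fintype.card_fin, nsmul_eq_mul, waveNumber]
  ring

theorem flowerFun_represents : (flowerFun N τ).Represents (flowerState hN τ).1 :=
  H2Flower.represents_ofProfile
    ((isProfileFamily_loopFamily (one_div_two_mul_pos (one_le_cast hN))
      (one_div_two_mul_lt_one (one_le_cast hN))).isProfile τ)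
    ((isProfileFamily_tailFamily (one_div_two_mul_pos (one_le_cast hN))
      (one_div_two_mul_lt_one (one_le_cast hN))).isProfile τ)

theorem stationaryNLS_flowerState :
    StationaryNLS (-waveNumber (1 / (2 * N)) τ ^ 2) (flowerState hN τ).1 := by
  have hc := one_div_two_mul_pos (one_le_cast hN)
  have hc1 := one_div_two_mul_lt_one (one_le_cast hN)
  have hl := (isProfileFamily_loopFamily hc hc1)
  have ht := (isProfileFamily_tailFamily hc hc1)
  refine ⟨fun j => ?_, ?_⟩
  · have h0 : H2.fn ((flowerState hN τ).1.loop j) =ᵐ[volume.restrict loopI]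
      loopFamily (1 / (2 * N)) 0 τ := (hl.memLp 0 τ).coeFn_toLp
    have h2 : H2.deriv2 ((flowerState hN τ).1.loop j) =ᵐ[volume.restrict loopI]
      loopFamily (1 / (2 * N)) 2 τ := (hl.memLp 2 τ).coeFn_toLp
    filter_upwards [h0, h2] with x e0 e2
    rw [e0, e2]
    simp only [loopFamily, Matrix.cons_val]
    ring
  · have h0 : H2.fn ((flowerState hN τ).1.tail) =ᵐ[volume.restrict tailI]
      tailFamily (1 / (2 * N)) 0 τ := (ht.memLp 0 τ).coeFn_toLp
    have h2 : H2.deriv2 ((flowerState hN τ).1.tail) =ᵐ[volume.restrict tailI]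
      tailFamily (1 / (2 * N)) 2 τ := (ht.memLp 2 τ).coeFn_toLp
    filter_upwards [h0, h2] with x e0 e2
    rw [e0, e2]
    simp only [tailFamily, sechDeriv]
    simp
    ring

include hN

theorem strictAntiOn_loopFamily :
    StrictAntiOn (loopFamily (1 / (2 * N)) 0 τ) (Icc 0 Real.pi) := by
  have hc := one_div_two_mul_pos (one_le_cast hN)
  have hc1 := one_div_two_mul_lt_one (one_le_cast hN)
  have hw := waveNumber_pos hc hc1 τ
  have hm : ∀ x ∈ Icc 0 Real.pi, waveNumber (1 / (2 * N)) τ * x ∈ Icc 0 (endTime (1 / (2 * N)) τ) :=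
    fun x hx => ⟨mul_nonneg hw.le hx.1, by
      rw [← waveNumber_mul_pi]; exact mul_le_mul_of_nonneg_left hx.2 hw.le⟩
  intro a ha b hb hab
  exact mul_lt_mul_of_pos_left (strictAntiOn_dnoidal hc hc1 τ (hm a ha) (hm b hb)
    (mul_lt_mul_of_pos_left hab hw)) hw

theorem strictAntiOn_tailFamily :
    StrictAntiOn (tailFamily (1 / (2 * N)) 0 τ) (Ici 0) := by
  have hc := one_div_two_mul_pos (one_le_cast hN)
  have hc1 := one_div_two_mul_lt_one (one_le_cast hN)
  have hw := waveNumber_pos hc hc1 τ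
  intro a ha b hb hab
  have ha' : 0 ≤ waveNumber (1 / (2 * N)) τ * a + tailShift τ :=
    add_nonneg (mul_nonneg hw.le ha) (tailShift_pos τ).le
  have h1 : waveNumber (1 / (2 * N)) τ * a + tailShift τ < waveNumber (1 / (2 * N)) τ * b + tailShift τ := by
    have := mul_lt_mul_of_pos_left hab hw
    linarith
  have h2 : Real.cosh (waveNumber (1 / (2 * N)) τ * a + tailShift τ)
      < Real.cosh (waveNumber (1 / (2 * N)) τ * b + tailShift τ) :=
    Real.cosh_strictMonoOn ha' (ha'.trans h1.le) h1
  have h3 := one_div_lt_one_div_of_lt (Real.cosh_pos _) h2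
  simpa [tailFamily, sechDeriv] using mul_lt_mul_of_pos_left h3 hw

theorem isSingleLobe_loopFamily : IsSingleLobe (loopFamily (1 / (2 * N)) 0 τ) := by
  have hpi := Real.pi_pos
  have habs : ∀ x, loopFamily (1 / (2 * N)) 0 τ x = loopFamily (1 / (2 * N)) 0 τ |x| := fun x => by
    rcases abs_choice x with h | h
    · rw [h]
    · rw [h, loopFamily_neg hN]
  have hanti := strictAntiOn_loopFamily hN τ
  have hm : ∀ x ∈ Icc (-Real.pi) Real.pi, |x| ∈ Icc 0 Real.pi := fun x hx =>
    ⟨abs_nonneg x, abs_le.2 hx⟩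
  refine Or.inl ⟨0, ⟨by linarith, hpi⟩, fun x hx hx0 => ?_, fun x hx => ?_⟩
  · rw [habs x]
    exact hanti ⟨le_rfl, hpi.le⟩ (hm x hx) (abs_pos.2 hx0)
  · have h := hanti.antitoneOn (hm x hx) ⟨hpi.le, le_rfl⟩ (hm x hx).2
    rw [← habs] at h
    exact ⟨by rwa [loopFamily_neg hN], h⟩

theorem isPositiveSingleLobeSymmetricState_flowerState :
    IsPositiveSingleLobeSymmetricState (-waveNumber (1 / (2 * N)) τ ^ 2) (flowerState hN τ)
      (flowerFun N τ) := by
  have hc := one_div_two_mul_pos (one_le_cast hN)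
  have hc1 := one_div_two_mul_lt_one (one_le_cast hN)
  have hw := waveNumber_pos hc hc1 τ
  refine ⟨flowerFun_represents hN τ, stationaryNLS_flowerState hN τ, fun j x _ => ?_, fun x _ => ?_,
    fun j => isSingleLobe_loopFamily hN τ, fun i j x _ => rfl⟩
  · exact mul_pos hw (profile_pos hc hc1 _ _)
  · have := Real.cosh_pos (waveNumber (1 / (2 * N)) τ * x + tailShift τ)
    exact mul_pos (pow_pos hw _) (one_div_pos.2 this)

end

/-! ### Uniqueness -/

theorem nonpos_of_hasDerivWithinAt_right_min {f : ℝ → ℝ} {d a b : ℝ} (hab : a < b)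
    (hd : HasDerivWithinAt f d (Icc a b) b) (h : ∀ x ∈ Icc a b, f b ≤ f x) : d ≤ 0 := by
  rw [hasDerivWithinAt_iff_tendsto_slope, Icc_sdiff_right] at hd
  have hne : (𝓝[Ico a b] b).NeBot := by
    rw [← mem_closure_iff_nhdsWithin_neBot, closure_Ico hab.ne]
    exact right_mem_Icc.2 hab.le
  refine le_of_tendsto hd ?_
  filter_upwards [self_mem_nhdsWithin] with x hx
  rw [slope_def_field]
  exact div_nonpos_of_nonneg_of_nonpos (sub_nonneg.2 (h x (Ico_subset_Icc_self hx)))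
    (sub_nonpos.2 hx.2.le)

theorem nonneg_of_hasDerivWithinAt_left_min {f : ℝ → ℝ} {d a b : ℝ} (hab : a < b)
    (hd : HasDerivWithinAt f d (Icc a b) a) (h : ∀ x ∈ Icc a b, f a ≤ f x) : 0 ≤ d := by
  rw [hasDerivWithinAt_iff_tendsto_slope, Icc_sdiff_left] at hd
  have hne : (𝓝[Ioc a b] a).NeBot := by
    rw [← mem_closure_iff_nhdsWithin_neBot, closure_Ioc hab.ne]
    exact left_mem_Icc.2 hab.le
  refine ge_of_tendsto hd ?_
  filter_upwards [self_mem_nhdsWithin] with x hx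
  rw [slope_def_field]
  exact div_nonneg (sub_nonneg.2 (h x (Ioc_subset_Icc_self hx))) (sub_nonneg.2 hx.1.le)

/-- Conservation of energy: the derivative is 2f'(f'' - k²f + 2f³) = 0. -/
theorem energy_eq {J : Set ℝ} (hJ : Convex ℝ J) {k : ℝ} {f f' : ℝ → ℝ}
    (hf : ∀ x ∈ J, HasDerivWithinAt f (f' x) J x)
    (hf' : ∀ x ∈ J, HasDerivWithinAt f' (k ^ 2 * f x - 2 * f x ^ 3) J x) {x y : ℝ} (hx : x ∈ J)
    (hy : y ∈ J) : f' y ^ 2 - k ^ 2 * f y ^ 2 + f y ^ 4 = f' x ^ 2 - k ^ 2 * f x ^ 2 + f x ^ 4 := by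
  have hd : ∀ z ∈ J, HasDerivWithinAt (fun z => f' z ^ 2 - k ^ 2 * f z ^ 2 + f z ^ 4) 0 J z := by
    intro z hz
    refine ((((hf' z hz).fun_pow 2).fun_sub (((hf z hz).fun_pow 2).const_mul (k ^ 2))).fun_add
      ((hf z hz).fun_pow 4)).congr_deriv ?_
    norm_num
    ring
  have h := hJ.norm_image_sub_le_of_norm_hasDerivWithin_le hd (C := 0) (fun z _ => by simp) hx hy
  rw [zero_mul, norm_le_zero_iff, sub_eq_zero] at h
  exact h

theorem FlowerFun.Represents.eqOn_loop {N : ℕ} {φ ψ : FlowerFun N} {Φ : H2Flower N}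
    (hφ : φ.Represents Φ) (hψ : ψ.Represents Φ) (j : Fin N) :
    EqOn (φ.loop j) (ψ.loop j) (Icc (-Real.pi) Real.pi) := by
  have hpi : -Real.pi ≠ Real.pi := by linarith [Real.pi_pos]
  have h : EqOn (φ.loop j) (ψ.loop j) loopI := Measure.eqOn_open_of_ae_eq
    ((hφ.loop_ae j).trans (hψ.loop_ae j).symm) isOpen_Ioo
    ((hφ.loop_contDiffOn j).continuousOn.mono Ioo_subset_Icc_self)
    ((hψ.loop_contDiffOn j).continuousOn.mono Ioo_subset_Icc_self)
  exact h.of_subset_closure (hφ.loop_contDiffOn j).continuousOn (hψ.loop_contDiffOn j).continuousOn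
    Ioo_subset_Icc_self (closure_Ioo hpi).ge

theorem FlowerFun.Represents.eqOn_tail {N : ℕ} {φ ψ : FlowerFun N} {Φ : H2Flower N}
    (hφ : φ.Represents Φ) (hψ : ψ.Represents Φ) : EqOn φ.tail ψ.tail (Ici 0) := by
  have h : EqOn φ.tail ψ.tail tailI := Measure.eqOn_open_of_ae_eq
    (hφ.tail_ae.trans hψ.tail_ae.symm) isOpen_Ioi
    (hφ.tail_contDiffOn.continuousOn.mono Ioi_subset_Ici_self)
    (hψ.tail_contDiffOn.continuousOn.mono Ioi_subset_Ici_self)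
  exact h.of_subset_closure hφ.tail_contDiffOn.continuousOn hψ.tail_contDiffOn.continuousOn
    Ioi_subset_Ici_self (closure_Ioi (0 : ℝ)).ge

/-- Membership in `H2NK` only supplies some representative; any two agree on the closed edges by
continuity, and so do their one-sided derivatives. -/
theorem FlowerFun.Represents.neumannKirchhoff {N : ℕ} {ψ : FlowerFun N} {Ψ : H2NK N}
    (hψ : ψ.Represents Ψ.1) : ψ.NeumannKirchhoff := by
  obtain ⟨φ, hφ, kφ⟩ := Ψ.2
  have hpi : -Real.pi ≤ Real.pi := by linarith [Real.pi_pos]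
  have hl := fun j => hψ.eqOn_loop hφ j
  have ht := hψ.eqOn_tail hφ
  refine ⟨fun j => ?_, fun j => ?_, ?_⟩
  · rw [hl j (right_mem_Icc.2 hpi), ht self_mem_Ici, kφ.right_eq]
  · rw [hl j (left_mem_Icc.2 hpi), ht self_mem_Ici, kφ.left_eq]
  · rw [derivWithin_congr ht (ht self_mem_Ici), ← kφ.kirchhoff]
    refine Finset.sum_congr rfl fun j _ => ?_
    rw [derivWithin_congr (hl j) (hl j (right_mem_Icc.2 hpi)),
      derivWithin_congr (hl j) (hl j (left_mem_Icc.2 hpi))]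

/-! ### Regularity and half-line energy of an arbitrary state -/

section

variable {N : ℕ} {k : ℝ} {Ψ : H2NK N} {ψ : FlowerFun N}

theorem hasDerivWithinAt_loop (hr : ψ.Represents Ψ.1) (j : Fin N) {x : ℝ}
    (hx : x ∈ Icc (-Real.pi) Real.pi) :
    HasDerivWithinAt (ψ.loop j) (derivWithin (ψ.loop j) (Icc (-Real.pi) Real.pi) x)
      (Icc (-Real.pi) Real.pi) x :=
  ((hr.loop_contDiffOn j).differentiableOn one_ne_zero x hx).hasDerivWithinAt

theorem hasDerivWithinAt_loop_deriv (hr : ψ.Represents Ψ.1) (hs : StationaryNLS (-k ^ 2) Ψ.1)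
    (j : Fin N) {x : ℝ} (hx : x ∈ Icc (-Real.pi) Real.pi) :
    HasDerivWithinAt (derivWithin (ψ.loop j) (Icc (-Real.pi) Real.pi))
      (k ^ 2 * ψ.loop j x - 2 * ψ.loop j x ^ 3) (Icc (-Real.pi) Real.pi) x := by
  have hpi : -Real.pi < Real.pi := by linarith [Real.pi_pos]
  have hcl : closure loopI = Icc (-Real.pi) Real.pi := closure_Ioo hpi.ne
  have hc := (hr.loop_contDiffOn j).continuousOn
  have h := H2.hasDerivWithinAt_derivWithin (I := loopI) isOpen_Ioo (convex_Ioo _ _)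
    (nonempty_Ioo.2 hpi) (U := Ψ.1.loop j) (φ := ψ.loop j)
    (f := fun x => k ^ 2 * ψ.loop j x - 2 * ψ.loop j x ^ 3) (x := x)
    (by rw [hcl]; exact hr.loop_contDiffOn j) (hr.loop_ae j)
    (by rw [hcl]; fun_prop) (by
      filter_upwards [hr.loop_ae j, hs.loop j] with y h1 h2
      rw [h1]; linarith) (by rwa [hcl])
  rwa [hcl] at h

theorem hasDerivWithinAt_tail (hr : ψ.Represents Ψ.1) {x : ℝ} (hx : x ∈ Ici (0 : ℝ)) :
    HasDerivWithinAt ψ.tail (derivWithin ψ.tail (Ici 0) x) (Ici 0) x :=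
  (hr.tail_contDiffOn.differentiableOn one_ne_zero x hx).hasDerivWithinAt

theorem hasDerivWithinAt_tail_deriv (hr : ψ.Represents Ψ.1) (hs : StationaryNLS (-k ^ 2) Ψ.1)
    {x : ℝ} (hx : x ∈ Ici (0 : ℝ)) : HasDerivWithinAt (derivWithin ψ.tail (Ici 0))
      (k ^ 2 * ψ.tail x - 2 * ψ.tail x ^ 3) (Ici 0) x := by
  have hcl : closure tailI = Ici 0 := closure_Ioi 0
  have hc := hr.tail_contDiffOn.continuousOn
  have h := H2.hasDerivWithinAt_derivWithin (I := tailI) isOpen_Ioi (convex_Ioi _)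
    nonempty_Ioi (U := Ψ.1.tail) (φ := ψ.tail)
    (f := fun x => k ^ 2 * ψ.tail x - 2 * ψ.tail x ^ 3) (x := x)
    (by rw [hcl]; exact hr.tail_contDiffOn) hr.tail_ae
    (by rw [hcl]; fun_prop) (by
      filter_upwards [hr.tail_ae, hs.tail] with y h1 h2
      rw [h1]; linarith) (by rwa [hcl])
  rwa [hcl] at h

/-- An integrable function with a limit at infinity has limit zero, as neighbourhoods of infinity
have infinite measure. -/
theorem eq_zero_of_tendsto_sq {u : L2 tailI} {f : ℝ → ℝ} (hf : f =ᵐ[volume.restrict tailI] u) {e : ℝ}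
    (h : Tendsto (fun x => f x ^ 2) atTop (𝓝 e)) : e = 0 := by
  have hi : IntegrableOn (fun x => f x ^ 2) tailI volume :=
    ((memLp_congr_ae hf).2 (Lp.memLp u)).integrable_sq
  refine IntegrableAtFilter.eq_zero_of_tendsto (l := atTop) (μ := volume)
    ⟨tailI, Ioi_mem_atTop 0, hi⟩ (fun s hs => ?_) h
  obtain ⟨b, hb⟩ := mem_atTop_sets.1 hs
  exact measure_mono_top (s₁ := Ici b) hb Real.volume_Ici

/-- A positive monotone function has a limit, which is 0 by square integrability. Energy
conservation then makes f'² converge to the energy, and f' is square integrable too. -/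
theorem tail_energy_eq_zero (hr : ψ.Represents Ψ.1) (hs : StationaryNLS (-k ^ 2) Ψ.1)
    (hpos : ∀ x ∈ Ici (0 : ℝ), 0 < ψ.tail x) (hanti : AntitoneOn ψ.tail (Ici 0)) :
    derivWithin ψ.tail (Ici 0) 0 ^ 2 = k ^ 2 * ψ.tail 0 ^ 2 - ψ.tail 0 ^ 4 := by
  set f := ψ.tail with hf
  set f' := derivWithin f (Ici 0) with hf'
  have hlim : ∃ e, Tendsto f atTop (𝓝 e) := by
    have h1 : Antitone fun x => f (max x 0) := fun x y hxy =>
      hanti (mem_Ici.2 (le_max_right x 0)) (mem_Ici.2 (le_max_right y 0)) (max_le_max_right 0 hxy)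
    have h2 : BddBelow (range fun x => f (max x 0)) :=
      ⟨0, by rintro _ ⟨x, rfl⟩; exact (hpos _ (mem_Ici.2 (le_max_right x 0))).le⟩
    refine ⟨_, (tendsto_atTop_ciInf h1 h2).congr' ?_⟩
    filter_upwards [eventually_ge_atTop 0] with x hx
    rw [max_eq_left hx]
  obtain ⟨e, he⟩ := hlim
  have he0 : e = 0 := pow_eq_zero_iff two_ne_zero |>.1 (eq_zero_of_tendsto_sq hr.tail_ae (he.pow 2))
  rw [he0] at he
  have hcl : closure tailI = Ici 0 := closure_Ioi 0
  have hae : f' =ᵐ[volume.restrict tailI] (Ψ.1.tail).1 1 := by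
    have := ae_eq_derivWithin_of_contDiffOn (I := tailI) isOpen_Ioi (convex_Ioi _) Ψ.1.tail.2.1
      (φ := ψ.tail) (by rw [hcl]; exact hr.tail_contDiffOn) hr.tail_ae
    rwa [hcl] at this
  have hen : ∀ x ∈ Ici (0 : ℝ), f' x ^ 2
      = (f' 0 ^ 2 - k ^ 2 * f 0 ^ 2 + f 0 ^ 4) + k ^ 2 * f x ^ 2 - f x ^ 4 := fun x hx => by
    have := energy_eq (convex_Ici 0) (fun x hx => hasDerivWithinAt_tail hr hx)
      (fun x hx => hasDerivWithinAt_tail_deriv hr hs hx) self_mem_Ici hx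
    linarith
  have hlim' : Tendsto (fun x => f' x ^ 2) atTop (𝓝 (f' 0 ^ 2 - k ^ 2 * f 0 ^ 2 + f 0 ^ 4)) := by
    have h1 := (((he.pow 2).const_mul (k ^ 2)).const_add
      (f' 0 ^ 2 - k ^ 2 * f 0 ^ 2 + f 0 ^ 4)).sub (he.pow 4)
    simp only [ne_eq, OfNat.ofNat_ne_zero, not_false_eq_true, zero_pow, mul_zero, add_zero,
      sub_zero] at h1
    refine h1.congr' ?_
    filter_upwards [eventually_ge_atTop 0] with x hx
    rw [hen x hx]
  have := eq_zero_of_tendsto_sq hae hlim'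
  linarith

end

theorem hasDerivAt_rescale {u u' : ℝ → ℝ} (hu : ∀ z, HasDerivAt u (u' z) z)
    (k β x : ℝ) : HasDerivAt (fun x => k * u (k * x + β)) (k ^ 2 * u' (k * x + β)) x := by
  have h1 : HasDerivAt (fun x => k * x + β) k x := by
    simpa using ((hasDerivAt_id x).const_mul k).add_const β
  exact (((hu _).comp x h1).const_mul k).congr_deriv (by ring)

theorem hasDerivAt_rescale_deriv {u u' : ℝ → ℝ} (hu' : ∀ z, HasDerivAt u' (u z - 2 * u z ^ 3) z)
    (k β x : ℝ) : HasDerivAt (fun x => k ^ 2 * u' (k * x + β))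
      (k ^ 2 * (k * u (k * x + β)) - 2 * (k * u (k * x + β)) ^ 3) x := by
  have h1 : HasDerivAt (fun x => k * x + β) k x := by
    simpa using ((hasDerivAt_id x).const_mul k).add_const β
  exact (((hu' _).comp x h1).const_mul (k ^ 2)).congr_deriv (by ring)

theorem contDiff_cubic (k : ℝ) : ContDiff ℝ 1 fun u : ℝ => k ^ 2 * u - 2 * u ^ 3 := by fun_prop

section

variable {N : ℕ} {k : ℝ} {Ψ : H2NK N} {ψ : FlowerFun N}

/-- Zero energy bounds the vertex value by k, so it equals k / cosh a for some a ≥ 0; monotonicity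
selects the sign of the derivative, and the Cauchy data at 0 are those of the sech. -/
theorem exists_tail_eq (hk : 0 < k) (hr : ψ.Represents Ψ.1) (hs : StationaryNLS (-k ^ 2) Ψ.1)
    (hpos : ∀ x ∈ Ici (0 : ℝ), 0 < ψ.tail x) (hanti : AntitoneOn ψ.tail (Ici 0)) :
    ∃ a, 0 ≤ a ∧ EqOn ψ.tail (fun x => k * sechDeriv 0 (k * x + a)) (Ici 0) ∧
      derivWithin ψ.tail (Ici 0) 0 = k ^ 2 * sechDeriv 1 a := by
  have hE := tail_energy_eq_zero hr hs hpos hanti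
  have hP := hpos 0 self_mem_Ici
  set P := ψ.tail 0 with hPdef
  set D := derivWithin ψ.tail (Ici 0) 0 with hDdef
  have hD : D ≤ 0 := by
    have h1 := ((hasDerivWithinAt_tail hr (x := 0) self_mem_Ici).mono
      (Icc_subset_Ici_self : Icc (0 : ℝ) 1 ⊆ Ici 0)).fun_neg
    have h2 := nonneg_of_hasDerivWithinAt_left_min one_pos h1 fun x hx =>
      neg_le_neg (hanti self_mem_Ici hx.1 hx.1)
    linarith
  have hPk : P ≤ k := by
    have h1 : 0 ≤ P ^ 2 * (k ^ 2 - P ^ 2) := by nlinarith [sq_nonneg D]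
    have h2 : 0 ≤ k ^ 2 - P ^ 2 := nonneg_of_mul_nonneg_right h1 (by positivity)
    nlinarith
  have h1 : 1 ≤ k / P := (one_le_div hP).2 hPk
  set a := Real.arsinh (√((k / P) ^ 2 - 1)) with ha
  have hsq : 0 ≤ (k / P) ^ 2 - 1 := by nlinarith
  have hcosh : Real.cosh a = k / P := by
    rw [ha, Real.cosh_arsinh, Real.sq_sqrt hsq, add_sub_cancel, Real.sqrt_sq (by positivity)]
  have hsinh : Real.sinh a ^ 2 = (k / P) ^ 2 - 1 := by
    rw [ha, Real.sinh_arsinh, Real.sq_sqrt hsq]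
  have hsinh0 : 0 ≤ Real.sinh a := by rw [ha, Real.sinh_arsinh]; exact Real.sqrt_nonneg _
  have ha0 : 0 ≤ a := Real.arsinh_nonneg_iff.2 (Real.sqrt_nonneg _)
  have hv : P = k * sechDeriv 0 a := by
    simp only [sechDeriv, Matrix.cons_val_zero, hcosh]
    field_simp
  have hd : D = k ^ 2 * sechDeriv 1 a := by
    simp only [sechDeriv, Matrix.cons_val_one, Matrix.cons_val_zero, hcosh]
    have h2 : D ^ 2 = (P ^ 2 * Real.sinh a) ^ 2 := by
      rw [mul_pow, hsinh, hE]; field_simp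
    have h3 : -D = P ^ 2 * Real.sinh a := by
      rw [← neg_sq D] at h2
      exact (sq_eq_sq₀ (by linarith) (by positivity)).1 h2
    field_simp
    linarith
  refine ⟨a, ha0, fun b hb => ?_, hd⟩
  have hsub : Icc 0 b ⊆ Ici 0 := Icc_subset_Ici_self
  refine eqOn_of_second_order_ode (contDiff_cubic k) (a := 0) (b := b)
    (f' := derivWithin ψ.tail (Ici 0)) (g' := fun x => k ^ 2 * sechDeriv 1 (k * x + a))
    (fun x hx => (hasDerivWithinAt_tail hr (hsub hx)).mono hsub)
    (fun x hx => (hasDerivWithinAt_tail_deriv hr hs (hsub hx)).mono hsub)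
    (fun x _ => (hasDerivAt_rescale hasDerivAt_sech0 k a x).hasDerivWithinAt)
    (fun x _ => (hasDerivAt_rescale_deriv (u := sechDeriv 0) hasDerivAt_sech1 k a x).hasDerivWithinAt)
    ?_ ?_ (right_mem_Icc.2 hb)
  · simpa using hv
  · simpa using hd

end

/-! ### Identification of the loop component -/

section

variable {f f' : ℝ → ℝ} {k a : ℝ}

/-- This excludes the shift a = 0. In a single lobe the derivatives at the two ends have opposite
signs, so equal ones vanish. Then f is the sech wave centred at π, whose value at -π is strictly
below k. -/
theorem false_of_deriv_eq_of_ends_eq (hk : 0 < k)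
    (hf : ∀ x ∈ Icc (-Real.pi) Real.pi, HasDerivWithinAt f (f' x) (Icc (-Real.pi) Real.pi) x)
    (hf' : ∀ x ∈ Icc (-Real.pi) Real.pi,
      HasDerivWithinAt f' (k ^ 2 * f x - 2 * f x ^ 3) (Icc (-Real.pi) Real.pi) x)
    (hlobe : IsSingleLobe f) (hr : f Real.pi = k) (hl : f (-Real.pi) = k)
    (hd : f' Real.pi = f' (-Real.pi)) : False := by
  have hpi : -Real.pi < Real.pi := by linarith [Real.pi_pos]
  have hR := hf _ (right_mem_Icc.2 hpi.le)
  have hL := hf _ (left_mem_Icc.2 hpi.le)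
  have h0 : f' Real.pi = 0 := by
    rcases hlobe with ⟨m, -, -, h⟩ | ⟨m, -, -, h⟩
    · have h1 := nonpos_of_hasDerivWithinAt_right_min hpi hR fun x hx => (h x hx).2
      have h2 := nonneg_of_hasDerivWithinAt_left_min hpi hL fun x hx => (h x hx).1
      linarith
    · have h1 := nonpos_of_hasDerivWithinAt_right_min hpi hR.fun_neg
        fun x hx => neg_le_neg (h x hx).2
      have h2 := nonneg_of_hasDerivWithinAt_left_min hpi hL.fun_neg
        fun x hx => neg_le_neg (h x hx).1
      linarith
  have heq := eqOn_of_second_order_ode_right (contDiff_cubic k) hf hf'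
    (g := fun x => k * sechDeriv 0 (k * x + -(k * Real.pi)))
    (g' := fun x => k ^ 2 * sechDeriv 1 (k * x + -(k * Real.pi)))
    (fun x _ => (hasDerivAt_rescale hasDerivAt_sech0 k _ x).hasDerivWithinAt)
    (fun x _ => (hasDerivAt_rescale_deriv (u := sechDeriv 0) hasDerivAt_sech1 k _ x).hasDerivWithinAt)
    (by simp [hr, sechDeriv]) (by simp [h0, sechDeriv])
  have h1 := heq (left_mem_Icc.2 hpi.le)
  rw [hl] at h1
  have h2 : 1 < Real.cosh (k * -Real.pi + -(k * Real.pi)) := by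
    rw [Real.one_lt_cosh]
    have := mul_pos hk Real.pi_pos
    linarith
  have h3 : k * sechDeriv 0 (k * -Real.pi + -(k * Real.pi)) < k := by
    simp only [sechDeriv, Matrix.cons_val_zero]
    rw [mul_one_div, div_lt_iff₀ (by linarith)]
    nlinarith
  simp only at h1
  linarith

theorem phase_eq_neg_endPhase_add {c : ℝ} (hc : 0 < c) (hc1 : c < 1) {τ z : ℝ}
    (hv : dnoidal c τ z = dnoidal c τ (endTime c τ))
    (hd : dnoidalDeriv c τ z = -dnoidalDeriv c τ (endTime c τ)) :
    ∃ n : ℤ, (n : ℝ) * (2 * Real.pi) = phase c τ z + endPhase c τ := by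
  have hs := modulus_pos hc τ
  have h1 : Real.cos (phase c τ z) = Real.cos (endPhase c τ) := by
    have h2 := congrArg (· ^ 2) hv
    simp only [dnoidal, profile_sq hc hc1, phase_endTime hc hc1] at h2
    have h3 : modulus c τ * Real.cos (phase c τ z) = modulus c τ * Real.cos (endPhase c τ) := by
      linarith
    exact mul_left_cancel₀ hs.ne' h3
  have h2 : Real.sin (phase c τ z) = -Real.sin (endPhase c τ) := by
    simp only [dnoidalDeriv, phase_endTime hc hc1] at hd
    have h3 : modulus c τ * Real.sin (phase c τ z) = modulus c τ * -Real.sin (endPhase c τ) := by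
      linarith
    exact mul_left_cancel₀ hs.ne' h3
  refine (Real.cos_eq_one_iff _).1 ?_
  rw [Real.cos_add, h1, h2]
  nlinarith [Real.sin_sq_add_cos_sq (endPhase c τ)]

/-- Identification of a single-lobe solution on a loop with the dnoidal wave. -/
theorem loop_eq_dnoidal {c : ℝ} (hc : 0 < c) (hc1 : c < 1) {τ : ℝ} (hk : 0 < k)
    (hf : ∀ x ∈ Icc (-Real.pi) Real.pi, HasDerivWithinAt f (f' x) (Icc (-Real.pi) Real.pi) x)
    (hf' : ∀ x ∈ Icc (-Real.pi) Real.pi,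
      HasDerivWithinAt f' (k ^ 2 * f x - 2 * f x ^ 3) (Icc (-Real.pi) Real.pi) x)
    (hlobe : IsSingleLobe f) (hr : f Real.pi = k * dnoidal c τ (endTime c τ))
    (hl : f (-Real.pi) = f Real.pi) (hd : f' Real.pi = k ^ 2 * dnoidalDeriv c τ (endTime c τ))
    (hd' : f' (-Real.pi) = -f' Real.pi) :
    k = waveNumber c τ ∧ EqOn f (loopFamily c 0 τ) (Icc (-Real.pi) Real.pi) := by
  have hpi0 := Real.pi_pos
  have hpi : -Real.pi < Real.pi := by linarith
  have hkpi := mul_pos hk hpi0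
  have hR := hf _ (right_mem_Icc.2 hpi.le)
  set T := endTime c τ with hT
  -- Chosen so that the rescaled time is T at x = π.
  set β := T - k * Real.pi with hβ
  have hsn := sin_endPhase_pos (c := c) τ
  have hs := modulus_pos hc τ
  have hneg : f' Real.pi < 0 := by
    rw [hd, hT, dnoidalDeriv, phase_endTime hc hc1]
    have := mul_pos (pow_pos hk 2) (mul_pos hs hsn)
    linarith
  have hg : ∀ x, HasDerivAt (fun x => k * dnoidal c τ (k * x + β))
    (k ^ 2 * dnoidalDeriv c τ (k * x + β)) x := hasDerivAt_rescale (hasDerivAt_dnoidal hc hc1 τ) k β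
  have heq := eqOn_of_second_order_ode_right (contDiff_cubic k) hf hf'
    (g := fun x => k * dnoidal c τ (k * x + β))
    (g' := fun x => k ^ 2 * dnoidalDeriv c τ (k * x + β))
    (fun x _ => (hg x).hasDerivWithinAt)
    (fun x _ => (hasDerivAt_rescale_deriv (hasDerivAt_dnoidalDeriv hc hc1 τ) k β x).hasDerivWithinAt)
    (by simp [hr, hβ]) (by simp [hd, hβ])
  set z := k * -Real.pi + β with hz
  have hmemL := left_mem_Icc.2 hpi.le
  have hv1 : dnoidal c τ z = dnoidal c τ T := by
    have h1 := heq hmemL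
    simp only at h1
    rw [hl, hr] at h1
    exact (mul_left_cancel₀ hk.ne' h1).symm
  have hv2 : dnoidalDeriv c τ z = -dnoidalDeriv c τ T := by
    have h1 := ((hg (-Real.pi)).hasDerivWithinAt (s := Icc (-Real.pi) Real.pi)).congr heq
      (heq hmemL)
    have h2 := (uniqueDiffOn_Icc hpi _ hmemL).eq_deriv _ (hf _ hmemL) h1
    rw [hd', hd, ← mul_neg] at h2
    exact (mul_left_cancel₀ (pow_pos hk 2).ne' h2).symm
  obtain ⟨n, hn⟩ := phase_eq_neg_endPhase_add hc hc1 hv1 hv2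
  have hmono := strictMono_phase hc hc1 τ
  have hzT : z < T := by rw [hz, hβ]; linarith
  have hχ := endPhase_lt_pi (c := c) τ
  have hχ0 := endPhase_pos (c := c) τ
  have hph : phase c τ z < endPhase c τ := by rw [← phase_endTime hc hc1]; exact hmono hzT
  -- The phase at -π is below θ, so 2πn < 2θ < 2π.
  have hn0 : n ≤ 0 := by
    by_contra hcon
    have : (1 : ℝ) ≤ n := by exact_mod_cast not_le.1 hcon
    nlinarith
  -- For n ≤ -1 the orbit crosses both phases 0 and -2π inside the loop and attains its maximum
  -- twice.
  have hn1 : n = 0 := by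
    by_contra hcon
    have hn2 : (n : ℝ) ≤ -1 := by
      have : n ≤ -1 := by omega
      exact_mod_cast this
    have hph2 : phase c τ z < -(2 * Real.pi) := by nlinarith
    have hpt : ∀ ψ, phase c τ z < ψ → ψ < endPhase c τ →
        (phaseTime c τ ψ - β) / k ∈ Icc (-Real.pi) Real.pi := by
      intro ψ h1 h2
      have h3 : z < phaseTime c τ ψ := by
        rw [← phaseTime_phase hc hc1 τ z]; exact strictMono_phaseTime hc hc1 τ h1
      have h4 : phaseTime c τ ψ < T := strictMono_phaseTime hc hc1 τ h2
      constructor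
      · rw [le_div_iff₀ hk]; rw [hz] at h3; linarith
      · rw [div_le_iff₀ hk]; rw [hβ]; linarith
    have hval : ∀ ψ, phase c τ z < ψ → ψ < endPhase c τ →
        f ((phaseTime c τ ψ - β) / k) = k * profile c τ ψ := by
      intro ψ h1 h2
      have h3 := heq (hpt ψ h1 h2)
      simp only at h3
      rw [h3, mul_div_cancel₀ _ hk.ne', sub_add_cancel, dnoidal, phase_phaseTime hc hc1]
    rcases hlobe with ⟨m, hm, hmax, -⟩ | ⟨m, -, -, hends⟩
    · have htop : ∀ x ∈ Icc (-Real.pi) Real.pi, f x ≤ k * profile c τ 0 := by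
        intro x hx
        rw [heq hx]
        refine mul_le_mul_of_nonneg_left (Real.sqrt_le_sqrt ?_) hk.le
        have := Real.cos_le_one (phase c τ (k * x + β))
        rw [Real.cos_zero]
        nlinarith
      have huniq : ∀ ψ, phase c τ z < ψ → ψ < endPhase c τ → profile c τ ψ = profile c τ 0 →
          (phaseTime c τ ψ - β) / k = m := by
        intro ψ h1 h2 h3
        by_contra hne
        have h4 := hmax _ (hpt ψ h1 h2) hne
        rw [hval ψ h1 h2, h3] at h4
        exact absurd (htop m (Ioo_subset_Icc_self hm)) (not_le.2 h4)
      have e1 := huniq 0 (by linarith) hχ0 rfl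
      have e2 := huniq (-(2 * Real.pi)) hph2 (by linarith) (by simp [profile])
      have e3 : phaseTime c τ 0 = phaseTime c τ (-(2 * Real.pi)) := by
        have := e1.trans e2.symm
        rw [div_left_inj' hk.ne'] at this
        linarith
      have := (strictMono_phaseTime hc hc1 τ).injective e3
      linarith
    -- A maximum at the end π would require f'(π) ≥ 0.
    · have := nonpos_of_hasDerivWithinAt_right_min hpi hR.fun_neg
        fun x hx => neg_le_neg (hends x hx).2
      linarith
  rw [hn1] at hn
  have hzz : z = -T := by
    rw [← phaseTime_phase hc hc1 τ z, show phase c τ z = -endPhase c τ by simp at hn; linarith,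
      phaseTime_neg]
    rfl
  have hkT : k * Real.pi = T := by
    rw [hz, hβ] at hzz; linarith
  have hkw : k = waveNumber c τ := by
    rw [waveNumber, eq_div_iff Real.pi_ne_zero]; exact hkT
  refine ⟨hkw, fun x hx => ?_⟩
  rw [heq hx]
  simp only [loopFamily, Matrix.cons_val_zero, ← hkw]
  rw [show β = 0 by rw [hβ]; linarith, add_zero]

end

theorem tailShift_log_sinh {a : ℝ} (ha : 0 < a) : tailShift (Real.log (Real.sinh a)) = a := by
  rw [tailShift, Real.exp_log (Real.sinh_pos_iff.2 ha), Real.arsinh_sinh]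

section

variable {N : ℕ} (hN : 1 ≤ N) {k : ℝ} {Ψ : H2NK N} {ψ : FlowerFun N}

theorem eq_flowerState_of_eqOn {τ : ℝ} (hr : ψ.Represents Ψ.1)
    (hl : ∀ j, EqOn (ψ.loop j) (loopFamily (1 / (2 * N)) 0 τ) (Icc (-Real.pi) Real.pi))
    (ht : EqOn ψ.tail (tailFamily (1 / (2 * N)) 0 τ) (Ici 0)) : Ψ = flowerState hN τ := by
  have hr' := flowerFun_represents hN τ
  have h1 : ∀ j, Ψ.1.loop j = (flowerState hN τ).1.loop j := fun j => by
    refine H2.ext_fn isOpen_Ioo (Lp.ext ?_)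
    have h2 : ψ.loop j =ᵐ[volume.restrict loopI] (flowerFun N τ).loop j :=
      (ae_restrict_iff' measurableSet_Ioo).2
        (.of_forall fun x hx => hl j (Ioo_subset_Icc_self hx))
    exact ((hr.loop_ae j).symm.trans h2).trans (hr'.loop_ae j)
  have h3 : Ψ.1.tail = (flowerState hN τ).1.tail := by
    refine H2.ext_fn isOpen_Ioi (Lp.ext ?_)
    have h2 : ψ.tail =ᵐ[volume.restrict tailI] (flowerFun N τ).tail :=
      (ae_restrict_iff' measurableSet_Ioi).2
        (.of_forall fun x hx => ht (Ioi_subset_Ici_self hx))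
    exact (hr.tail_ae.symm.trans h2).trans hr'.tail_ae
  refine Subtype.ext ((WithLp.ofLp_injective 2) (Prod.ext ?_ h3))
  exact PiLp.ext h1

include hN

/-- The half-line yields the shift a, hence τ = log sinh a; the vertex conditions transfer the data
to the loop, which is then forced to be the dnoidal wave of the same τ. -/
theorem exists_eq_flowerState (hk : 0 < k)
    (h : IsPositiveSingleLobeSymmetricState (-k ^ 2) Ψ ψ) (hanti : AntitoneOn ψ.tail (Ici 0)) :
    ∃ τ, k = waveNumber (1 / (2 * N)) τ ∧ Ψ = flowerState hN τ := by
  have hc := one_div_two_mul_pos (one_le_cast hN)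
  have hc1 := one_div_two_mul_lt_one (one_le_cast hN)
  have hN0 : (0 : ℝ) < N := by have := one_le_cast hN; linarith
  have hpi : -Real.pi < Real.pi := by linarith [Real.pi_pos]
  have hr := h.represents
  have hNK := hr.neumannKirchhoff
  obtain ⟨a, ha, htail, hD⟩ := exists_tail_eq hk hr h.nls h.tail_pos hanti
  set j₀ : Fin N := ⟨0, hN⟩
  set f := ψ.loop j₀ with hf
  set f' := derivWithin f (Icc (-Real.pi) Real.pi) with hf'
  have hfd := fun x hx => hasDerivWithinAt_loop hr j₀ (x := x) hx
  have hfd' := fun x hx => hasDerivWithinAt_loop_deriv hr h.nls j₀ (x := x) hx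
  have hP : ψ.tail 0 = k * sechDeriv 0 a := by simpa using htail self_mem_Ici
  have hRv : f Real.pi = k * sechDeriv 0 a := (hNK.right_eq j₀).trans hP
  have hLv : f (-Real.pi) = k * sechDeriv 0 a := (hNK.left_eq j₀).trans hP
  have hK : (N : ℝ) * (f' Real.pi - f' (-Real.pi)) = k ^ 2 * sechDeriv 1 a := by
    rw [← hD, ← hNK.kirchhoff, Finset.sum_congr rfl (g := fun _ => f' Real.pi - f' (-Real.pi))]
    · simp [mul_sub]
    · intro j _
      have hj := h.symmetric j j₀
      rw [derivWithin_congr hj (hj (right_mem_Icc.2 hpi.le)),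
        derivWithin_congr hj (hj (left_mem_Icc.2 hpi.le))]
  rcases ha.eq_or_lt with ha0 | ha0
  · exfalso
    rw [← ha0] at hRv hLv hK
    have e0 : sechDeriv 0 0 = 1 := by simp [sechDeriv]
    have e1 : sechDeriv 1 0 = 0 := by simp [sechDeriv]
    rw [e0, mul_one] at hRv hLv
    rw [e1, mul_zero, mul_eq_zero, or_iff_right hN0.ne', sub_eq_zero] at hK
    exact false_of_deriv_eq_of_ends_eq hk hfd hfd' (h.singleLobe j₀) hRv hLv hK
  · set τ := Real.log (Real.sinh a) with hτ
    have hshift : tailShift τ = a := tailShift_log_sinh ha0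
    -- Equal end values give equal squares of the end derivatives. The Kirchhoff sum is nonzero for
    -- a > 0, so the derivatives are opposite and Kirchhoff determines them.
    have hen := energy_eq (convex_Icc _ _) hfd hfd' (left_mem_Icc.2 hpi.le) (right_mem_Icc.2 hpi.le)
    have hsq : f' Real.pi ^ 2 = f' (-Real.pi) ^ 2 := by
      rw [show ψ.loop j₀ = f from rfl, hRv, hLv] at hen
      linarith
    have hneg : sechDeriv 1 a < 0 := by
      simp only [sechDeriv, Matrix.cons_val_one, Matrix.cons_val_zero]
      have h1 := Real.sinh_pos_iff.2 ha0
      have h2 := Real.cosh_pos a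
      exact neg_neg_of_pos (by positivity)
    have hne : f' Real.pi - f' (-Real.pi) ≠ 0 := by
      intro h0
      rw [h0, mul_zero] at hK
      exact (mul_neg_of_pos_of_neg (pow_pos hk 2) hneg).ne hK.symm
    have hopp : f' (-Real.pi) = -f' Real.pi := by
      rcases sq_eq_sq_iff_eq_or_eq_neg.1 hsq with h1 | h1
      · exact absurd (sub_eq_zero.2 h1) hne
      · linarith
    have hval : f Real.pi = k * dnoidal (1 / (2 * N)) τ (endTime (1 / (2 * N)) τ) := by
      rw [hRv, dnoidal, phase_endTime hc hc1, profile_endPhase hc hc1, hshift]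
      rfl
    have hder : f' Real.pi = k ^ 2 * dnoidalDeriv (1 / (2 * N)) τ (endTime (1 / (2 * N)) τ) := by
      have h1 := tanh_div_cosh_tailShift hc τ
      rw [hshift, Real.tanh_eq_sinh_div_cosh, div_div, ← sq] at h1
      rw [dnoidalDeriv, phase_endTime hc hc1]
      rw [hopp] at hK
      have h2 : sechDeriv 1 a = -(Real.sinh a / Real.cosh a ^ 2) := rfl
      rw [h2, h1] at hK
      field_simp at hK ⊢
      linarith
    obtain ⟨hkw, hloop⟩ := loop_eq_dnoidal hc hc1 hk hfd hfd' (h.singleLobe j₀) hval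
      (hLv.trans hRv.symm) hder hopp
    refine ⟨τ, hkw, eq_flowerState_of_eqOn hN hr (fun j => (h.symmetric j j₀).trans hloop) ?_⟩
    intro x hx
    rw [htail hx, hkw]
    simp [tailFamily, hshift]

end

theorem theorem1 (N : ℕ) (hN : 1 ≤ N) :
    ∃ Φ : ℝ → H2NK N,
      (∀ ω : ℝ, ω < 0 →
        (∃ φ : FlowerFun N,
          IsPositiveSingleLobeSymmetricState ω (Φ ω) φ ∧
          (∀ j, ∀ x ∈ Icc (-Real.pi) Real.pi, φ.loop j (-x) = φ.loop j x) ∧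
          (∀ j, StrictAntiOn (φ.loop j) (Icc 0 Real.pi)) ∧
          StrictAntiOn φ.tail (Ici 0)) ∧
        (∀ (Ψ : H2NK N) (ψ : FlowerFun N),
          IsPositiveSingleLobeSymmetricState ω Ψ ψ → AntitoneOn ψ.tail (Ici 0) → Ψ = Φ ω)) ∧
      ContDiffOn ℝ 1 Φ (Iio 0) ∧
      ContDiffOn ℝ 1 (fun ω => mass (Φ ω).1) (Iio 0) ∧
      StrictAntiOn (fun ω => mass (Φ ω).1) (Iio 0) ∧
      Tendsto (fun ω => mass (Φ ω).1) (𝓝[<] 0) (𝓝 0) ∧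
      Tendsto (fun ω => mass (Φ ω).1) atBot atTop := by
  have hn := one_le_cast hN
  have hc := one_div_two_mul_pos hn
  have hc1 := one_div_two_mul_lt_one hn
  have hpi := Real.pi_pos
  set σ := freqParam hc hc1 with hσ
  have hwave : ∀ ω < 0, waveNumber (1 / (2 * N)) (σ ω) = √(-ω) := fun ω hω => by
    rw [waveNumber, endTime_freqParam hc hc1 hω, mul_div_cancel_left₀ _ hpi.ne']
  have hfreq : ∀ ω : ℝ, ω < 0 → -√(-ω) ^ 2 = ω := fun ω hω => by
    rw [Real.sq_sqrt (by linarith), neg_neg]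
  refine ⟨fun ω => flowerState hN (σ ω), fun ω hω => ⟨⟨flowerFun N (σ ω), ?_,
    fun _ x _ => loopFamily_neg hN _ x, fun _ => strictAntiOn_loopFamily hN _,
    strictAntiOn_tailFamily hN _⟩, fun Ψ ψ h hanti => ?_⟩, ?_, ?_, ?_, ?_, ?_⟩
  · have h := isPositiveSingleLobeSymmetricState_flowerState hN (σ ω)
    rwa [hwave ω hω, hfreq ω hω] at h
  · rw [← hfreq ω hω] at h
    obtain ⟨τ, hk, rfl⟩ := exists_eq_flowerState hN (Real.sqrt_pos.2 (neg_pos.2 hω)) h hanti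
    have h1 : τ = σ ω := by
      apply (strictMono_endTime hc hc1).injective
      rw [← waveNumber_mul_pi τ, ← waveNumber_mul_pi (σ ω), hwave ω hω, hk]
    rw [h1]
  · exact (contDiff_flowerState hN).comp_contDiffOn (contDiffOn_freqParam hc hc1)
  all_goals simp_rw [mass_flowerState hN]
  · exact (((contDiff_endTime hc hc1).mul (contDiff_scaledMass hn)).div_const _).comp_contDiffOn
      (contDiffOn_freqParam hc hc1)
  -- The parameter τ decreases in ω while T M increases in τ.
  · intro a ha b hb hab
    exact div_lt_div_of_pos_right (strictMono_endTime_mul_scaledMass hn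
      (strictAntiOn_freqParam hc hc1 ha hb hab)) hpi
  · have h := ((tendsto_endTime_mul_scaledMass_atBot hn).comp
      (tendsto_freqParam_zero hc hc1)).div_const Real.pi
    rwa [zero_div] at h
  · exact ((tendsto_endTime_mul_scaledMass_atTop hn).comp
      (tendsto_freqParam_atBot hc hc1)).atTop_div_const hpi
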